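/- **Setting.** Consider the screened Poisson equation $-\Delta u+\omega^2u=f$ on a rectangle $[a,b]\times[c,d]$ with zero Dirichlet conditions, or with zero Neumann conditions and $\omega\ne0$. Take partitions of $[a,b]$ and $[c,d]$ into $m\ge1$ and $n\ge1$ elements and a polynomial degree $p\ge1$. In each direction use the basis consisting of the piecewise linear hat functions (without the two boundary hats in the Dirichlet case), followed, for $k=0,\dots,p-2$, by the functions that equal the affinely mapped integrated Legendre polynomial $W_k(x)=(1-x^2)C_k^{(3/2)}(x)/((k+1)(k+2))$ on one element and vanish on the others. Let $M_x,M_y$ be the mass matrices and $A_x,A_y$ the matrices $-\Delta+\tfrac{\omega^2}{2}M$. Let $N\ge 1$ be the larger of the numbers of degrees of freedom in the two directions (both assumed positive), and $\nu=\max(m,n)$. The discrete problem is the generalised Sylvester equation $AUC-DUB=F$ with $A=A_x$, $B=-A_y$, $C=M_y$, $D=M_x$. Write $\sigma(X,Y)=\{\lambda: X-\lambda Y\text{ is singular}\}$. **Algorithm (generalised ADI), tolerance $0<\epsilon<1$.** *Precomputation.* From the entries of $A,B,C,D$ and from $\epsilon$: find intervals $[\alpha_1,\alpha_2]\supseteq\sigma(A,D)$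 and $[\beta_1,\beta_2]\supseteq\sigma(B,C)$ with $\alpha_1<\alpha_2$ and $\beta_1<\beta_2$, each of whose endpoints agrees with a generalised eigenvalue up to a fixed relative accuracy $\delta\in(0,1)$; set $$\gamma=\frac{|\beta_1-\alpha_1||\beta_2-\alpha_2|}{|\beta_1-\alpha_2||\beta_2-\alpha_1|},\qquad J=\Big\lceil \frac{\log(16\gamma)\log(4/\epsilon)}{\pi^2}\Big\rceil ;$$ compute the shifts $p_j=T(-\alpha\,\mathrm{dn}(\tfrac{2j-1}{2J}K(k),k))$ and $q_j=T(\alpha\,\mathrm{dn}(\tfrac{2j-1}{2J}K(k),k))$, $1\le j\le J$, where $\alpha=-1+2\gamma+2\sqrt{\gamma^2-\gamma}$, $k=\sqrt{1-\alpha^{-2}}$, $K$ is the complete elliptic integral of the first kind, $\mathrm{dn}$ the Jacobi elliptic function, and $T$ the Möbius map taking $-\alpha,-1,1,\alpha$ to $\alpha_1,\alpha_2,\beta_1,\beta_2$; and compute the reverse Cholesky factorisations $L_j^\top L_j=A-q_jD$ and $R_j^\top R_j=p_jC-B$ ($L_j,R_j$ lower triangular with positive diagonal). *Solve.* Given $F$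 and the precomputed data, set $W_0=0$ and for $j=1,\dots,J$ $$W_{j-1/2}=(F-(A-p_jD)W_{j-1})(B-p_jC)^{-1},\qquad W_j=(A-q_jD)^{-1}(F-W_{j-1/2}(B-q_jC));$$ return $W_JC^{-1}$. **Cost model.** An operation is a real $+,-,\times,\div$, a square root, a comparison, writing a rational constant, or an evaluation of $\sinh,\cosh,\tanh,\log,K,\mathrm{dn}$; rounding a real $x$ up to a natural number costs $\lceil x\rceil+1$ operations. Programs are algebraic computation trees, one for each boundary condition and $(m,n,p)$ (and $J$, for the solve), which take the real data above as input. **Theorem.** For every $\delta\in(0,1)$ there are such programs for the precomputation and for the solve with the following properties. 1. The precomputation uses $O(\nu N^2+JN)$ operations, with a constant that depends only on $\delta$. 2. Each solve uses $O(JN^2)$ operations, with a constant that depends only on $\delta$. 3. For a fixed rectangle, boundary condition and $\omega$, and for partitions in which the ratio of any two element lengths is at least a fixed $\rho>0$, uniformly for $N\ge2$ and $0<\epsilon\le\tfrac12$: $J=O(\log N\log\epsilon^{-1})$, the precomputation uses $O(\nu N^2+N\log N\log\epsilon^{-1})$ operations, and each solve uses $O(N^2\log N\log\epsilon^{-1})$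 operations, with constants that depend only on $\delta,\rho,\omega$, the rectangle and the boundary condition. 4. If moreover the number of elements is bounded, $\nu\le n_0$ (so that $N\to\infty$ means $p\to\infty$), the precomputation uses $O(N^2+N\log N\log\epsilon^{-1})$ operations and precomputation and solve together use $O(N^2\log N\log\epsilon^{-1})$ operations, that is, quasi-optimal complexity; here the constants may also depend on $n_0$. -/

import Mathlib

open Polynomial

noncomputable section

namespace GenADI

/-! ### Operation counts: real computation trees

A program works on a growing list of real registers, which initially holds the input. It is an
algebraic computation tree: which registers are used may depend on the control flow, but never on
the value of a register other than through `branch` and `ceil`; the only literal constants are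
rational. -/

/-- The incomplete elliptic integral of the first kind `F(φ, k)`, with modulus `k`. -/
def ellF (φ k : ℝ) : ℝ := ∫ θ in (0 : ℝ)..φ, 1 / Real.sqrt (1 - k ^ 2 * Real.sin θ ^ 2)

/-- The complete elliptic integral of the first kind `K(k)`, with modulus `k`. -/
def ellK (k : ℝ) : ℝ := ellF (Real.pi / 2) k

/-- The Jacobi amplitude `am(u, k)`: the inverse of `φ ↦ F(φ, k)` (a bijection for `0 ≤ k < 1`). -/
def jacobiAm (u k : ℝ) : ℝ := Function.invFun (fun φ => ellF φ k) u

/-- The Jacobi elliptic function `dn(u, k)`, with modulus `k`. -/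
def jacobiDn (u k : ℝ) : ℝ := Real.sqrt (1 - k ^ 2 * Real.sin (jacobiAm u k) ^ 2)

/-- Unary unit-cost operations: square root and special functions of one variable. -/
inductive UnOp
  | sqrt
  | sinh
  | cosh
  | tanh
  | log
  | ellK

/-- Binary unit-cost operations: field operations and the elliptic function `dn(u, k)`. -/
inductive BinOp
  | add
  | sub
  | mul
  | div
  | dn

def UnOp.eval : UnOp → ℝ → ℝ
  | .sqrt, x => Real.sqrt x
  | .sinh, x => Real.sinh x
  | .cosh, x => Real.cosh x
  | .tanh, x => Real.tanh x
  | .log, x => Real.log x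
  | .ellK, x => GenADI.ellK x

def BinOp.eval : BinOp → ℝ → ℝ → ℝ
  | .add, x, y => x + y
  | .sub, x, y => x - y
  | .mul, x, y => x * y
  | .div, x, y => x / y
  | .dn, x, y => jacobiDn x y

/-- Programs. Register addresses are natural numbers; the instructions `const`, `un`, `bin` append
one new register, `branch i j s t` continues with `s` if register `i` is smaller than register `j`
and with `t` otherwise, `ceil i t` continues with `t r`, where `r` is register `i` rounded up to a
natural number, and `ret l` stops and returns the registers listed in `l`. -/
inductive Prog
  | ret (l : List ℕ)
  | const (q : ℚ) (t : Prog)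
  | un (f : UnOp) (i : ℕ) (t : Prog)
  | bin (f : BinOp) (i j : ℕ) (t : Prog)
  | branch (i j : ℕ) (s t : Prog)
  | ceil (i : ℕ) (t : ℕ → Prog)

/-- The content of register `i`. -/
def reg (mem : List ℝ) (i : ℕ) : ℝ := mem.getD i 0

/-- The list of values that a program returns. -/
def Prog.output : Prog → List ℝ → List ℝ
  | .ret l, mem => l.map (reg mem)
  | .const q t, mem => t.output (mem ++ [(q : ℝ)])
  | .un f i t, mem => t.output (mem ++ [f.eval (reg mem i)])
  | .bin f i j t, mem => t.output (mem ++ [f.eval (reg mem i) (reg mem j)])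
  | .branch i j s t, mem =>
      open Classical in if reg mem i < reg mem j then s.output mem else t.output mem
  | .ceil i t, mem => (t ⌈reg mem i⌉₊).output mem

/-- The number of operations that a program executes. Every instruction costs one operation, except
that rounding `x` up costs `⌈x⌉ + 1` (comparing `x` with `0, 1, 2, …` in turn). -/
def Prog.cost : Prog → List ℝ → ℕ
  | .ret _, _ => 0
  | .const q t, mem => t.cost (mem ++ [(q : ℝ)]) + 1
  | .un f i t, mem => t.cost (mem ++ [f.eval (reg mem i)]) + 1
  | .bin f i j t, mem => t.cost (mem ++ [f.eval (reg mem i) (reg mem j)]) + 1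
  | .branch i j s t, mem =>
      (open Classical in if reg mem i < reg mem j then s.cost mem else t.cost mem) + 1
  | .ceil i t, mem => (t ⌈reg mem i⌉₊).cost mem + (⌈reg mem i⌉₊ + 1)

/-- The entries of a matrix, row by row. -/
def matList {M N : ℕ} (X : Matrix (Fin M) (Fin N) ℝ) : List ℝ :=
  (List.ofFn fun i => List.ofFn (X i)).flatten

/-! ### The generalised ADI algorithm for `A U C - D U B = F` -/

/-- The generalised spectrum `σ(A, B)`. -/
def genSpectrum {N : ℕ} (A B : Matrix (Fin N) (Fin N) ℝ) : Set ℝ :=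
  {lam | ¬ IsUnit (A - lam • B)}

/-- `L` is the reverse Cholesky factor of `A`: `A = Lᵀ L`, `L` lower triangular with positive
diagonal. -/
def IsRevCholesky {N : ℕ} (A L : Matrix (Fin N) (Fin N) ℝ) : Prop :=
  (∀ i j, i < j → L i j = 0) ∧ (∀ i, 0 < L i i) ∧ A = L.transpose * L

/-- `a` and `b` are the extreme points of the set `S` up to the relative error `δ`, rounded
outwards. -/
def IsEnclosure (δ : ℝ) (S : Set ℝ) (a b : ℝ) : Prop :=
  a < b ∧ S ⊆ Set.Icc a b ∧ (∃ s ∈ S, |a - s| ≤ δ * |s|) ∧ (∃ s ∈ S, |b - s| ≤ δ * |s|)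

/-- The cross-ratio `γ`. -/
def adiGamma (a b c d : ℝ) : ℝ := |c - a| * |d - b| / (|c - b| * |d - a|)

/-- The number of iterations `J`. -/
def adiCount (a b c d ε : ℝ) : ℕ :=
  ⌈Real.log (16 * adiGamma a b c d) * Real.log (4 / ε) / Real.pi ^ 2⌉₊

/-- The parameter `α > 1` for which `(-α, -1, 1, α)` and `(a, b, c, d)` have the same
cross-ratio. -/
def adiAlpha (a b c d : ℝ) : ℝ :=
  -1 + 2 * adiGamma a b c d + 2 * Real.sqrt (adiGamma a b c d ^ 2 - adiGamma a b c d)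

/-- The Möbius transformation that maps `-α, -1, 1` to `a, b, c` (and hence `α` to `d`). -/
def adiMobius (a b c d z : ℝ) : ℝ :=
  (a * ((z - 1) * (adiAlpha a b c d - 1) * (b - c)) + c * (2 * (z + adiAlpha a b c d) * (b - a))) /
    ((z - 1) * (adiAlpha a b c d - 1) * (b - c) + 2 * (z + adiAlpha a b c d) * (b - a))

/-- The modulus `√(1 - 1/α²)`. -/
def adiModulus (a b c d : ℝ) : ℝ := Real.sqrt (1 - 1 / adiAlpha a b c d ^ 2)

/-- `dn((2j-1)/(2J) K(k), k)` for `k = √(1 - 1/α²)`; the index is `i = j - 1`. -/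
def adiDn (a b c d : ℝ) (J i : ℕ) : ℝ :=
  jacobiDn ((2 * (i : ℝ) + 1) / (2 * (J : ℝ)) * ellK (adiModulus a b c d)) (adiModulus a b c d)

/-- The shift `p_j`, `j = i + 1`. -/
def adiShiftP (a b c d : ℝ) (J i : ℕ) : ℝ :=
  adiMobius a b c d (-(adiAlpha a b c d * adiDn a b c d J i))

/-- The shift `q_j`, `j = i + 1`. -/
def adiShiftQ (a b c d : ℝ) (J i : ℕ) : ℝ :=
  adiMobius a b c d (adiAlpha a b c d * adiDn a b c d J i)

/-- What the precomputation hands over to the solve. -/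
structure ADIData (M N : ℕ) where
  a : ℝ
  b : ℝ
  c : ℝ
  d : ℝ
  J : ℕ
  p : Fin J → ℝ
  q : Fin J → ℝ
  L : Fin J → Matrix (Fin M) (Fin M) ℝ
  R : Fin J → Matrix (Fin N) (Fin N) ℝ

/-- The data as a list of reals (`J` can be read off from its length). -/
def ADIData.toList {M N : ℕ} (S : ADIData M N) : List ℝ :=
  [S.a, S.b, S.c, S.d] ++ List.ofFn S.p ++ List.ofFn S.q ++
    (List.ofFn fun j => matList (S.L j)).flatten ++ (List.ofFn fun j => matList (S.R j)).flatten

/-- `S` is a result of the precomputation for `A, B, C, D` and tolerance `ε`, where the extreme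
generalised eigenvalues are computed to relative accuracy `δ`. As `B - p_j C` is negative definite
in the case at hand, the matrix that is factorised is `p_j C - B`. -/
structure ADIData.IsPrecomputation {M N : ℕ} (S : ADIData M N) (δ ε : ℝ)
    (A : Matrix (Fin M) (Fin M) ℝ) (B C : Matrix (Fin N) (Fin N) ℝ)
    (D : Matrix (Fin M) (Fin M) ℝ) : Prop where
  encl_left : IsEnclosure δ (genSpectrum A D) S.a S.b
  encl_right : IsEnclosure δ (genSpectrum B C) S.c S.d
  count : S.J = adiCount S.a S.b S.c S.d ε
  shift_p : ∀ j, S.p j = adiShiftP S.a S.b S.c S.d S.J j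
  shift_q : ∀ j, S.q j = adiShiftQ S.a S.b S.c S.d S.J j
  chol_left : ∀ j, IsRevCholesky (A - S.q j • D) (S.L j)
  chol_right : ∀ j, IsRevCholesky (S.p j • C - B) (S.R j)

/-- One ADI step `W_{j-1} ↦ W_j` with shifts `p_j = s` and `q_j = t`. -/
def adiStep {M N : ℕ} (A : Matrix (Fin M) (Fin M) ℝ) (B C : Matrix (Fin N) (Fin N) ℝ)
    (D : Matrix (Fin M) (Fin M) ℝ) (F : Matrix (Fin M) (Fin N) ℝ) (s t : ℝ)
    (W : Matrix (Fin M) (Fin N) ℝ) : Matrix (Fin M) (Fin N) ℝ :=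
  let W' : Matrix (Fin M) (Fin N) ℝ := (F - (A - s • D) * W) * (B - s • C)⁻¹
  (A - t • D)⁻¹ * (F - W' * (B - t • C))

/-- The matrix `W_J C⁻¹` returned by the solve. -/
def adiSolution {M N : ℕ} (A : Matrix (Fin M) (Fin M) ℝ) (B C : Matrix (Fin N) (Fin N) ℝ)
    (D : Matrix (Fin M) (Fin M) ℝ) (F : Matrix (Fin M) (Fin N) ℝ) (S : ADIData M N) :
    Matrix (Fin M) (Fin N) ℝ :=
  Fin.foldl S.J (fun W j => adiStep A B C D F (S.p j) (S.q j) W) 0 * C⁻¹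

/-! ### The `hp`-finite element discretisation -/

/-- The Legendre polynomial `P_k` (Rodrigues' formula). -/
def legendreP (k : ℕ) : ℝ[X] :=
  Polynomial.C (1 / (2 ^ k * (k.factorial : ℝ))) * derivative^[k] ((X ^ 2 - 1) ^ k)

/-- The integrated Legendre polynomial
`W_k = (1 - x²) C_k^{(3/2)} / ((k+1)(k+2))`, that is, the polynomial with `W_k' = -P_{k+1}` and
`W_k(±1) = 0`. -/
def bubbleW (k : ℕ) : ℝ[X] :=
  -(Polynomial.C (1 / (2 ^ (k + 1) * ((k + 1).factorial : ℝ))) *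
    derivative^[k] ((X ^ 2 - 1) ^ (k + 1)))

theorem derivative_bubbleW (k : ℕ) : derivative (bubbleW k) = -legendreP (k + 1) := by
  simp only [bubbleW, legendreP, derivative_neg, derivative_C_mul, Function.iterate_succ_apply']

theorem bubbleW_eval_of_sq_eq_one (k : ℕ) {t : ℝ} (ht : t ^ 2 = 1) : (bubbleW k).eval t = 0 := by
  have h := pow_sub_dvd_iterate_derivative_pow (X ^ 2 - 1 : ℝ[X]) (k + 1) k
  obtain ⟨r, hr⟩ := h
  rw [bubbleW, hr]
  simp [ht]

/-- A partition `a = x_0 < x_1 < ⋯ < x_n = b` (only `node 0, …, node n` matter). -/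
structure Mesh (a b : ℝ) (n : ℕ) where
  node : ℕ → ℝ
  node_zero : node 0 = a
  node_last : node n = b
  node_lt : ∀ j < n, node j < node (j + 1)

/-- The ratio of the lengths of any two elements is at least `ρ`. -/
def Mesh.QuasiUniform {a b : ℝ} {n : ℕ} (x : Mesh a b n) (ρ : ℝ) : Prop :=
  ∀ i < n, ∀ j < n, ρ * (x.node (j + 1) - x.node j) ≤ x.node (i + 1) - x.node i

/-- The hat function `h_j`, `0 ≤ j ≤ n`. -/
def Mesh.hat {a b : ℝ} {n : ℕ} (x : Mesh a b n) (j : ℕ) (t : ℝ) : ℝ :=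
  open Classical in
  if 1 ≤ j ∧ x.node (j - 1) ≤ t ∧ t ≤ x.node j then
    (t - x.node (j - 1)) / (x.node j - x.node (j - 1))
  else if j + 1 ≤ n ∧ x.node j ≤ t ∧ t ≤ x.node (j + 1) then
    (x.node (j + 1) - t) / (x.node (j + 1) - x.node j)
  else 0

/-- The bubble function of index `k` on the element `[x_e, x_{e+1}]`, `0 ≤ e < n`. -/
def Mesh.bubble {a b : ℝ} {n : ℕ} (x : Mesh a b n) (k e : ℕ) (t : ℝ) : ℝ :=
  open Classical in
  if x.node e ≤ t ∧ t ≤ x.node (e + 1) then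
    (bubbleW k).eval ((2 * t - x.node e - x.node (e + 1)) / (x.node (e + 1) - x.node e))
  else 0

/-- The boundary condition. -/
inductive BC
  | dirichlet
  | neumann

/-- The number of hat functions in the basis on `n` elements. -/
def BC.numHats : BC → ℕ → ℕ
  | .dirichlet, n => n - 1
  | .neumann, n => n + 1

/-- The index of the first hat function in the basis. -/
def BC.firstHat : BC → ℕ
  | .dirichlet => 1
  | .neumann => 0

/-- The number of degrees of freedom on `n ≥ 1` elements with degree `p ≥ 1`: `pn - 1` for
Dirichlet and `pn + 1` for Neumann conditions. -/
def BC.dof (bc : BC) (n p : ℕ) : ℕ := bc.numHats n + n * (p - 1)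

/-- The basis `[hats | W_{0,1}, …, W_{0,n} | W_{1,1}, …, W_{1,n} | ⋯]`. -/
def Mesh.basis {a b : ℝ} {n : ℕ} (x : Mesh a b n) (bc : BC) (i : ℕ) : ℝ → ℝ :=
  if i < bc.numHats n then x.hat (bc.firstHat + i)
  else x.bubble ((i - bc.numHats n) / n) ((i - bc.numHats n) % n)

/-- The mass matrix. -/
def Mesh.mass {a b : ℝ} {n : ℕ} (x : Mesh a b n) (bc : BC) (p : ℕ) :
    Matrix (Fin (bc.dof n p)) (Fin (bc.dof n p)) ℝ :=
  Matrix.of fun i j => ∫ t in a..b, x.basis bc i t * x.basis bc j t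

/-- The weak (negative) Laplacian. -/
def Mesh.stiffness {a b : ℝ} {n : ℕ} (x : Mesh a b n) (bc : BC) (p : ℕ) :
    Matrix (Fin (bc.dof n p)) (Fin (bc.dof n p)) ℝ :=
  Matrix.of fun i j => ∫ t in a..b, deriv (x.basis bc i) t * deriv (x.basis bc j) t

/-- The matrix `-Δ + (ω²/2) M`. -/
def Mesh.screened {a b : ℝ} {n : ℕ} (x : Mesh a b n) (bc : BC) (ω : ℝ) (p : ℕ) :
    Matrix (Fin (bc.dof n p)) (Fin (bc.dof n p)) ℝ :=
  x.stiffness bc p + (ω ^ 2 / 2) • x.mass bc p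

/-- A discretisation of the screened Poisson equation `-Δu + ω² u = f` on `[a, b] × [c, d]` by
tensor products of piecewise polynomials of degree `p` on `m × n` rectangular elements. -/
structure Discretisation (bc : BC) (a b c d ω : ℝ) (m n p : ℕ) where
  x : Mesh a b m
  y : Mesh c d n
  one_le_m : 1 ≤ m
  one_le_n : 1 ≤ n
  one_le_p : 1 ≤ p
  dof_x_pos : 0 < bc.dof m p
  dof_y_pos : 0 < bc.dof n p
  omega_ne_zero : bc = BC.neumann → ω ≠ 0

namespace Discretisation

variable {bc : BC} {a b c d ω : ℝ} {m n p : ℕ}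

/-- The matrices of the generalised Sylvester equation `A U C - D U B = F`, which is
`A_x U M_y + M_x U A_y = F` for the screened Poisson equation. -/
def matA (P : Discretisation bc a b c d ω m n p) :
    Matrix (Fin (bc.dof m p)) (Fin (bc.dof m p)) ℝ := P.x.screened bc ω p

def matB (P : Discretisation bc a b c d ω m n p) :
    Matrix (Fin (bc.dof n p)) (Fin (bc.dof n p)) ℝ := -P.y.screened bc ω p

def matC (P : Discretisation bc a b c d ω m n p) :
    Matrix (Fin (bc.dof n p)) (Fin (bc.dof n p)) ℝ := P.y.mass bc p

def matD (P : Discretisation bc a b c d ω m n p) :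
    Matrix (Fin (bc.dof m p)) (Fin (bc.dof m p)) ℝ := P.x.mass bc p

/-- The maximal number of elements in either coordinate direction. -/
def numElem (_P : Discretisation bc a b c d ω m n p) : ℕ := max m n

/-- The maximal number of degrees of freedom in either coordinate direction. -/
def maxDof (_P : Discretisation bc a b c d ω m n p) : ℕ := max (bc.dof m p) (bc.dof n p)

/-- The entries of `A, B, C, D`. -/
def matrices (P : Discretisation bc a b c d ω m n p) : List ℝ :=
  matList P.matA ++ matList P.matB ++ matList P.matC ++ matList P.matD

/-- The input of the precomputation. -/
def preInput (P : Discretisation bc a b c d ω m n p) (ε : ℝ) : List ℝ := P.matrices ++ [ε]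

/-- `S` is a result of the precomputation for this discretisation. -/
def IsPre (P : Discretisation bc a b c d ω m n p) (δ ε : ℝ)
    (S : ADIData (bc.dof m p) (bc.dof n p)) : Prop :=
  S.IsPrecomputation δ ε P.matA P.matB P.matC P.matD

/-- The input of the solve with right-hand side `F`. -/
def solveInput (P : Discretisation bc a b c d ω m n p)
    (S : ADIData (bc.dof m p) (bc.dof n p))
    (F : Matrix (Fin (bc.dof m p)) (Fin (bc.dof n p)) ℝ) : List ℝ :=
  P.matrices ++ S.toList ++ matList F

/-- The result of the solve with right-hand side `F`. -/
def solution (P : Discretisation bc a b c d ω m n p)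
    (S : ADIData (bc.dof m p) (bc.dof n p))
    (F : Matrix (Fin (bc.dof m p)) (Fin (bc.dof n p)) ℝ) :
    Matrix (Fin (bc.dof m p)) (Fin (bc.dof n p)) ℝ :=
  adiSolution P.matA P.matB P.matC P.matD F S

end Discretisation

end GenADI

end

/-! Sparsity carries the cost bounds. A bubble `W_k` vanishes at the ends of its element and is
orthogonal to polynomials of degree below `k`. Hence the mass and stiffness matrices couple a bubble
only with bubbles of the same element whose index differs by at most two, and, if its own index is
at most one, with the hats of that element; hats couple with neighbouring hats. In the chosen order
of the basis each unknown has at most four earlier neighbours, and these are coupled to one another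
(`Coupled.clique`). Elimination from the last unknown to the first therefore creates no fill-in, and
the reverse Cholesky factors of all linear combinations of mass and stiffness share one pattern.
Factorising, solving with a factor and multiplying a vector cost `O(N)` each
(`Pattern.chol_computes`, `Pattern.solveVec_computes`, `Pattern.residual_computes`). An ADI step
applies such operations to the rows and columns of an array, hence `O(N²)`.

The extreme eigenvalues must also be found in `O(N²)` operations, whatever the conditioning. By
`Pattern.Conforms.posDef_iff`, deciding whether `t` exceeds the largest eigenvalue of a pencil `(X,
Y)` takes one sparse factorisation of `t Y - X`. The trace of `Y⁻¹ X`, computed with `N` sparse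
solves, lies between this eigenvalue and `N` times it. Starting from twice the trace and shrinking
by a fixed ratio, `O(N)` tests suffice (`Pattern.lamMax_computes`). The smallest eigenvalue comes
from the pencil with its matrices swapped.

The matrices to be factorised are positive definite because `p_j > 0 > q_j`. The only fact about
elliptic functions needed for this is `1/α ≤ dn ≤ 1` (`adiDn_mem`); the rest is the sign of a Möbius
transformation.

Finally `J` is logarithmic in `N` because `γ ≤ α₂/α₁` is polynomial in `N`: eigenvalues are bounded
below by a Poincaré inequality or by the term with `ω²`, and above by an inverse inequality. Crude
exponents there affect only constants, since only `log γ` enters.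

Programs are written in continuation-passing style; `Frag.Computes` records correctness and cost
together and composes through `Frag.Computes.bind`. -/

noncomputable section

namespace GenADI

/-! ### Program fragments -/

/-- Register `i` exists and holds the value `v`. -/
def Holds (mem : List ℝ) (i : ℕ) (v : ℝ) : Prop := mem[i]? = some v

theorem Holds.reg {mem : List ℝ} {i : ℕ} {v : ℝ} (h : Holds mem i v) : reg mem i = v := by
  unfold Holds at h
  simp [GenADI.reg, List.getD, h]

theorem Holds.mono {mem mem' : List ℝ} {i : ℕ} {v : ℝ} (h : Holds mem i v)
    (hm : mem <+: mem') : Holds mem' i v := by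
  obtain ⟨t, rfl⟩ := hm
  unfold Holds at *
  rw [List.getElem?_append_left (List.getElem?_eq_some_iff.1 h).1, h]

theorem holds_append (mem : List ℝ) (v : ℝ) : Holds (mem ++ [v]) mem.length v := by
  simp [Holds]

/-- A program fragment: given the number of registers in use and the continuation, a program. -/
def Frag (α : Type) : Type := ℕ → (α → ℕ → Prog) → Prog

namespace Frag

variable {α β σ : Type} {ι : Type}

instance : Monad Frag where
  pure a := fun s k => k a s
  bind f g := fun s k => f s fun a s' => g a s' k

def const (q : ℚ) : Frag ℕ := fun s k => .const q (k s (s + 1))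

def un (f : UnOp) (i : ℕ) : Frag ℕ := fun s k => .un f i (k s (s + 1))

def bin (f : BinOp) (i j : ℕ) : Frag ℕ := fun s k => .bin f i j (k s (s + 1))

/-- Each branch receives the whole continuation, so the program is a tree and the branches may
return different addresses. -/
def ifLt (i j : ℕ) (f g : Frag α) : Frag α := fun s k => .branch i j (f s k) (g s k)

def ceil (i : ℕ) : Frag ℕ := fun s k => .ceil i fun r => k r s

/-- Started with memory `mem`, the fragment appends registers, returns a result that satisfies `Q`,
and performs at most `c` operations. -/
def Computes (f : Frag α) (mem : List ℝ) (c : ℕ) (Q : α → List ℝ → Prop) : Prop :=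
  ∃ a mem', mem <+: mem' ∧ Q a mem' ∧ ∀ k : α → ℕ → Prog,
    (f mem.length k).output mem = (k a mem'.length).output mem' ∧
      (f mem.length k).cost mem ≤ (k a mem'.length).cost mem' + c

namespace Computes

variable {f : Frag α} {g : α → Frag β} {mem : List ℝ} {c c₁ c₂ : ℕ}
  {P : α → List ℝ → Prop} {Q : β → List ℝ → Prop}

theorem mono {P' : α → List ℝ → Prop} (h : f.Computes mem c₁ P') (hc : c₁ ≤ c)
    (hP : ∀ a mem', mem <+: mem' → P' a mem' → P a mem') : f.Computes mem c P := by
  obtain ⟨a, mem', hm, hQ, hk⟩ := h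
  exact ⟨a, mem', hm, hP a mem' hm hQ, fun k => ⟨(hk k).1, (hk k).2.trans (by omega)⟩⟩

theorem pure {a : α} (h : P a mem) : (Pure.pure a : Frag α).Computes mem 0 P :=
  ⟨a, mem, List.prefix_rfl, h, fun _ => ⟨rfl, le_rfl⟩⟩

/-- The specification holds for all continuations, so that of `f` may be taken to be `g` followed by
an arbitrary one; costs add along the executed path. -/
theorem bind (hf : f.Computes mem c₁ P)
    (hg : ∀ a mem', mem <+: mem' → P a mem' → (g a).Computes mem' c₂ Q) :
    (f >>= g).Computes mem (c₁ + c₂) Q := by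
  obtain ⟨a, mem', hm, hP, hk⟩ := hf
  obtain ⟨b, mem'', hm', hQ, hk'⟩ := hg a mem' hm hP
  refine ⟨b, mem'', hm.trans hm', hQ, fun k => ?_⟩
  have h₁ := hk fun a s' => g a s' k
  have h₂ := hk' k
  exact ⟨h₁.1.trans h₂.1, h₁.2.trans (by omega)⟩

theorem const (q : ℚ) : (Frag.const q).Computes mem 1 fun a m => Holds m a q :=
  ⟨mem.length, mem ++ [(q : ℝ)], List.prefix_append _ _, holds_append _ _, fun k => by
    simp [Frag.const, Prog.output, Prog.cost]⟩

theorem un {i : ℕ} {v : ℝ} (op : UnOp) (h : Holds mem i v) :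
    (Frag.un op i).Computes mem 1 fun a m => Holds m a (op.eval v) :=
  ⟨mem.length, mem ++ [op.eval v], List.prefix_append _ _, holds_append _ _, fun k => by
    simp [Frag.un, Prog.output, Prog.cost, h.reg]⟩

theorem bin {i j : ℕ} {v w : ℝ} (op : BinOp) (hi : Holds mem i v) (hj : Holds mem j w) :
    (Frag.bin op i j).Computes mem 1 fun a m => Holds m a (op.eval v w) :=
  ⟨mem.length, mem ++ [op.eval v w], List.prefix_append _ _, holds_append _ _, fun k => by
    simp [Frag.bin, Prog.output, Prog.cost, hi.reg, hj.reg]⟩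

theorem ifLt {i j : ℕ} {v w : ℝ} {f g : Frag α} (hi : Holds mem i v) (hj : Holds mem j w)
    (hf : v < w → f.Computes mem c P) (hg : ¬ v < w → g.Computes mem c P) :
    (Frag.ifLt i j f g).Computes mem (c + 1) P := by
  by_cases h : v < w
  · obtain ⟨a, mem', hm, hP, hk⟩ := hf h
    refine ⟨a, mem', hm, hP, fun k => ?_⟩
    have := hk k
    simp only [Frag.ifLt, Prog.output, Prog.cost, hi.reg, hj.reg, h, if_true]
    exact ⟨this.1, by omega⟩
  · obtain ⟨a, mem', hm, hP, hk⟩ := hg h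
    refine ⟨a, mem', hm, hP, fun k => ?_⟩
    have := hk k
    simp only [Frag.ifLt, Prog.output, Prog.cost, hi.reg, hj.reg, h, if_false]
    exact ⟨this.1, by omega⟩

/-- The result is a natural number known to the rest of the program, not a register: this is how the
number of iterations shapes the code that follows. -/
theorem ceil {i : ℕ} {v : ℝ} (h : Holds mem i v) :
    (Frag.ceil i).Computes mem (⌈v⌉₊ + 1) fun a _ => a = ⌈v⌉₊ :=
  ⟨⌈v⌉₊, mem, List.prefix_rfl, rfl, fun k => by
    simp [Frag.ceil, Prog.output, Prog.cost, h.reg]⟩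

end Computes

end Frag

/-! ### Arithmetic expressions -/

/-- Arithmetic expressions in the registers. -/
inductive Expr
  | reg (i : ℕ)
  | const (q : ℚ)
  | un (f : UnOp) (e : Expr)
  | bin (f : BinOp) (e₁ e₂ : Expr)

namespace Expr

instance : Add Expr := ⟨.bin .add⟩
instance : Sub Expr := ⟨.bin .sub⟩
instance : Mul Expr := ⟨.bin .mul⟩
instance : Div Expr := ⟨.bin .div⟩

/-- The number of operations in an expression. -/
def size : Expr → ℕ
  | .reg _ => 0
  | .const _ => 1
  | .un _ e => e.size + 1
  | .bin _ e₁ e₂ => e₁.size + e₂.size + 1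

/-- The expression is well-formed and has the value `v`. -/
inductive Denotes (mem : List ℝ) : Expr → ℝ → Prop
  | reg {i v} : Holds mem i v → Denotes mem (.reg i) v
  | const (q : ℚ) : Denotes mem (.const q) q
  | un (f : UnOp) {e v} : Denotes mem e v → Denotes mem (.un f e) (f.eval v)
  | bin (f : BinOp) {e₁ e₂ v₁ v₂} : Denotes mem e₁ v₁ → Denotes mem e₂ v₂ →
      Denotes mem (.bin f e₁ e₂) (f.eval v₁ v₂)

namespace Denotes

variable {mem mem' : List ℝ} {e e₁ e₂ : Expr} {v v₁ v₂ : ℝ}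

theorem mono (h : e.Denotes mem v) (hm : mem <+: mem') : e.Denotes mem' v := by
  induction h with
  | reg h => exact .reg (h.mono hm)
  | const q => exact .const q
  | un f _ ih => exact .un f ih
  | bin f _ _ ih₁ ih₂ => exact .bin f ih₁ ih₂

theorem add (h₁ : e₁.Denotes mem v₁) (h₂ : e₂.Denotes mem v₂) :
    (e₁ + e₂).Denotes mem (v₁ + v₂) := .bin .add h₁ h₂

theorem sub (h₁ : e₁.Denotes mem v₁) (h₂ : e₂.Denotes mem v₂) :
    (e₁ - e₂).Denotes mem (v₁ - v₂) := .bin .sub h₁ h₂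

theorem mul (h₁ : e₁.Denotes mem v₁) (h₂ : e₂.Denotes mem v₂) :
    (e₁ * e₂).Denotes mem (v₁ * v₂) := .bin .mul h₁ h₂

theorem div (h₁ : e₁.Denotes mem v₁) (h₂ : e₂.Denotes mem v₂) :
    (e₁ / e₂).Denotes mem (v₁ / v₂) := .bin .div h₁ h₂

theorem sqrt (h : e.Denotes mem v) : (Expr.un .sqrt e).Denotes mem (Real.sqrt v) := .un .sqrt h

theorem congr (h : e.Denotes mem v) (hv : v = v₁) : e.Denotes mem v₁ := hv ▸ h

end Denotes

end Expr

/-! ### Evaluation of expressions, sums, products, tables and loops -/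

namespace Frag

variable {α β σ : Type} {ι : Type} {mem : List ℝ}

/-- Evaluates an expression. -/
def expr : Expr → Frag ℕ
  | .reg i => pure i
  | .const q => const q
  | .un f e => do un f (← expr e)
  | .bin f e₁ e₂ => do
    let a ← expr e₁
    let b ← expr e₂
    bin f a b

theorem Computes.expr {e : Expr} {v : ℝ} (h : e.Denotes mem v) :
    (Frag.expr e).Computes mem e.size fun a m => Holds m a v := by
  induction e generalizing mem v with
  | reg i => cases h with | reg h => exact .pure h
  | const q => cases h; exact .const q
  | un f e ih =>
    cases h with | un _ h =>
    exact (ih h).bind fun a m _ ha => .un f ha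
  | bin f e₁ e₂ ih₁ ih₂ =>
    cases h with | bin _ h₁ h₂ =>
    refine ((ih₁ h₁).bind fun a m hm ha => (ih₂ (h₂.mono hm)).bind fun b m' hm' hb =>
      .bin f (ha.mono hm') hb).mono ?_ fun _ _ _ h => h
    simp [Expr.size]; omega

theorem Computes.expr_le {e : Expr} {v : ℝ} {c : ℕ} (h : e.Denotes mem v) (hc : e.size ≤ c) :
    (Frag.expr e).Computes mem c fun a m => Holds m a v :=
  (Computes.expr h).mono hc fun _ _ _ h => h

/-- The sum of the expressions `e i`, `i ∈ l`. -/
def sumList (e : ι → Expr) : List ι → Frag ℕ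
  | [] => const 0
  | i :: l => do
    let a ← sumList e l
    expr (.reg a + e i)

theorem Computes.sumList {e : ι → Expr} {v : ι → ℝ} {c : ℕ} (l : List ι)
    (h : ∀ i ∈ l, (e i).Denotes mem (v i)) (hc : ∀ i ∈ l, (e i).size ≤ c) :
    (Frag.sumList e l).Computes mem (1 + (c + 1) * l.length)
      fun a m => Holds m a (l.map v).sum := by
  induction l with
  | nil => exact (Computes.const 0).mono (by simp) fun a m _ h => by simpa using h
  | cons i l ih =>
    refine ((ih (fun j hj => h j (by simp [hj])) fun j hj => hc j (by simp [hj])).bind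
      fun a m hm ha => (Computes.expr_le (c := c + 1)
        (.add (.reg ha) ((h i (by simp)).mono hm)) ?_)).mono ?_ ?_
    · have := hc i (by simp)
      show 0 + (e i).size + 1 ≤ _
      omega
    · simp only [List.length_cons]; ring_nf; omega
    · intro a m _ ha
      simpa [add_comm] using ha

theorem Computes.sumFinset {e : ι → Expr} {v : ι → ℝ} {c : ℕ} (s : Finset ι)
    (h : ∀ i ∈ s, (e i).Denotes mem (v i)) (hc : ∀ i ∈ s, (e i).size ≤ c) :
    (Frag.sumList e s.toList).Computes mem (1 + (c + 1) * s.card)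
      fun a m => Holds m a (∑ i ∈ s, v i) := by
  have := Computes.sumList s.toList (mem := mem) (e := e) (v := v) (c := c)
    (fun i hi => h i (by simpa using hi)) (fun i hi => hc i (by simpa using hi))
  simpa using this

/-- The product of the registers `t i`, `i ∈ l`. -/
def prodList (t : ι → ℕ) : List ι → Frag ℕ
  | [] => const 1
  | i :: l => do
    let a ← prodList t l
    bin .mul a (t i)

theorem Computes.prodList {t : ι → ℕ} {v : ι → ℝ} (l : List ι)
    (h : ∀ i ∈ l, Holds mem (t i) (v i)) :
    (Frag.prodList t l).Computes mem (1 + l.length) fun a m => Holds m a (l.map v).prod := by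
  induction l with
  | nil => exact (Computes.const 1).mono (by simp) fun a m _ h => by simpa using h
  | cons i l ih =>
    refine ((ih fun j hj => h j (by simp [hj])).bind
      fun a m hm ha => Computes.bin .mul ha ((h i (by simp)).mono hm)).mono ?_ ?_
    · simp only [List.length_cons]; omega
    · intro a m _ ha
      simpa [BinOp.eval, mul_comm] using ha

theorem Computes.prodFinset {t : ι → ℕ} {v : ι → ℝ} (s : Finset ι)
    (h : ∀ i ∈ s, Holds mem (t i) (v i)) :
    (Frag.prodList t s.toList).Computes mem (1 + s.card) fun a m => Holds m a (∏ i ∈ s, v i) := by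
  have := Computes.prodList s.toList (mem := mem) (t := t) (v := v)
    (fun i hi => h i (by simpa using hi))
  simpa using this

/-- The results of the fragments `f i`, `i ∈ l`. -/
def tabList [DecidableEq ι] [Inhabited α] (f : ι → Frag α) : List ι → Frag (ι → α)
  | [] => pure fun _ => default
  | i :: l => do
    let a ← f i
    let t ← tabList f l
    pure (Function.update t i a)

theorem Computes.tabList [DecidableEq ι] [Inhabited α] {f : ι → Frag α} {c : ℕ}
    {P : ι → α → List ℝ → Prop}
    (hP : ∀ i a m m', m <+: m' → P i a m → P i a m') (l : List ι)
    (h : ∀ i ∈ l, ∀ m, mem <+: m → (f i).Computes m c (P i)) :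
    (Frag.tabList f l).Computes mem (c * l.length) fun t m => ∀ i ∈ l, P i (t i) m := by
  induction l generalizing mem with
  | nil => exact Computes.mono (.pure (P := fun _ _ => True) trivial) (by simp) (by simp)
  | cons i l ih =>
    refine ((h i (by simp) mem List.prefix_rfl).bind fun a m hm ha =>
      (ih fun j hj m' hm' => h j (by simp [hj]) m' (hm.trans hm')).bind fun t m' hm' ht =>
        .pure ?_).mono ?_ fun _ _ _ h => h
    · intro j hj
      by_cases hij : j = i
      · subst hij
        simpa using hP _ _ _ _ hm' ha
      · simp only [List.mem_cons, hij, false_or] at hj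
        simpa [hij] using ht j hj
    · simp [mul_add]; omega

/-- `f 0, f 1, …` in turn, acting on a state. -/
def loop {N : ℕ} (f : Fin N → σ → Frag σ) (s : σ) : ℕ → Frag σ
  | 0 => pure s
  | k + 1 => do
    let s' ← loop f s k
    if h : k < N then f ⟨k, h⟩ s' else pure s'

theorem Computes.loop {N : ℕ} {f : Fin N → σ → Frag σ} {s : σ} {c : Fin N → ℕ}
    (Inv : ℕ → σ → List ℝ → Prop) (h₀ : Inv 0 s mem)
    (h : ∀ (i : Fin N) s' m, mem <+: m → Inv i s' m → (f i s').Computes m (c i) (Inv (i + 1))) :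
    (Frag.loop f s N).Computes mem (∑ i, c i) (Inv N) := by
  have key : ∀ k ≤ N, (Frag.loop f s k).Computes mem
      (∑ i ∈ Finset.range k, if h : i < N then c ⟨i, h⟩ else 0) (Inv k) := by
    intro k
    induction k with
    | zero => intro _; exact .pure h₀
    | succ k ih =>
      intro hk
      have hk' : k < N := hk
      rw [Finset.sum_range_succ]
      refine (ih hk'.le).bind fun s' m hm hs => ?_
      simp only [hk', dif_pos]
      exact h ⟨k, hk'⟩ s' m hm hs
  have := key N le_rfl
  rwa [Finset.sum_range, Finset.sum_congr rfl fun i _ => by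
    rw [dif_pos i.2]] at this

/-- A table whose entries are computed in the order `ord 0, ord 1, …`; each may use the entries
computed before. -/
def seqTab {N : ℕ} [Inhabited α] (ord : Equiv.Perm (Fin N))
    (f : Fin N → (Fin N → α) → Frag α) : Frag (Fin N → α) :=
  loop (fun i t => do
    let a ← f (ord i) t
    pure (Function.update t (ord i) a)) (fun _ => default) N

/-- The cost may depend on the entry, because for the columns of a pattern only the total cost is
controlled. The permutation `ord` allows substitution in either direction. -/
theorem Computes.seqTab {N : ℕ} [Inhabited α] {ord : Equiv.Perm (Fin N)}
    {f : Fin N → (Fin N → α) → Frag α} {c : Fin N → ℕ} {P : Fin N → α → List ℝ → Prop}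
    (hP : ∀ i a m m', m <+: m' → P i a m → P i a m')
    (h : ∀ i t m, mem <+: m → (∀ j, ord.symm j < ord.symm i → P j (t j) m) →
      (f i t).Computes m (c i) (P i)) :
    (Frag.seqTab ord f).Computes mem (∑ i, c i) fun t m => ∀ i, P i (t i) m := by
  have := Computes.loop (f := fun i t => (do
    let a ← f (ord i) t
    Pure.pure (Function.update t (ord i) a) : Frag (Fin N → α))) (s := fun _ => default)
    (c := fun i => c (ord i)) (mem := mem)
    (fun k t m => ∀ i, (ord.symm i : ℕ) < k → P i (t i) m) (by simp) ?_
  · rw [Equiv.sum_comp ord c] at this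
    exact this.mono le_rfl fun t m _ ht i => ht i (ord.symm i).2
  · intro i t m hm ht
    refine ((h (ord i) t m hm fun j hj => ht j (by simpa using hj)).bind fun a m' hm' ha =>
      .pure ?_).mono (by simp) fun _ _ _ h => h
    intro j hj
    by_cases hij : j = ord i
    · subst hij; simpa using ha
    · have hne : (ord.symm j : ℕ) ≠ i := fun h' => hij (by
        rw [← Fin.ext h', Equiv.apply_symm_apply])
      simpa [hij] using hP _ _ _ _ hm' (ht j (by omega))

end Frag

/-! ### Reverse Cholesky factorisation without fill-in -/

/-- A sparsity pattern of symmetric matrices (given by the positions below the diagonal), with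
boundedly many entries in each row, for which elimination from the last to the first unknown
produces no fill-in. -/
structure Pattern (N : ℕ) where
  lo : Fin N → Finset (Fin N)
  lt_of_mem : ∀ {i j}, j ∈ lo i → j < i
  card_le : ∀ i, (lo i).card ≤ 4
  clique : ∀ {i j k}, i ∈ lo k → j ∈ lo k → j < i → j ∈ lo i

namespace Pattern

variable {N : ℕ} (P : Pattern N)

/-- The positions above the diagonal. -/
def up (j : Fin N) : Finset (Fin N) := Finset.univ.filter fun i => j ∈ P.lo i

variable {P}

theorem mem_up {i j : Fin N} : i ∈ P.up j ↔ j ∈ P.lo i := by simp [up]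

theorem lt_of_mem_up {i j : Fin N} (h : i ∈ P.up j) : j < i := P.lt_of_mem (mem_up.1 h)

/-- Double counting: rows have at most four entries, and although columns carry no bound of their
own, every cost below is a sum over columns. -/
theorem sum_card_up_le : ∑ j, (P.up j).card ≤ 4 * N := by
  have : ∑ j, (P.up j).card = ∑ i, (P.lo i).card := by
    simp only [up, Finset.card_filter]
    rw [Finset.sum_comm]
    refine Finset.sum_congr rfl fun i _ => ?_
    rw [← Finset.card_filter]
    congr 1
    ext j; simp
  rw [this]
  calc ∑ i, (P.lo i).card ≤ ∑ _i : Fin N, 4 := Finset.sum_le_sum fun i _ => P.card_le i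
    _ = 4 * N := by simp [mul_comm]

variable (P)

/-- `A` is symmetric with sparsity pattern `P`. -/
def Conforms (A : Matrix (Fin N) (Fin N) ℝ) : Prop :=
  A.IsSymm ∧ ∀ i j, j < i → j ∉ P.lo i → A i j = 0

variable {P}

theorem Conforms.sub {A B : Matrix (Fin N) (Fin N) ℝ} (hA : P.Conforms A) (hB : P.Conforms B) :
    P.Conforms (A - B) :=
  ⟨hA.1.sub hB.1, fun i j h h' => by simp [hA.2 i j h h', hB.2 i j h h']⟩

theorem Conforms.add {A B : Matrix (Fin N) (Fin N) ℝ} (hA : P.Conforms A) (hB : P.Conforms B) :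
    P.Conforms (A + B) :=
  ⟨hA.1.add hB.1, fun i j h h' => by simp [hA.2 i j h h', hB.2 i j h h']⟩

theorem Conforms.smul {A : Matrix (Fin N) (Fin N) ℝ} (hA : P.Conforms A) (c : ℝ) :
    P.Conforms (c • A) :=
  ⟨hA.1.smul c, fun i j h h' => by simp [hA.2 i j h h']⟩

theorem sum_eq_up {i : Fin N} {f : Fin N → ℝ} (h : ∀ k, k ≠ i → k ∉ P.up i → f k = 0) :
    ∑ k, f k = f i + ∑ k ∈ P.up i, f k := by
  rw [← Finset.sum_insert (fun h' => (lt_of_mem_up h').false)]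
  symm
  refine Finset.sum_subset (Finset.subset_univ _) fun k _ hk => ?_
  simp only [Finset.mem_insert, not_or] at hk
  exact h k hk.1 hk.2

theorem sum_eq_lo {i : Fin N} {f : Fin N → ℝ} (h : ∀ k, k ≠ i → k ∉ P.lo i → f k = 0) :
    ∑ k, f k = f i + ∑ k ∈ P.lo i, f k := by
  rw [← Finset.sum_insert (fun h' => (P.lt_of_mem h').false)]
  symm
  refine Finset.sum_subset (Finset.subset_univ _) fun k _ hk => ?_
  simp only [Finset.mem_insert, not_or] at hk
  exact h k hk.1 hk.2

/-- A row of a matrix with sparsity pattern `P` times a vector. -/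
theorem Conforms.mulVec_apply {A : Matrix (Fin N) (Fin N) ℝ} (hA : P.Conforms A)
    (v : Fin N → ℝ) (i : Fin N) :
    A.mulVec v i = A i i * v i + (∑ k ∈ P.lo i, A i k * v k + ∑ k ∈ P.up i, A k i * v k) := by
  have hd : Disjoint (P.lo i) (P.up i) := Finset.disjoint_left.2 fun k h h' =>
    (P.lt_of_mem h).asymm (lt_of_mem_up h')
  have hs : ∑ k ∈ P.up i, A k i * v k = ∑ k ∈ P.up i, A i k * v k :=
    Finset.sum_congr rfl fun k _ => by rw [hA.1.apply]
  have hi : i ∉ P.lo i ∪ P.up i := by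
    simp only [Finset.mem_union, not_or]
    exact ⟨fun h => (P.lt_of_mem h).false, fun h => (lt_of_mem_up h).false⟩
  rw [hs, ← Finset.sum_union hd,
    ← Finset.sum_insert (f := fun k => A i k * v k) hi]
  symm
  refine Finset.sum_subset (Finset.subset_univ _) fun k _ hk => ?_
  simp only [Finset.mem_insert, Finset.mem_union, not_or] at hk
  obtain ⟨h₁, h₂, h₃⟩ := hk
  rcases lt_or_gt_of_ne h₁ with h | h
  · rw [hA.2 i k h h₂, zero_mul]
  · rw [← hA.1.apply, hA.2 k i h fun h' => h₃ (mem_up.2 h'), zero_mul]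

variable (P)

/-- The reverse Cholesky recursion, from the last row to the first. -/
def cholRec (A : Matrix (Fin N) (Fin N) ℝ) (i j : Fin N) : ℝ :=
  if j = i then Real.sqrt (A i i - ∑ k ∈ (P.up i).attach, cholRec A k i * cholRec A k i)
  else if j ∈ P.lo i then
    (A i j - ∑ k ∈ (P.up i).attach, cholRec A k i * cholRec A k j) /
      Real.sqrt (A i i - ∑ k ∈ (P.up i).attach, cholRec A k i * cholRec A k i)
  else 0
termination_by N - i
decreasing_by all_goals
  have := lt_of_mem_up k.2
  omega

variable {P}
variable {A L : Matrix (Fin N) (Fin N) ℝ}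

theorem cholRec_diag (i : Fin N) : P.cholRec A i i =
    Real.sqrt (A i i - ∑ k ∈ P.up i, P.cholRec A k i * P.cholRec A k i) := by
  rw [cholRec, if_pos rfl, Finset.sum_attach (P.up i) fun k => P.cholRec A k i * P.cholRec A k i]

theorem cholRec_of_mem {i j : Fin N} (h : j ∈ P.lo i) : P.cholRec A i j =
    (A i j - ∑ k ∈ P.up i, P.cholRec A k i * P.cholRec A k j) / P.cholRec A i i := by
  rw [cholRec, if_neg (P.lt_of_mem h).ne, if_pos h, cholRec_diag,
    Finset.sum_attach (P.up i) fun k => P.cholRec A k i * P.cholRec A k i,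
    Finset.sum_attach (P.up i) fun k => P.cholRec A k i * P.cholRec A k j]

theorem cholRec_eq_zero {i j : Fin N} (h : j ≠ i) (h' : j ∉ P.lo i) : P.cholRec A i j = 0 := by
  rw [cholRec, if_neg h, if_neg h']

theorem isRevCholesky_apply (hL : IsRevCholesky A L) (i j : Fin N) :
    A i j = ∑ k, L k i * L k j := by
  rw [hL.2.2]; simp [Matrix.mul_apply]

/-- A reverse Cholesky factor has no fill-in. -/
theorem Conforms.chol_eq_zero (hA : P.Conforms A) (hL : IsRevCholesky A L) {i j : Fin N}
    (h : j ≠ i) (h' : j ∉ P.lo i) : L i j = 0 := by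
  obtain ⟨n, hn⟩ : ∃ n, n = N - (i : ℕ) := ⟨_, rfl⟩
  induction n using Nat.strong_induction_on generalizing i j with
  | _ n ih =>
  rcases lt_or_gt_of_ne h with hji | hij
  · have e := isRevCholesky_apply hL i j
    rw [hA.2 i j hji h', Finset.sum_eq_single i] at e
    · exact (mul_eq_zero.1 e.symm).resolve_left (hL.2.1 i).ne'
    · intro k _ hk
      rcases lt_or_gt_of_ne hk with h₁ | h₁
      · rw [hL.1 k i h₁, zero_mul]
      · by_cases hki : i ∈ P.lo k
        · rw [ih (N - k) (by omega) (hji.trans h₁).ne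
            (fun hkj => h' (P.clique hki hkj hji)) rfl, mul_zero]
        · rw [ih (N - k) (by omega) h₁.ne hki rfl, zero_mul]
    · simp
  · exact hL.1 i j hij

/-- Uniqueness of the factor. Together with existence for definite matrices it shows that the
recursion meets only positive pivots there. -/
theorem Conforms.chol_eq_cholRec (hA : P.Conforms A) (hL : IsRevCholesky A L) (i j : Fin N) :
    L i j = P.cholRec A i j := by
  obtain ⟨n, hn⟩ : ∃ n, n = N - (i : ℕ) := ⟨_, rfl⟩
  induction n using Nat.strong_induction_on generalizing i j with
  | _ n ih =>
  have hup : ∀ k ∈ P.up i, ∀ j, L k j = P.cholRec A k j := fun k hk j =>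
    ih (N - k) (by have := lt_of_mem_up hk; omega) k j rfl
  have hz : ∀ k, k ≠ i → k ∉ P.up i → L k i = 0 := fun k hk hk' =>
    hA.chol_eq_zero hL hk.symm fun h => hk' (mem_up.2 h)
  have hd : L i i = P.cholRec A i i := by
    have e := isRevCholesky_apply hL i i
    rw [sum_eq_up (i := i) fun k hk hk' => by rw [hz k hk hk', zero_mul]] at e
    rw [cholRec_diag, e, Finset.sum_congr rfl fun k hk => by rw [hup k hk i], add_sub_cancel_right,
      Real.sqrt_mul_self (hL.2.1 i).le]
  by_cases hij : j = i
  · rw [hij, hd]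
  by_cases hj : j ∈ P.lo i
  · have e := isRevCholesky_apply hL i j
    rw [sum_eq_up (i := i) fun k hk hk' => by rw [hz k hk hk', zero_mul]] at e
    rw [cholRec_of_mem hj, e, Finset.sum_congr rfl fun k hk => by rw [hup k hk i, hup k hk j],
      add_sub_cancel_right, ← hd, mul_div_cancel_left₀ _ (hL.2.1 i).ne']
  · rw [cholRec_eq_zero hij hj, hA.chol_eq_zero hL hij hj]

theorem Conforms.isRevCholesky_cholRec (hA : P.Conforms A) (h : ∀ i, 0 < P.cholRec A i i) :
    IsRevCholesky A (Matrix.of (P.cholRec A)) := by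
  refine ⟨fun i j hij => cholRec_eq_zero hij.ne' fun h' => (P.lt_of_mem h').asymm hij, h, ?_⟩
  have hz : ∀ {i} k, k ≠ i → k ∉ P.up i → P.cholRec A k i = 0 := fun k hk hk' =>
    cholRec_eq_zero hk.symm fun h => hk' (mem_up.2 h)
  have key : ∀ i j, j ≤ i → A i j = ∑ k, P.cholRec A k i * P.cholRec A k j := by
    intro i j hji
    rw [sum_eq_up (i := i) fun k hk hk' => by rw [hz k hk hk', zero_mul]]
    rcases hji.lt_or_eq with hlt | rfl
    · by_cases hj : j ∈ P.lo i
      · rw [cholRec_of_mem hj, mul_div_cancel₀ _ (h i).ne', sub_add_cancel]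
      -- Outside the pattern both sides vanish: a row `k` containing both `i` and `j` is excluded by
      -- `clique`.
      · rw [hA.2 i j hlt hj, cholRec_eq_zero hlt.ne hj, mul_zero, zero_add]
        refine (Finset.sum_eq_zero fun k hk => ?_).symm
        by_cases hjk : j ∈ P.lo k
        · exact absurd (P.clique (mem_up.1 hk) hjk hlt) hj
        · rw [cholRec_eq_zero (hlt.trans (lt_of_mem_up hk)).ne hjk, mul_zero]
    · have h₁ := h j
      -- A positive square root has a positive argument, so squaring it gives the argument back.
      rw [cholRec_diag] at h₁
      rw [cholRec_diag, Real.mul_self_sqrt (Real.sqrt_pos.1 h₁).le, sub_add_cancel]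
  ext i j
  simp only [Matrix.mul_apply, Matrix.transpose_apply, Matrix.of_apply]
  rcases le_total j i with hji | hij
  · exact key i j hji
  · rw [← hA.1.apply, key j i hij]
    exact Finset.sum_congr rfl fun k _ => mul_comm _ _

end Pattern

/-! ### Existence of reverse Cholesky factors, and a test for definiteness -/

section Cholesky

variable {N : ℕ} {A L : Matrix (Fin N) (Fin N) ℝ}

theorem IsRevCholesky.isUnit (hL : IsRevCholesky A L) : IsUnit L := by
  rw [Matrix.isUnit_iff_isUnit_det, Matrix.det_of_isLowerTriangular L fun i j h => hL.1 i j h]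
  exact (Finset.prod_pos fun i _ => hL.2.1 i).ne'.isUnit

theorem IsRevCholesky.posDef (hL : IsRevCholesky A L) : A.PosDef := by
  rw [hL.2.2]
  have := Matrix.PosDef.conjTranspose_mul_self L
    (Matrix.mulVec_injective_iff_isUnit.2 hL.isUnit)
  simpa using this

/-- Induction on the size, eliminating the last unknown: the Schur complement `S` of the last
diagonal entry is again positive definite. -/
theorem exists_isRevCholesky (hA : A.PosDef) : ∃ L, IsRevCholesky A L := by
  induction N with
  | zero => exact ⟨A, fun i => i.elim0, fun i => i.elim0, by ext i; exact i.elim0⟩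
  | succ N ih =>
    set l := Fin.last N
    have hl : 0 < A l l := hA.diag_pos
    have hsym : ∀ i j, A i j = A j i := fun i j => by simpa using (hA.1.apply i j).symm
    let S : Matrix (Fin N) (Fin N) ℝ :=
      Matrix.of fun i j => A i.castSucc j.castSucc - A l i.castSucc * A l j.castSucc / A l l
    have hS : S.PosDef := by
      refine Matrix.PosDef.of_dotProduct_mulVec_pos ?_ fun x hx => ?_
      · ext i j
        simp only [S, Matrix.conjTranspose_apply, Matrix.of_apply, star_trivial]
        rw [hsym, mul_comm]
      · let y : Fin (N + 1) → ℝ :=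
          Fin.snoc (α := fun _ => ℝ) x (-(∑ j, A l j.castSucc * x j) / A l l)
        have hy : y ≠ 0 := fun h => hx (by
          ext i
          have := congrFun h i.castSucc
          simpa [y] using this)
        have := hA.dotProduct_mulVec_pos hy
        convert this using 1
        have hA' : ∀ i : Fin N, A i.castSucc l = A l i.castSucc := fun i => hsym _ _
        simp only [dotProduct, Matrix.mulVec, star_trivial, Fin.sum_univ_castSucc, y,
          Fin.snoc_castSucc, Fin.snoc_last, S, Matrix.of_apply]
        change _ = ∑ i : Fin N, x i * (∑ j : Fin N, A i.castSucc j.castSucc * x j +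
          A i.castSucc l * (-(∑ j, A l j.castSucc * x j) / A l l)) +
          -(∑ j, A l j.castSucc * x j) / A l l * (∑ j : Fin N, A l j.castSucc * x j +
          A l l * (-(∑ j, A l j.castSucc * x j) / A l l))
        have h₁ : A l l * (-(∑ j, A l j.castSucc * x j) / A l l) =
          -(∑ j, A l j.castSucc * x j) := by field_simp
        rw [h₁, add_neg_cancel, mul_zero, add_zero]
        refine Finset.sum_congr rfl fun i _ => ?_
        rw [hA']
        congr 1
        simp only [sub_mul, Finset.sum_sub_distrib]
        rw [sub_eq_add_neg]
        congr 1
        rw [neg_div, mul_neg, Finset.sum_div, Finset.mul_sum]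
        congr 1
        exact Finset.sum_congr rfl fun j _ => by ring
    obtain ⟨L, h₁, h₂, h₃⟩ := ih hS
    let r : ℝ := Real.sqrt (A l l)
    have hr : 0 < r := Real.sqrt_pos.2 hl
    have hrr : r * r = A l l := Real.mul_self_sqrt hl.le
    -- The last row is that of `A` divided by the root of the pivot; its contribution to `L'ᵀ L'` is
    -- exactly what was subtracted in `S`.
    let L' : Matrix (Fin (N + 1)) (Fin (N + 1)) ℝ := Matrix.of fun i j =>
      Fin.lastCases (motive := fun _ => ℝ) (A l j / r)
        (fun i => Fin.lastCases (motive := fun _ => ℝ) 0 (fun j => L i j) j) i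
    have e₁ : ∀ j, L' l j = A l j / r := fun j => by simp [L', l]
    have e₂ : ∀ i : Fin N, L' i.castSucc l = 0 := fun i => by simp [L', l]
    have e₃ : ∀ i j : Fin N, L' i.castSucc j.castSucc = L i j := fun i j => by simp [L']
    refine ⟨L', ?_, ?_, ?_⟩
    · intro i j hij
      induction i using Fin.lastCases with
      | last => exact absurd hij (not_lt.2 (Fin.le_last j))
      | cast i =>
        induction j using Fin.lastCases with
        | last => exact e₂ i
        | cast j => rw [e₃]; exact h₁ i j (by simpa using hij)
    · intro i
      induction i using Fin.lastCases with
      | last => exact (e₁ l).symm ▸ div_pos hl hr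
      | cast i => rw [e₃]; exact h₂ i
    · have hS' : ∀ i j, S i j = ∑ k, L k i * L k j := fun i j => by
        rw [h₃]; simp [Matrix.mul_apply]
      ext i j
      simp only [Matrix.mul_apply, Matrix.transpose_apply, Fin.sum_univ_castSucc]
      change _ = ∑ k : Fin N, L' k.castSucc i * L' k.castSucc j + L' l i * L' l j
      rw [e₁, e₁, div_mul_div_comm, hrr]
      induction i using Fin.lastCases with
      | last =>
        change A l j = ∑ k : Fin N, L' k.castSucc l * _ + A l l * A l j / A l l
        simp only [e₂, zero_mul, Finset.sum_const_zero, zero_add]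
        field_simp
      | cast i =>
        induction j using Fin.lastCases with
        | last =>
          change A i.castSucc l = ∑ k : Fin N, _ * L' k.castSucc l + _ * A l l / A l l
          simp only [e₂, mul_zero, Finset.sum_const_zero, zero_add]
          rw [hsym]; field_simp
        | cast j =>
          simp only [e₃]
          rw [← hS' i j]
          simp [S]

/-- The diagonal entries of the recursion are values of `Real.sqrt`, hence nonnegative even if the
matrix is indefinite, and a breakdown produces a zero. So the sign of one product decides
definiteness, with a single comparison. -/
theorem Pattern.Conforms.posDef_iff {P : Pattern N} (hA : P.Conforms A) :
    A.PosDef ↔ 0 < ∏ i, P.cholRec A i i := by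
  constructor
  · intro h
    obtain ⟨L, hL⟩ := exists_isRevCholesky h
    exact Finset.prod_pos fun i _ => hA.chol_eq_cholRec hL i i ▸ hL.2.1 i
  · intro h
    refine (hA.isRevCholesky_cholRec fun i => ?_).posDef
    refine lt_of_le_of_ne ?_ fun h' => h.ne' (Finset.prod_eq_zero (Finset.mem_univ i) h'.symm)
    rw [Pattern.cholRec_diag]
    exact Real.sqrt_nonneg _

end Cholesky

/-! ### Extreme generalised eigenvalues -/

section Spectrum

variable {N : ℕ} {X Y : Matrix (Fin N) (Fin N) ℝ}

theorem mem_genSpectrum_iff {lam : ℝ} :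
    lam ∈ genSpectrum X Y ↔ ∃ v ≠ 0, X.mulVec v = lam • Y.mulVec v := by
  rw [genSpectrum, Set.mem_ofPred_eq, Matrix.isUnit_iff_isUnit_det, isUnit_iff_ne_zero, not_not,
    ← Matrix.exists_mulVec_eq_zero_iff]
  simp only [Matrix.sub_mulVec, Matrix.smul_mulVec, sub_eq_zero]

/-- The largest generalised eigenvalue of a definite pencil. -/
theorem exists_max_genEigenvalue (hN : 0 < N) (hX : X.IsSymm) (hY : Y.PosDef) :
    ∃ lam ∈ genSpectrum X Y, (lam • Y - X).PosSemidef ∧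
      (X.PosSemidef → lam ≤ (Y⁻¹ * X).trace ∧ (Y⁻¹ * X).trace ≤ N * lam) := by
  obtain ⟨L, hL⟩ := exists_isRevCholesky hY
  have hdet : IsUnit L.det := (Matrix.isUnit_iff_isUnit_det _).1 hL.isUnit
  have hdet' : IsUnit L.transpose.det := by rwa [Matrix.det_transpose]
  set G := L⁻¹ with hG
  -- With `Y = Lᵀ L` and `G = L⁻¹`, this congruence turns the pencil into the ordinary symmetric
  -- eigenvalue problem for `Z`.
  set Z := G.transpose * X * G with hZdef
  have hLG : L * G = 1 := Matrix.mul_nonsing_inv _ hdet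
  have hGL : G * L = 1 := Matrix.nonsing_inv_mul _ hdet
  have hLG' : G.transpose * L.transpose = 1 := by rw [← Matrix.transpose_mul, hLG]; simp
  have hGL' : L.transpose * G.transpose = 1 := by rw [← Matrix.transpose_mul, hGL]; simp
  have hXZ : X = L.transpose * Z * L := by
    calc X = (L.transpose * G.transpose) * X * (G * L) := by rw [hGL, hGL']; simp
      _ = _ := by simp only [hZdef, Matrix.mul_assoc]
  have hZ : Z.IsHermitian := by
    simp only [Matrix.IsHermitian, hZdef, Matrix.conjTranspose_eq_transpose_of_trivial,
      Matrix.transpose_mul, Matrix.transpose_transpose, hX.eq, Matrix.mul_assoc]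
  have : Nonempty (Fin N) := ⟨⟨0, hN⟩⟩
  obtain ⟨i₀, hi₀⟩ := Finite.exists_max hZ.eigenvalues
  set lam := hZ.eigenvalues i₀
  have hfac : X - lam • Y = L.transpose * (Z - lam • 1) * L := by
    rw [Matrix.mul_sub, Matrix.sub_mul, ← hXZ, hL.2.2]
    simp
  -- `Y⁻¹ = G Gᵀ`, so the trace is that of `Z` by cyclicity, that is, the sum of the generalised
  -- eigenvalues.
  have htr : (Y⁻¹ * X).trace = ∑ i, hZ.eigenvalues i := by
    have h₁ : Y⁻¹ = G * G.transpose := by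
      rw [hL.2.2, Matrix.mul_inv_rev, hG, Matrix.transpose_nonsing_inv]
    rw [h₁, Matrix.mul_assoc, Matrix.trace_mul_comm, ← hZdef]
    simpa using hZ.trace_eq_sum_eigenvalues
  refine ⟨lam, ?_, ?_, fun hXp => ?_⟩
  · intro h
    rw [hfac] at h
    have h₂ : IsUnit (Z - lam • 1) := by
      have h3 : Z - lam • 1 = G.transpose * (L.transpose * (Z - lam • 1) * L) * G := by
        calc Z - lam • 1 = (G.transpose * L.transpose) * (Z - lam • 1) * (L * G) := by
              rw [hLG, hLG']; simp
          _ = _ := by simp only [Matrix.mul_assoc]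
      rw [h3]
      exact ((IsUnit.of_mul_eq_one _ hLG').mul h).mul (IsUnit.of_mul_eq_one _ hGL)
    have h₃ := hZ.eigenvalues_mem_spectrum_real i₀
    rw [spectrum.mem_iff] at h₃
    apply h₃
    rw [← neg_sub, IsUnit.neg_iff, Algebra.algebraMap_eq_smul_one]
    exact h₂
  · have h₁ : (lam • 1 - Z).PosSemidef := by
      have h₂ : lam • (1 : Matrix (Fin N) (Fin N) ℝ) - Z =
          (hZ.eigenvectorUnitary : Matrix (Fin N) (Fin N) ℝ) *
            Matrix.diagonal (fun i => lam - hZ.eigenvalues i) *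
            star (hZ.eigenvectorUnitary : Matrix (Fin N) (Fin N) ℝ) := by
        have h₃ : Matrix.diagonal (fun i => lam - hZ.eigenvalues i) =
            lam • 1 - Matrix.diagonal (RCLike.ofReal ∘ hZ.eigenvalues : Fin N → ℝ) := by
          rw [← Matrix.diagonal_one, ← Matrix.diagonal_smul, Matrix.diagonal_sub]
          congr 1; ext i; simp
        rw [h₃, Matrix.mul_sub, Matrix.sub_mul]
        congr 1
        · simp
        · conv_lhs => rw [hZ.spectral_theorem]
          simp [Unitary.conjStarAlgAut_apply]
      rw [h₂, Matrix.star_eq_conjTranspose]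
      exact Matrix.PosSemidef.mul_mul_conjTranspose_same
        (Matrix.PosSemidef.diagonal fun i => by simpa using hi₀ i) _
    rw [← neg_sub, hfac]
    have h₂ := h₁.conjTranspose_mul_mul_same L
    rw [Matrix.conjTranspose_eq_transpose_of_trivial] at h₂
    convert h₂ using 1
    rw [← neg_sub, Matrix.mul_neg, Matrix.neg_mul, neg_neg]
  · have hZp : Z.PosSemidef := by
      have := hXp.conjTranspose_mul_mul_same G
      rwa [Matrix.conjTranspose_eq_transpose_of_trivial] at this
    rw [htr]
    refine ⟨Finset.single_le_sum (fun i _ => hZp.eigenvalues_nonneg i) (Finset.mem_univ i₀), ?_⟩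
    calc ∑ i, hZ.eigenvalues i ≤ ∑ _i : Fin N, lam := Finset.sum_le_sum fun i _ => hi₀ i
      _ = N * lam := by simp

variable {lam : ℝ}

theorem le_of_mem_genSpectrum (hY : Y.PosDef) (hlam : (lam • Y - X).PosSemidef) {μ : ℝ}
    (hμ : μ ∈ genSpectrum X Y) : μ ≤ lam := by
  obtain ⟨v, hv, h⟩ := mem_genSpectrum_iff.1 hμ
  have h₁ := hlam.dotProduct_mulVec_nonneg v
  have h₂ := hY.dotProduct_mulVec_pos hv
  rw [Matrix.sub_mulVec, Matrix.smul_mulVec, h, ← sub_smul, dotProduct_smul, smul_eq_mul] at h₁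
  exact sub_nonneg.1 (nonneg_of_mul_nonneg_left h₁ h₂)

/-- Testing with an eigenvector for `lam` gives one direction; the other splits off the definite
part `(t - lam) Y`. It makes definiteness an oracle for comparing `t` with the largest eigenvalue.
-/
theorem posDef_smul_sub_iff (hY : Y.PosDef) (hlam : (lam • Y - X).PosSemidef)
    (hmem : lam ∈ genSpectrum X Y) {t : ℝ} : (t • Y - X).PosDef ↔ lam < t := by
  constructor
  · intro ht
    obtain ⟨v, hv, h⟩ := mem_genSpectrum_iff.1 hmem
    have h₁ := ht.dotProduct_mulVec_pos hv
    have h₂ := hY.dotProduct_mulVec_pos hv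
    rw [Matrix.sub_mulVec, Matrix.smul_mulVec, h, ← sub_smul, dotProduct_smul, smul_eq_mul] at h₁
    exact sub_pos.1 (pos_of_mul_pos_left h₁ h₂.le)
  · intro ht
    have : t • Y - X = (t - lam) • Y + (lam • Y - X) := by
      rw [sub_smul]; abel
    rw [this]
    exact (hY.smul (sub_pos.2 ht)).add_posSemidef hlam

/-- Reduces the smallest eigenvalue of a pencil to the largest one of the swapped pencil. -/
theorem inv_mem_genSpectrum {μ : ℝ} (hμ : μ ≠ 0) :
    μ⁻¹ ∈ genSpectrum Y X ↔ μ ∈ genSpectrum X Y := by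
  simp only [mem_genSpectrum_iff]
  refine exists_congr fun v => and_congr_right fun _ => ?_
  rw [eq_inv_smul_iff₀ hμ, eq_comm]

theorem neg_mem_genSpectrum_neg {μ : ℝ} : -μ ∈ genSpectrum (-X) Y ↔ μ ∈ genSpectrum X Y := by
  simp only [mem_genSpectrum_iff]
  refine exists_congr fun v => and_congr_right fun _ => ?_
  rw [Matrix.neg_mulVec, neg_smul, neg_inj]

theorem pos_of_mem_genSpectrum (hX : X.PosDef) (hY : Y.PosDef) {μ : ℝ}
    (hμ : μ ∈ genSpectrum X Y) : 0 < μ := by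
  obtain ⟨v, hv, h⟩ := mem_genSpectrum_iff.1 hμ
  have h₁ := hX.dotProduct_mulVec_pos hv
  have h₂ := hY.dotProduct_mulVec_pos hv
  rw [h, dotProduct_smul, smul_eq_mul] at h₁
  exact pos_of_mul_pos_left h₁ h₂.le

end Spectrum

/-! ### Sparse linear algebra programs -/

/-- The registers `t i` hold the vector `v`. -/
def HoldsVec {ι : Type} (mem : List ℝ) (t : ι → ℕ) (v : ι → ℝ) : Prop :=
  ∀ i, Holds mem (t i) (v i)

theorem HoldsVec.mono {ι : Type} {mem mem' : List ℝ} {t : ι → ℕ} {v : ι → ℝ}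
    (h : HoldsVec mem t v) (hm : mem <+: mem') : HoldsVec mem' t v := fun i => (h i).mono hm

/-- The registers `t i j` hold the matrix `X`. -/
def HoldsMat {ι κ : Type} (mem : List ℝ) (t : ι → κ → ℕ) (X : Matrix ι κ ℝ) : Prop :=
  ∀ i j, Holds mem (t i j) (X i j)

theorem HoldsMat.mono {ι κ : Type} {mem mem' : List ℝ} {t : ι → κ → ℕ} {X : Matrix ι κ ℝ}
    (h : HoldsMat mem t X) (hm : mem <+: mem') : HoldsMat mem' t X :=
  fun i j => (h i j).mono hm

namespace Pattern

variable {N : ℕ} (P : Pattern N)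

/-- The registers `t i j`, where `(i, j)` is on the diagonal or a position of the pattern, hold the
entries of `X`. -/
def HoldsPat (mem : List ℝ) (t : Fin N → Fin N → ℕ) (X : Matrix (Fin N) (Fin N) ℝ) : Prop :=
  ∀ i, ∀ j ∈ insert i (P.lo i), Holds mem (t i j) (X i j)

variable {P} {mem mem' : List ℝ} {t : Fin N → Fin N → ℕ} {X : Matrix (Fin N) (Fin N) ℝ}

theorem HoldsPat.mono (h : P.HoldsPat mem t X) (hm : mem <+: mem') : P.HoldsPat mem' t X :=
  fun i j hj => (h i j hj).mono hm

theorem HoldsPat.diag (h : P.HoldsPat mem t X) (i : Fin N) : Holds mem (t i i) (X i i) :=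
  h i i (by simp)

theorem HoldsPat.of_mem (h : P.HoldsPat mem t X) {i j : Fin N} (hj : j ∈ P.lo i) :
    Holds mem (t i j) (X i j) := h i j (by simp [hj])

theorem _root_.GenADI.HoldsMat.holdsPat (h : HoldsMat mem t X) : P.HoldsPat mem t X :=
  fun i j _ => h i j

variable (P)

/-- Computes the entries on the diagonal and in the pattern. -/
def buildMat (e : Fin N → Fin N → Expr) : Frag (Fin N → Fin N → ℕ) :=
  Frag.seqTab (Equiv.refl _) fun i _ =>
    Frag.tabList (fun j => Frag.expr (e i j)) (insert i (P.lo i)).toList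

variable {P}

theorem buildMat_computes {e : Fin N → Fin N → Expr} {c : ℕ}
    (h : ∀ i, ∀ j ∈ insert i (P.lo i), (e i j).Denotes mem (X i j))
    (hc : ∀ i j, (e i j).size ≤ c) :
    (P.buildMat e).Computes mem (5 * c * N) fun t m => P.HoldsPat m t X := by
  refine (Frag.Computes.seqTab (c := fun _ => 5 * c)
    (P := fun i (t : Fin N → ℕ) m => ∀ j ∈ insert i (P.lo i), Holds m (t j) (X i j))
    (fun i t m m' hm h j hj => (h j hj).mono hm) fun i t m hm _ => ?_).mono
    (by simp [mul_comm]) fun _ _ _ h => h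
  refine (Frag.Computes.tabList (c := c) (P := fun j a m => Holds m a (X i j))
    (fun _ _ _ _ hm h => h.mono hm) (insert i (P.lo i)).toList fun j hj m' hm' => ?_).mono ?_
    fun t m _ h j hj => h j (by simpa using hj)
  · exact Frag.Computes.expr_le ((h i j (by simpa using hj)).mono (hm.trans hm')) (hc i j)
  · rw [Finset.length_toList, mul_comm]
    exact Nat.mul_le_mul_right _ ((Finset.card_insert_le _ _).trans
      (Nat.succ_le_succ (P.card_le i)))

variable (P)

/-- Computes the reverse Cholesky factor of the matrix in the registers `t`. -/
def chol (t : Fin N → Fin N → ℕ) : Frag (Fin N → Fin N → ℕ) := do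
  -- One register holding zero serves every position outside the pattern, so a full table of
  -- addresses is available after only `O(N)` operations.
  let z ← Frag.const 0
  Frag.seqTab Fin.revPerm fun i T => do
    let s ← Frag.sumList (fun k => .reg (T k i) * .reg (T k i)) (P.up i).toList
    let d ← Frag.expr (.un .sqrt (.reg (t i i) - .reg s))
    let r ← Frag.tabList (fun j => do
      let s ← Frag.sumList (fun k => .reg (T k i) * .reg (T k j)) (P.up i).toList
      Frag.expr ((.reg (t i j) - .reg s) / .reg d)) (P.lo i).toList
    pure fun j => if j = i then d else if j ∈ P.lo i then r j else z

variable {P}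

/-- Definiteness is not required: the output is the recursion even when it breaks down, as the
definiteness test needs. Row `i` costs at most `15 + 10 |up i|`, and the column sizes add up to at
most `4 N`. -/
theorem chol_computes (h : P.HoldsPat mem t X) :
    (P.chol t).Computes mem (55 * N + 1) fun T m => HoldsMat m T (Matrix.of (P.cholRec X)) := by
  refine ((Frag.Computes.const 0).bind fun z m hm hz => ?_).mono (c₁ := 1 + 55 * N)
    (P' := fun T m => ∀ i, HoldsVec m (T i) (P.cholRec X i)) (by omega)
    (fun _ _ _ h => h)
  refine (Frag.Computes.seqTab (c := fun i => 15 + 10 * (P.up i).card)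
    (P := fun i t m => HoldsVec m t (P.cholRec X i))
    (fun i t m m' hm h => h.mono hm) fun i T m' hm' hT => ?_).mono ?_ fun _ _ _ h => h
  · have hup : ∀ k ∈ P.up i, ∀ j, Holds m' (T k j) (P.cholRec X k j) := fun k hk =>
      hT k (by simpa [Fin.revPerm] using lt_of_mem_up hk)
    refine ((Frag.Computes.sumFinset (P.up i) (c := 1)
      (v := fun k => P.cholRec X k i * P.cholRec X k i)
      (fun k hk => .mul (.reg (hup k hk i)) (.reg (hup k hk i))) fun k hk => le_rfl).bind
      fun s m₁ hm₁ hs => (Frag.Computes.expr_le (c := 2)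
        (.sqrt (.sub (.reg ((h.diag i).mono (hm.trans (hm'.trans hm₁)))) (.reg hs)))
        le_rfl).bind (c₂ := 4 * (3 + 2 * (P.up i).card)) fun d m₂ hm₂ hd => ?_).mono
        (by omega) fun _ _ _ h => h
    rw [← cholRec_diag] at hd
    refine ((Frag.Computes.tabList (c := 3 + 2 * (P.up i).card)
      (P := fun j a m => Holds m a (if j ∈ P.lo i then P.cholRec X i j else 0))
      (fun _ _ _ _ hm h => h.mono hm) (P.lo i).toList fun j hj m₃ hm₃ => ?_).bind
      fun r m₃ hm₃ hr => Frag.Computes.pure ?_).mono ?_ fun _ _ _ h => h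
    · have hj' : j ∈ P.lo i := by simpa using hj
      rw [if_pos hj', cholRec_of_mem hj']
      refine ((Frag.Computes.sumFinset (P.up i) (c := 1)
        (v := fun k => P.cholRec X k i * P.cholRec X k j)
        (fun k hk => .mul (.reg ((hup k hk i).mono (hm₁.trans (hm₂.trans hm₃))))
          (.reg ((hup k hk j).mono (hm₁.trans (hm₂.trans hm₃))))) fun k hk => le_rfl).bind
        fun s m₄ hm₄ hs => Frag.Computes.expr_le (c := 2)
          (.div (.sub (.reg ((h.of_mem hj').mono
            (hm.trans (hm'.trans (hm₁.trans (hm₂.trans (hm₃.trans hm₄))))))) (.reg hs))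
            (.reg (hd.mono (hm₃.trans hm₄)))) le_rfl).mono (by omega) fun _ _ _ h => h
    · intro j
      by_cases hji : j = i
      · subst hji
        simpa using hd.mono hm₃
      · by_cases hj : j ∈ P.lo i
        · have := hr j (by simpa using hj)
          simpa [hji, hj] using this
        · have := hz.mono (hm'.trans (hm₁.trans (hm₂.trans hm₃)))
          simpa [hji, hj, cholRec_eq_zero hji hj] using this
    · rw [Finset.length_toList, add_zero, mul_comm]
      exact Nat.mul_le_mul_right _ (P.card_le i)
  · rw [Finset.sum_add_distrib, ← Finset.mul_sum]
    have := P.sum_card_up_le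
    simp
    omega

variable (P)

/-- Solves `Lᵀ L x = f`. -/
def solveVec (T : Fin N → Fin N → ℕ) (f : Fin N → ℕ) : Frag (Fin N → ℕ) := do
  let z ← Frag.seqTab Fin.revPerm fun j z => do
    let s ← Frag.sumList (fun i => .reg (T i j) * .reg (z i)) (P.up j).toList
    Frag.expr ((.reg (f j) - .reg s) / .reg (T j j))
  Frag.seqTab (Equiv.refl _) fun i x => do
    let s ← Frag.sumList (fun j => .reg (T i j) * .reg (x j)) (P.lo i).toList
    Frag.expr ((.reg (z i) - .reg s) / .reg (T i i))

variable {P}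

/-- Backward substitution for `Lᵀ w = v` and forward substitution for `L x = w`. Any factor `L` is
admissible, since the absence of fill-in is a property of the factor and not of the way it was
computed. -/
theorem solveVec_computes {L : Matrix (Fin N) (Fin N) ℝ} {T : Fin N → Fin N → ℕ}
    {f : Fin N → ℕ} {v : Fin N → ℝ} (hX : P.Conforms X) (hL : IsRevCholesky X L)
    (hT : HoldsMat mem T L) (hf : HoldsVec mem f v) :
    (P.solveVec T f).Computes mem (22 * N) fun x m => HoldsVec m x (X⁻¹.mulVec v) := by
  have hXu : IsUnit X.det := (Matrix.isUnit_iff_isUnit_det _).1 hL.posDef.isUnit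
  set x : Fin N → ℝ := X⁻¹.mulVec v with hx
  set w : Fin N → ℝ := L.mulVec x with hw
  have hLw : L.transpose.mulVec w = v := by
    rw [hw, Matrix.mulVec_mulVec, ← hL.2.2, hx, Matrix.mulVec_mulVec,
      Matrix.mul_nonsing_inv _ hXu, Matrix.one_mulVec]
  have hw' : ∀ j, (v j - ∑ i ∈ P.up j, L i j * w i) / L j j = w j := by
    intro j
    have e : v j = ∑ i, L i j * w i := by
      rw [← hLw]; simp [Matrix.mulVec, dotProduct]
    rw [sum_eq_up (P := P) (i := j) fun k hk hk' => by
      rw [hX.chol_eq_zero hL hk.symm fun h => hk' (mem_up.2 h), zero_mul]] at e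
    rw [e, add_sub_cancel_right, mul_div_cancel_left₀ _ (hL.2.1 j).ne']
  have hx' : ∀ i, (w i - ∑ j ∈ P.lo i, L i j * x j) / L i i = x i := by
    intro i
    have e : w i = ∑ j, L i j * x j := by rw [hw]; simp [Matrix.mulVec, dotProduct]
    rw [sum_eq_lo (P := P) (i := i) fun k hk hk' => by
      rw [hX.chol_eq_zero hL hk hk', zero_mul]] at e
    rw [e, add_sub_cancel_right, mul_div_cancel_left₀ _ (hL.2.1 i).ne']
  refine Frag.Computes.mono (c₁ := 11 * N + 11 * N) (Frag.Computes.bind (P := fun z m => HoldsVec m z w) ?_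
    fun z m hm hz => ?_) (by omega) fun _ _ _ h => h
  · refine (Frag.Computes.seqTab (c := fun j => 3 + 2 * (P.up j).card)
      (P := fun i a m => Holds m a (w i)) (fun _ _ _ _ hm h => h.mono hm)
      fun j z m hm hz => ?_).mono ?_ fun _ _ _ h => h
    · rw [← hw' j]
      refine ((Frag.Computes.sumFinset (P.up j) (c := 1) (v := fun i => L i j * w i)
        (fun i hi => .mul (.reg ((hT i j).mono hm)) (.reg (hz i
          (by simpa [Fin.revPerm] using lt_of_mem_up hi)))) fun _ _ => le_rfl).bind
        fun s m₁ hm₁ hs => Frag.Computes.expr_le (c := 2) (.div (.sub (.reg ((hf j).mono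
          (hm.trans hm₁))) (.reg hs)) (.reg ((hT j j).mono (hm.trans hm₁)))) le_rfl).mono
        (by omega) fun _ _ _ h => h
    · rw [Finset.sum_add_distrib, ← Finset.mul_sum]
      have := P.sum_card_up_le
      simp
      omega
  · refine (Frag.Computes.seqTab (c := fun _ => 11)
      (P := fun i a m => Holds m a (x i)) (fun _ _ _ _ hm h => h.mono hm)
      fun i y m₁ hm₁ hy => ?_).mono (by simp [mul_comm]) fun _ _ _ h => h
    rw [← hx' i]
    refine ((Frag.Computes.sumFinset (P.lo i) (c := 1) (v := fun j => L i j * x j)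
      (fun j hj => .mul (.reg ((hT i j).mono (hm.trans hm₁))) (.reg (hy j
        (by simpa using P.lt_of_mem hj)))) fun _ _ => le_rfl).bind
      fun s m₂ hm₂ hs => Frag.Computes.expr_le (c := 2) (.div (.sub (.reg ((hz i).mono
        (hm₁.trans hm₂))) (.reg hs)) (.reg ((hT i i).mono (hm.trans (hm₁.trans hm₂)))))
        le_rfl).mono ?_ fun _ _ _ h => h
    have := P.card_le i
    omega

variable (P)

/-- Computes `f - X w`. -/
def residual (t : Fin N → Fin N → ℕ) (f w : Fin N → ℕ) : Frag (Fin N → ℕ) :=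
  Frag.seqTab (Equiv.refl _) fun i _ => do
    let s₁ ← Frag.sumList (fun k => .reg (t i k) * .reg (w k)) (P.lo i).toList
    let s₂ ← Frag.sumList (fun k => .reg (t k i) * .reg (w k)) (P.up i).toList
    Frag.expr (.reg (f i) - (.reg (t i i) * .reg (w i) + (.reg s₁ + .reg s₂)))

variable {P}

theorem residual_computes {f w : Fin N → ℕ} {v u : Fin N → ℝ} (hX : P.Conforms X)
    (ht : P.HoldsPat mem t X) (hf : HoldsVec mem f v) (hw : HoldsVec mem w u) :
    (P.residual t f w).Computes mem (22 * N) fun r m => HoldsVec m r (v - X.mulVec u) := by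
  refine (Frag.Computes.seqTab (c := fun i => 14 + 2 * (P.up i).card)
    (P := fun i a m => Holds m a ((v - X.mulVec u) i)) (fun _ _ _ _ hm h => h.mono hm)
    fun i r m hm _ => ?_).mono ?_ fun _ _ _ h => h
  · rw [Pi.sub_apply, hX.mulVec_apply]
    refine ((Frag.Computes.sumFinset (P.lo i) (c := 1) (v := fun k => X i k * u k)
      (fun k hk => .mul (.reg ((ht.of_mem hk).mono hm)) (.reg ((hw k).mono hm)))
      fun _ _ => le_rfl).bind fun s₁ m₁ hm₁ hs₁ =>
      (Frag.Computes.sumFinset (P.up i) (c := 1) (v := fun k => X k i * u k)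
      (fun k hk => .mul (.reg ((ht.of_mem (mem_up.1 hk)).mono (hm.trans hm₁)))
        (.reg ((hw k).mono (hm.trans hm₁)))) fun _ _ => le_rfl).bind fun s₂ m₂ hm₂ hs₂ =>
      Frag.Computes.expr_le (c := 4) (.sub (.reg ((hf i).mono (hm.trans (hm₁.trans hm₂))))
        (.add (.mul (.reg ((ht.diag i).mono (hm.trans (hm₁.trans hm₂))))
          (.reg ((hw i).mono (hm.trans (hm₁.trans hm₂))))) (.add (.reg (hs₁.mono hm₂))
          (.reg hs₂)))) le_rfl).mono ?_ fun _ _ _ h => h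
    have := P.card_le i
    omega
  · rw [Finset.sum_add_distrib, ← Finset.mul_sum]
    have := P.sum_card_up_le
    simp
    omega

end Pattern

/-! ### Input and output layout -/

theorem getElem?_flatten_ofFn {m n : ℕ} (f : Fin m → List ℝ) (hf : ∀ i, (f i).length = n)
    (i : Fin m) {j : ℕ} (hj : j < n) :
    (List.ofFn f).flatten[(i : ℕ) * n + j]? = (f i)[j]? := by
  induction m with
  | zero => exact i.elim0
  | succ m ih =>
    rw [List.ofFn_succ, List.flatten_cons]
    induction i using Fin.cases with
    | zero => rw [List.getElem?_append_left (by simpa [hf] using hj)]; simp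
    | succ i =>
      rw [List.getElem?_append_right (by rw [hf, Fin.val_succ, Nat.succ_mul]; omega), hf,
        ← ih (fun i => f i.succ) (fun i => hf _) i]
      congr 1
      rw [Fin.val_succ, Nat.succ_mul]
      omega

theorem length_flatten_ofFn {m n : ℕ} (f : Fin m → List ℝ) (hf : ∀ i, (f i).length = n) :
    (List.ofFn f).flatten.length = m * n := by
  rw [List.length_flatten, List.map_ofFn, List.sum_ofFn]
  simp [hf]

theorem length_matList {M N : ℕ} (X : Matrix (Fin M) (Fin N) ℝ) : (matList X).length = M * N :=
  length_flatten_ofFn _ fun i => by simp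

/-- The address of a matrix entry in a list of matrices with `N` columns, starting at `o`. -/
def matAddr {M N : ℕ} (o : ℕ) (i : Fin M) (j : Fin N) : ℕ := o + ((i : ℕ) * N + j)

theorem getElem?_matList {M N : ℕ} (X : Matrix (Fin M) (Fin N) ℝ) (i : Fin M) (j : Fin N) :
    (matList X)[(i : ℕ) * N + j]? = some (X i j) := by
  rw [matList, getElem?_flatten_ofFn _ (fun i => by simp) i j.2]
  simp

theorem Holds.append_right {mem l : List ℝ} {i o : ℕ} {v : ℝ} (h : Holds mem i v)
    (ho : o = l.length + i) : Holds (l ++ mem) o v := by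
  unfold Holds at *
  rw [ho, List.getElem?_append_right (by omega), Nat.add_sub_cancel_left, h]

theorem holdsMat_matList {M N o : ℕ} (l : List ℝ) (X : Matrix (Fin M) (Fin N) ℝ)
    (ho : o = l.length) : HoldsMat (l ++ matList X) (matAddr o) X := fun i j =>
  Holds.append_right (getElem?_matList X i j) (by rw [ho, matAddr])

theorem HoldsMat.append {ι κ : Type} {mem l : List ℝ} {t : ι → κ → ℕ} {X : Matrix ι κ ℝ}
    (h : HoldsMat mem t X) : HoldsMat (mem ++ l) t X := h.mono (List.prefix_append _ _)

/-- The addresses of the entries of a matrix, row by row. -/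
def addrList {M N : ℕ} (t : Fin M → Fin N → ℕ) : List ℕ :=
  (List.ofFn fun i => List.ofFn (t i)).flatten

theorem HoldsVec.map_ofFn {N : ℕ} {mem : List ℝ} {t : Fin N → ℕ} {v : Fin N → ℝ}
    (h : HoldsVec mem t v) : (List.ofFn t).map (reg mem) = List.ofFn v := by
  rw [List.map_ofFn]
  exact congrArg List.ofFn (funext fun i => (h i).reg)

theorem map_flatten_ofFn {J : ℕ} {mem : List ℝ} {f : Fin J → List ℕ} {g : Fin J → List ℝ}
    (h : ∀ j, (f j).map (reg mem) = g j) :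
    (List.ofFn f).flatten.map (reg mem) = (List.ofFn g).flatten := by
  rw [List.map_flatten, List.map_ofFn]
  exact congrArg (fun x => (List.ofFn x).flatten) (funext h)

theorem HoldsMat.map_addrList {M N : ℕ} {mem : List ℝ} {t : Fin M → Fin N → ℕ}
    {X : Matrix (Fin M) (Fin N) ℝ} (h : HoldsMat mem t X) :
    (addrList t).map (reg mem) = matList X :=
  map_flatten_ofFn fun i => HoldsVec.map_ofFn (h i)

/-- The program that executes a fragment on `s` input registers and returns its result. -/
def Frag.toProg (f : Frag (List ℕ)) (s : ℕ) : Prog := f s fun l _ => .ret l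

theorem Frag.Computes.toProg {f : Frag (List ℕ)} {s c : ℕ} {mem : List ℝ}
    {Q : List ℝ → Prop} (h : f.Computes mem c fun l m => Q (l.map (reg m)))
    (hs : s = mem.length) : Q ((f.toProg s).output mem) ∧ (f.toProg s).cost mem ≤ c := by
  obtain ⟨l, mem', -, hQ, hk⟩ := h
  subst hs
  have := hk fun l _ => .ret l
  rw [Frag.toProg, this.1]
  exact ⟨hQ, by simpa [Prog.cost] using this.2⟩

/-! ### Enclosing the extreme generalised eigenvalues -/

namespace Pattern

variable {N : ℕ} (P : Pattern N)

/-- Decreases the value of register `t` by the factor in register `r` as long as the matrix `t Y - X`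
remains positive definite. -/
def search (X Y : Fin N → Fin N → ℕ) (z r : ℕ) : ℕ → ℕ → Frag ℕ
  | 0, t => pure t
  | k + 1, t => do
    let t' ← Frag.bin .mul t r
    let T ← P.buildMat fun i j => .reg t' * .reg (Y i j) - .reg (X i j)
    let L ← P.chol T
    let d ← Frag.prodList (fun i => L i i) Finset.univ.toList
    Frag.ifLt z d (search X Y z r k t') (pure t)

/-- An upper bound of the largest generalised eigenvalue of a definite pencil with relative
accuracy `1 / D`. -/
def lamMax (D : ℕ) (X Y : Fin N → Fin N → ℕ) : Frag ℕ := do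
  let L ← P.chol Y
  let x ← Frag.seqTab (Equiv.refl _) fun c _ => P.solveVec L (X c)
  let s ← Frag.sumList (fun c => .reg (x c c)) Finset.univ.toList
  let t ← Frag.expr (.reg s + .reg s)
  let r ← Frag.const (D / (D + 1))
  let z ← Frag.const 0
  P.search X Y z r (2 * N * D) t

variable {P} {X Y : Matrix (Fin N) (Fin N) ℝ} {tX tY : Fin N → Fin N → ℕ}

/-- The invariant `lam < v` and `v * q ^ k ≤ lam`, with `k` the number of steps left, excludes
running out of steps: for `k = 0` it is contradictory. When the test first fails, `v * q ≤ lam < v`.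
A step costs `1 + 10 N + (55 N + 1) + (1 + N) + 1` operations. -/
theorem search_computes (hX : P.Conforms X) (hY : P.Conforms Y) (hYp : Y.PosDef) {lam q : ℝ}
    (hlam : (lam • Y - X).PosSemidef) (hmem : lam ∈ genSpectrum X Y) {z r : ℕ} (k : ℕ) :
    ∀ {mem : List ℝ} {t : ℕ} {v : ℝ}, HoldsMat mem tX X → HoldsMat mem tY Y → Holds mem z 0 →
    Holds mem r q → Holds mem t v → lam < v → v * q ^ k ≤ lam →
    (P.search tX tY z r k t).Computes mem ((66 * N + 4) * k)
      fun a m => ∃ v, Holds m a v ∧ lam < v ∧ v * q ≤ lam := by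
  induction k with
  | zero =>
    intro mem t v _ _ _ _ _ h₁ h₂
    rw [pow_zero, mul_one] at h₂
    exact absurd h₁ (not_lt.2 h₂)
  | succ k ih =>
    intro mem t v htX htY hz hr ht h₁ h₂
    refine ((Frag.Computes.bin .mul ht hr).bind fun t' m₁ hm₁ ht' =>
      (buildMat_computes (X := (v * q) • Y - X) (c := 2) (fun i j _ => ?_)
        fun _ _ => le_rfl).bind fun T m₂ hm₂ hT => (chol_computes hT).bind fun L m₃ hm₃ hL =>
      (Frag.Computes.prodFinset (v := fun i => P.cholRec ((v * q) • Y - X) i i) Finset.univ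
        fun i _ => hL i i).bind fun d m₄ hm₄ hd =>
      Frag.Computes.ifLt (c := (66 * N + 4) * k)
        (hz.mono (hm₁.trans (hm₂.trans (hm₃.trans hm₄)))) hd (fun hlt => ?_)
        fun hlt => Frag.Computes.mono (.pure (P := fun a m => ∃ v, Holds m a v ∧ lam < v ∧ v * q ≤ lam)
          ⟨v, ht.mono (hm₁.trans (hm₂.trans (hm₃.trans hm₄))), h₁, ?_⟩) (Nat.zero_le _)
          fun _ _ _ h => h).mono ?_ fun _ _ _ h => h
    · exact .sub (.mul (.reg ht') (.reg ((htY i j).mono hm₁))) (.reg ((htX i j).mono hm₁))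
    · have hm := hm₁.trans (hm₂.trans (hm₃.trans hm₄))
      refine ih (htX.mono hm) (htY.mono hm) (hz.mono hm) (hr.mono hm)
        (ht'.mono (hm₂.trans (hm₃.trans hm₄))) ?_ (by
          rw [pow_succ'] at h₂; simp only [BinOp.eval]; linarith)
      exact (posDef_smul_sub_iff hYp hlam hmem).1 (((hY.smul _).sub hX).posDef_iff.2 hlt)
    · by_contra hc
      exact hlt (((hY.smul _).sub hX).posDef_iff.1
        ((posDef_smul_sub_iff hYp hlam hmem).2 (not_le.1 hc)))
    · rw [Finset.card_univ, Fintype.card_fin]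
      ring_nf
      omega

/-- The trace of `Y⁻¹ X` lies between `lam` and `N * lam`; doubling it makes the starting value
strictly larger than `lam`. Its computation takes `N` sparse solves, and the search takes at most `2
* N * D` tests of cost `O(N)`, so both parts are quadratic in `N`. -/
theorem lamMax_computes (hN : 0 < N) (hX : P.Conforms X) (hY : P.Conforms Y) (hXp : X.PosDef)
    (hYp : Y.PosDef) {D : ℕ} (hD : 0 < D) {mem : List ℝ} (htX : HoldsMat mem tX X)
    (htY : HoldsMat mem tY Y) : (P.lamMax D tX tY).Computes mem ((84 + 140 * D) * N ^ 2)
      fun a m => ∃ v, Holds m a v ∧ ∃ lam ∈ genSpectrum X Y, (∀ μ ∈ genSpectrum X Y, μ ≤ lam) ∧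
        lam < v ∧ v ≤ (1 + 1 / (D : ℝ)) * lam := by
  obtain ⟨lam, hmem, hlam, htr⟩ := exists_max_genEigenvalue hN hX.1 hYp
  obtain ⟨htr₁, htr₂⟩ := htr hXp.posSemidef
  have hpos := pos_of_mem_genSpectrum hXp hYp hmem
  have hDr : (0 : ℝ) < D := by exact_mod_cast hD
  set q : ℝ := ((D / (D + 1) : ℚ) : ℝ) with hq
  have hq' : q = D / (D + 1) := by rw [hq]; push_cast; rfl
  have hYL := hY.isRevCholesky_cholRec fun i => by
    obtain ⟨L, hL⟩ := exists_isRevCholesky hYp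
    exact hY.chol_eq_cholRec hL i i ▸ hL.2.1 i
  -- Bernoulli: `(1 + 1/D) ^ (2 N D) ≥ 1 + 2 N`, which bridges the whole range from `2 N lam` down
  -- to `lam`.
  have hpow : 2 * (N : ℝ) * q ^ (2 * N * D) ≤ 1 := by
    have h₁ : 1 + ((2 * N * D : ℕ) : ℝ) * (1 / D) ≤ (1 + 1 / (D : ℝ)) ^ (2 * N * D) :=
      one_add_mul_le_pow (by have : (0 : ℝ) ≤ 1 / D := by positivity
                             linarith) _
    have h₂ : ((2 * N * D : ℕ) : ℝ) * (1 / D) = 2 * N := by push_cast; field_simp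
    have h₃ : q = (1 + 1 / (D : ℝ))⁻¹ := by rw [hq']; field_simp
    rw [h₃, inv_pow, ← div_eq_mul_inv, div_le_one (by positivity)]
    linarith
  refine ((chol_computes htY.holdsPat).bind fun L m₁ hm₁ hL =>
    (Frag.Computes.seqTab (c := fun _ => 22 * N)
      (P := fun c x m => HoldsVec m x (Y⁻¹.mulVec (X c))) (fun _ _ _ _ hm h => h.mono hm)
      fun c _ m hm _ => solveVec_computes hY hYL (hL.mono hm) ((htX.mono (hm₁.trans hm)) c)).bind
    fun x m₂ hm₂ hx => (Frag.Computes.sumFinset Finset.univ (c := 0)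
      (v := fun c => Y⁻¹.mulVec (X c) c) (fun c _ => .reg (hx c c)) fun _ _ => le_rfl).bind
    fun s m₃ hm₃ hs => (Frag.Computes.expr_le (c := 1) (.add (.reg hs) (.reg hs)) le_rfl).bind
    fun t m₄ hm₄ ht => (Frag.Computes.const (D / (D + 1))).bind fun r m₅ hm₅ hr =>
    (Frag.Computes.const 0).bind fun z m₆ hm₆ hz => ?_).mono
    (c₁ := (55 * N + 1) + (∑ _c : Fin N, 22 * N + ((1 + (0 + 1) * (Finset.univ : Finset (Fin N)).card) + (1 + (1 + (1 +
      (66 * N + 4) * (2 * N * D)))))))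
    (P' := fun a m => ∃ v, Holds m a v ∧ lam < v ∧ v * q ≤ lam) ?_ ?_
  · have hm := hm₁.trans (hm₂.trans (hm₃.trans (hm₄.trans (hm₅.trans hm₆))))
    -- By symmetry the rows of `X` serve as its columns.
    have htrace : ∑ c, Y⁻¹.mulVec (X c) c = (Y⁻¹ * X).trace := by
      simp only [Matrix.trace, Matrix.diag, Matrix.mul_apply, Matrix.mulVec, dotProduct]
      exact Finset.sum_congr rfl fun c _ => Finset.sum_congr rfl fun k _ => by rw [hX.1.apply]
    rw [htrace] at ht
    refine search_computes hX hY hYp hlam hmem _ (htX.mono hm) (htY.mono hm) (by simpa using hz)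
      (hr.mono hm₆) (ht.mono (hm₅.trans hm₆)) (by linarith) ?_
    have hq0 : 0 ≤ q ^ (2 * N * D) := by rw [hq']; positivity
    nlinarith [mul_le_mul_of_nonneg_right htr₂ hq0, mul_le_mul_of_nonneg_left hpow hpos.le]
  · simp only [Finset.sum_const, Finset.card_univ, Fintype.card_fin, smul_eq_mul]
    have h₁ : N ≤ N ^ 2 := Nat.le_self_pow (by norm_num) N
    have h₂ : N * D ≤ N ^ 2 * D := Nat.mul_le_mul_right _ h₁
    have h₃ : (66 * N + 4) * (2 * N * D) = 132 * (N ^ 2 * D) + 8 * (N * D) := by ring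
    have h₄ : N * (22 * N) = 22 * N ^ 2 := by ring
    have h₅ : (84 + 140 * D) * N ^ 2 = 84 * N ^ 2 + 140 * (N ^ 2 * D) := by ring
    have h₆ : 1 ≤ N ^ 2 := Nat.one_le_pow _ _ hN
    rw [h₃, h₄, h₅]
    omega
  · rintro a m _ ⟨v, hv, h₁, h₂⟩
    refine ⟨v, hv, lam, hmem, fun μ hμ => le_of_mem_genSpectrum hYp hlam hμ, h₁, ?_⟩
    rw [hq', mul_div_assoc', div_le_iff₀ (by positivity)] at h₂
    have : (1 + 1 / (D : ℝ)) * lam = lam * (D + 1) / D := by field_simp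
    rw [this, le_div_iff₀ hDr]
    exact h₂

end Pattern

/-! ### The shift parameters -/

section Shifts

variable {a b c d : ℝ}

theorem adiGamma_eq (ha : 0 < a) (hab : a < b) (hcd : c < d) (hd : d < 0) :
    adiGamma a b c d = (a - c) * (b - d) / ((b - c) * (a - d)) := by
  rw [adiGamma, abs_of_neg (by linarith : c - a < 0), abs_of_neg (by linarith : d - b < 0),
    abs_of_neg (by linarith : c - b < 0), abs_of_neg (by linarith : d - a < 0)]
  congr 1 <;> ring

/-- The identity `(a - c)(b - d) - (b - c)(a - d) = (b - a)(d - c)`. -/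
theorem adiGamma_sub_one (ha : 0 < a) (hab : a < b) (hcd : c < d) (hd : d < 0) :
    adiGamma a b c d - 1 = (b - a) * (d - c) / ((b - c) * (a - d)) := by
  have h₁ : 0 < b - c := by linarith
  have h₂ : 0 < a - d := by linarith
  rw [adiGamma_eq ha hab hcd hd]
  field_simp
  ring

theorem one_lt_adiGamma (ha : 0 < a) (hab : a < b) (hcd : c < d) (hd : d < 0) :
    1 < adiGamma a b c d := by
  have h₁ : 0 < b - c := by linarith
  have h₂ : 0 < a - d := by linarith
  have h₃ : 0 < b - a := by linarith
  have h₄ : 0 < d - c := by linarith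
  have := adiGamma_sub_one ha hab hcd hd
  have h₅ : 0 < (b - a) * (d - c) / ((b - c) * (a - d)) := by positivity
  linarith

/-- `a - c ≤ b - c`, and `(b - d)/(a - d) ≤ b/a` because `d < 0`. Thus the condition number of the
left pencil alone controls the number of iterations. -/
theorem adiGamma_le (ha : 0 < a) (hab : a < b) (hcd : c < d) (hd : d < 0) :
    adiGamma a b c d ≤ b / a := by
  have h₁ : 0 < b - c := by linarith
  have h₂ : 0 < a - d := by linarith
  rw [adiGamma_eq ha hab hcd hd, div_le_div_iff₀ (by positivity) ha]
  have h₃ : (b - d) * a ≤ b * (a - d) := by nlinarith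
  have h₄ : 0 ≤ b * (a - d) := mul_nonneg (by linarith) h₂.le
  calc (a - c) * (b - d) * a = (a - c) * ((b - d) * a) := by ring
    _ ≤ (b - c) * (b * (a - d)) :=
      mul_le_mul (by linarith) h₃ (mul_nonneg (by linarith) ha.le) h₁.le
    _ = _ := by ring

theorem one_lt_adiAlpha (h : 1 < adiGamma a b c d) : 1 < adiAlpha a b c d := by
  have := Real.sqrt_nonneg (adiGamma a b c d ^ 2 - adiGamma a b c d)
  rw [adiAlpha]
  linarith

/-- The cross-ratio of `(-α, -1, 1, α)` is `(α + 1)²/(4 α)`; equating it with `γ` gives this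
quadratic equation for `α`. -/
theorem adiAlpha_sub_one_sq (h : 1 < adiGamma a b c d) :
    (adiAlpha a b c d - 1) ^ 2 = 4 * adiAlpha a b c d * (adiGamma a b c d - 1) := by
  have hs := Real.sq_sqrt (show 0 ≤ adiGamma a b c d ^ 2 - adiGamma a b c d by nlinarith)
  rw [adiAlpha]
  linear_combination 4 * hs

/-- `dn² = 1 - k² sin²` lies between `1 - k² = 1/α²` and `1`, whatever the amplitude is. No property
of the elliptic integral or its inverse is needed. -/
theorem adiDn_mem (h : 1 < adiAlpha a b c d) (J i : ℕ) :
    1 ≤ adiAlpha a b c d * adiDn a b c d J i ∧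
      adiAlpha a b c d * adiDn a b c d J i ≤ adiAlpha a b c d := by
  have h0 : 0 < adiAlpha a b c d := by linarith
  rw [adiDn, jacobiDn]
  set k := adiModulus a b c d with hk
  set s := Real.sin (jacobiAm ((2 * (i : ℝ) + 1) / (2 * (J : ℝ)) * ellK k) k)
  have hs : s ^ 2 ≤ 1 := Real.sin_sq_le_one _
  have h1 : 1 / adiAlpha a b c d ^ 2 ≤ 1 := by
    rw [div_le_one (by positivity)]
    nlinarith
  have hk2 : k ^ 2 = 1 - 1 / adiAlpha a b c d ^ 2 := Real.sq_sqrt (by linarith)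
  constructor
  · rw [← div_le_iff₀' h0]
    refine Real.le_sqrt_of_sq_le ?_
    rw [div_pow, one_pow]
    nlinarith [sq_nonneg k, sq_nonneg s]
  · refine mul_le_of_le_one_right h0.le ?_
    refine Real.sqrt_le_iff.2 ⟨zero_le_one, ?_⟩
    nlinarith [mul_nonneg (sq_nonneg k) (sq_nonneg s)]

theorem adiMobius_neg (ha : 0 < a) (hab : a < b) (hcd : c < d) (hd : d < 0) {z : ℝ}
    (h₁ : 1 ≤ z) (h₂ : z ≤ adiAlpha a b c d) : adiMobius a b c d z < 0 := by
  have hγ := one_lt_adiGamma ha hab hcd hd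
  have hα := one_lt_adiAlpha hγ
  have hsq := adiAlpha_sub_one_sq hγ
  have hγ' := adiGamma_sub_one ha hab hcd hd
  rw [adiMobius]
  set α := adiAlpha a b c d
  have hbc : 0 < b - c := by linarith
  have had : 0 < a - d := by linarith
  have hba : 0 < b - a := by linarith
  -- The numerator is affine in `z`, so its sign on `[1, α]` follows from the endpoints. At `z = α`
  -- the equation for `α` turns it into a positive multiple of `d`, reflecting `T(α) = d`.
  have hend : a * ((α - 1) * (α - 1) * (b - c)) + c * (2 * (α + α) * (b - a)) < 0 := by
    have e : a * ((α - 1) * (α - 1) * (b - c)) + c * (2 * (α + α) * (b - a)) =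
        4 * α * (b - a) * (d * (a - c)) / (a - d) := by
      have h3 : (α - 1) * (α - 1) =
          4 * α * ((b - a) * (d - c) / ((b - c) * (a - d))) := by rw [← hγ', ← hsq]; ring
      rw [h3]
      field_simp
      ring
    rw [e]
    refine div_neg_of_neg_of_pos (mul_neg_of_pos_of_neg (by positivity) ?_) had
    exact mul_neg_of_neg_of_pos hd (by linarith)
  have hstart : c * (2 * (1 + α) * (b - a)) < 0 :=
    mul_neg_of_neg_of_pos (by linarith) (by positivity)
  refine div_neg_of_neg_of_pos ?_ ?_
  · have hα1 : 0 < α - 1 := by linarith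
    -- Linear interpolation between the values at `1` and `α`.
    have e : (α - 1) * (a * ((z - 1) * (α - 1) * (b - c)) + c * (2 * (z + α) * (b - a))) =
        (z - 1) * (a * ((α - 1) * (α - 1) * (b - c)) + c * (2 * (α + α) * (b - a))) +
        (α - z) * (c * (2 * (1 + α) * (b - a))) := by ring
    have : (α - 1) * (a * ((z - 1) * (α - 1) * (b - c)) + c * (2 * (z + α) * (b - a))) < 0 := by
      rw [e]
      rcases h₁.eq_or_lt with rfl | h
      · nlinarith
      · nlinarith [mul_neg_of_pos_of_neg (sub_pos.2 h) hend,
          mul_nonpos_of_nonneg_of_nonpos (sub_nonneg.2 h₂) hstart.le]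
    exact neg_of_mul_neg_right this hα1.le
  · have h3 : 0 ≤ (z - 1) * (α - 1) * (b - c) :=
      mul_nonneg (mul_nonneg (by linarith) (by linarith)) hbc.le
    have h4 : 0 < 2 * (z + α) * (b - a) := mul_pos (by linarith) hba
    linarith

theorem adiMobius_pos (ha : 0 < a) (hab : a < b) (hcd : c < d) (hd : d < 0) {z : ℝ}
    (h₁ : 1 ≤ z) (h₂ : z ≤ adiAlpha a b c d) : 0 < adiMobius a b c d (-z) := by
  have hα := one_lt_adiAlpha (one_lt_adiGamma ha hab hcd hd)
  rw [adiMobius]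
  set α := adiAlpha a b c d
  have hbc : 0 < b - c := by linarith
  have hba : 0 < b - a := by linarith
  have hu : (-z - 1) * (α - 1) * (b - c) < 0 :=
    mul_neg_of_neg_of_pos (mul_neg_of_neg_of_pos (by linarith) (by linarith)) hbc
  have hv : 0 ≤ 2 * (-z + α) * (b - a) := mul_nonneg (by linarith) hba.le
  refine div_pos_of_neg_of_neg ?_ ?_
  · nlinarith
  -- Expansion of the denominator around `z = 1`, where it equals `-2 (α - 1)(a - c)`.
  · have e : (-z - 1) * (α - 1) * (b - c) + 2 * (-z + α) * (b - a) =
        -((z - 1) * ((α - 1) * (b - c) + 2 * (b - a)) + 2 * (α - 1) * (a - c)) := by ring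
    rw [e]
    have h3 : 0 ≤ (z - 1) * ((α - 1) * (b - c) + 2 * (b - a)) :=
      mul_nonneg (by linarith) (add_nonneg (mul_nonneg (by linarith) hbc.le) (by linarith))
    have h4 : 0 < 2 * (α - 1) * (a - c) := mul_pos (by linarith) (by linarith)
    linarith

/-- This sign and the opposite one of `q_j` make `p_j C - B` and `A - q_j D` sums of positive
definite matrices. -/
theorem adiShiftP_pos (ha : 0 < a) (hab : a < b) (hcd : c < d) (hd : d < 0) (J i : ℕ) :
    0 < adiShiftP a b c d J i :=
  have h := adiDn_mem (one_lt_adiAlpha (one_lt_adiGamma ha hab hcd hd)) J i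
  adiMobius_pos ha hab hcd hd h.1 h.2

theorem adiShiftQ_neg (ha : 0 < a) (hab : a < b) (hcd : c < d) (hd : d < 0) (J i : ℕ) :
    adiShiftQ a b c d J i < 0 :=
  have h := adiDn_mem (one_lt_adiAlpha (one_lt_adiGamma ha hab hcd hd)) J i
  adiMobius_neg ha hab hcd hd h.1 h.2

/-- Lets `J N²` absorb the part of the solve that lies outside the iteration. -/
theorem one_le_adiCount (ha : 0 < a) (hab : a < b) (hcd : c < d) (hd : d < 0) {ε : ℝ}
    (hε₀ : 0 < ε) (hε₁ : ε < 1) : 1 ≤ adiCount a b c d ε := by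
  rw [adiCount, Nat.one_le_ceil_iff]
  have h := one_lt_adiGamma ha hab hcd hd
  refine div_pos (mul_pos (Real.log_pos (by linarith)) (Real.log_pos ?_)) (by positivity)
  rw [lt_div_iff₀ hε₀]
  linarith

end Shifts

/-! ### Enclosures -/

section Enclosure

variable {N : ℕ} {X Y : Matrix (Fin N) (Fin N) ℝ} {δ a b : ℝ}

/-- With relative error below one, the endpoint is at least `(1 - δ) s` for a positive eigenvalue
`s`. -/
theorem IsEnclosure.pos (hX : X.PosDef) (hY : Y.PosDef) (hδ : δ < 1)
    (h : IsEnclosure δ (genSpectrum X Y) a b) : 0 < a := by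
  obtain ⟨-, -, ⟨s, hs, h₁⟩, -⟩ := h
  have hs' := pos_of_mem_genSpectrum hX hY hs
  rw [abs_of_pos hs'] at h₁
  have := neg_abs_le (a - s)
  nlinarith

theorem IsEnclosure.neg (h : IsEnclosure δ (genSpectrum X Y) a b) :
    IsEnclosure δ (genSpectrum (-X) Y) (-b) (-a) := by
  obtain ⟨h₁, h₂, ⟨s, hs, hs'⟩, ⟨t, ht, ht'⟩⟩ := h
  refine ⟨by linarith, fun μ hμ => ?_, ⟨-t, neg_mem_genSpectrum_neg.2 ht, ?_⟩,
    ⟨-s, neg_mem_genSpectrum_neg.2 hs, ?_⟩⟩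
  · have := h₂ (neg_mem_genSpectrum_neg.1 (by simpa using hμ : -(-μ) ∈ genSpectrum (-X) Y))
    exact ⟨by linarith [this.2], by linarith [this.1]⟩
  · rwa [← neg_add', abs_neg, abs_neg, ← sub_eq_add_neg]
  · rwa [← neg_add', abs_neg, abs_neg, ← sub_eq_add_neg]

theorem IsEnclosure.of_neg (h : IsEnclosure δ (genSpectrum (-X) Y) a b) :
    IsEnclosure δ (genSpectrum X Y) (-b) (-a) := by
  simpa using h.neg

/-- Taking reciprocals preserves the relative accuracy: `1/μ - 1/w = ((w - μ)/w) * (1/μ) ≤ κ/μ` when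
`μ < w ≤ (1 + κ) μ`. So upper bounds for both orders of the pencil enclose the spectrum. -/
theorem isEnclosure_of_bounds (hX : X.PosDef) (hY : Y.PosDef) {κ lam μ v w : ℝ} (hκ : 0 ≤ κ)
    (hκδ : κ ≤ δ)
    (hlam : lam ∈ genSpectrum X Y) (hmax : ∀ s ∈ genSpectrum X Y, s ≤ lam) (hv : lam < v)
    (hv' : v ≤ (1 + κ) * lam) (hμ : μ ∈ genSpectrum Y X)
    (hmin : ∀ s ∈ genSpectrum Y X, s ≤ μ) (hw : μ < w) (hw' : w ≤ (1 + κ) * μ) :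
    IsEnclosure δ (genSpectrum X Y) (1 / w) v := by
  have hlam0 := pos_of_mem_genSpectrum hX hY hlam
  have hμ0 := pos_of_mem_genSpectrum hY hX hμ
  have hμ' : 1 / μ ∈ genSpectrum X Y := by
    rw [one_div]; exact (inv_mem_genSpectrum hμ0.ne').2 hμ
  have hwμ : 1 / w < 1 / μ := one_div_lt_one_div_of_lt hμ0 hw
  have hw0 : 0 < w := hμ0.trans hw
  refine ⟨(hwμ.trans_le (hmax _ hμ')).trans hv, fun s hs => ⟨?_, (hmax s hs).trans hv.le⟩,
    ⟨1 / μ, hμ', ?_⟩, ⟨lam, hlam, ?_⟩⟩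
  · have hs0 := pos_of_mem_genSpectrum hX hY hs
    have := hmin _ ((inv_mem_genSpectrum hs0.ne').2 hs)
    rw [one_div]
    exact inv_le_of_inv_le₀ hs0 (this.trans hw.le)
  · rw [abs_of_neg (sub_neg.2 hwμ), abs_of_pos (one_div_pos.2 hμ0), neg_sub]
    have h1 : 1 / μ - 1 / w ≤ κ * (1 / μ) := by
      have : 1 / μ - 1 / w = (w - μ) / w * (1 / μ) := by field_simp
      rw [this]
      refine mul_le_mul_of_nonneg_right ?_ (one_div_pos.2 hμ0).le
      rw [div_le_iff₀ hw0]
      nlinarith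
    exact h1.trans (mul_le_mul_of_nonneg_right hκδ (one_div_pos.2 hμ0).le)
  · rw [abs_of_pos (sub_pos.2 hv), abs_of_pos hlam0]
    nlinarith

end Enclosure

/-! ### The precomputation -/

namespace Pattern

variable {N : ℕ} (P : Pattern N)

/-- Encloses the spectrum of a definite pencil. -/
def enclose (D : ℕ) (X Y : Fin N → Fin N → ℕ) : Frag (ℕ × ℕ) := do
  let v ← P.lamMax D X Y
  let w ← P.lamMax D Y X
  let a ← Frag.expr (.const 1 / .reg w)
  pure (a, v)

variable {P} {X Y : Matrix (Fin N) (Fin N) ℝ} {tX tY : Fin N → Fin N → ℕ}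

theorem enclose_computes (hN : 0 < N) (hX : P.Conforms X) (hY : P.Conforms Y) (hXp : X.PosDef)
    (hYp : Y.PosDef) {D : ℕ} (hD : 0 < D) {δ : ℝ} (hδ : 1 / (D : ℝ) ≤ δ) {mem : List ℝ}
    (htX : HoldsMat mem tX X) (htY : HoldsMat mem tY Y) :
    (P.enclose D tX tY).Computes mem ((170 + 280 * D) * N ^ 2) fun t m =>
      ∃ a b, Holds m t.1 a ∧ Holds m t.2 b ∧ IsEnclosure δ (genSpectrum X Y) a b := by
  refine ((lamMax_computes hN hX hY hXp hYp hD htX htY).bind fun v m₁ hm₁ hv =>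
    (lamMax_computes hN hY hX hYp hXp hD (htY.mono hm₁) (htX.mono hm₁)).bind (c₂ := 2)
    fun w m₂ hm₂ hw => ?_).mono ?_ fun _ _ _ h => h
  · obtain ⟨v', hv', lam, hlam, hmax, h₁, h₂⟩ := hv
    obtain ⟨w', hw', μ, hμ, hmin, h₃, h₄⟩ := hw
    refine ((Frag.Computes.expr_le (c := 2) (.div (.const 1) (.reg hw')) le_rfl).bind
      fun a m₃ hm₃ ha => Frag.Computes.pure ⟨1 / w', v', ?_, hv'.mono (hm₂.trans hm₃),
        isEnclosure_of_bounds hXp hYp (by positivity) hδ hlam hmax h₁ h₂ hμ hmin h₃ h₄⟩).mono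
        (by simp) fun _ _ _ h => h
    simpa using ha
  · have h₆ : 1 ≤ N ^ 2 := Nat.one_le_pow _ _ hN
    ring_nf
    omega

end Pattern

/-- Negates a matrix. -/
def negMat {N : ℕ} (t : Fin N → Fin N → ℕ) : Frag (Fin N → Fin N → ℕ) :=
  Frag.seqTab (Equiv.refl _) fun i _ => Frag.seqTab (Equiv.refl _) fun j _ =>
    Frag.expr (.const 0 - .reg (t i j))

theorem negMat_computes {N : ℕ} {mem : List ℝ} {t : Fin N → Fin N → ℕ}
    {X : Matrix (Fin N) (Fin N) ℝ} (h : HoldsMat mem t X) :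
    (negMat t).Computes mem (2 * N ^ 2) fun t m => HoldsMat m t (-X) := by
  refine (Frag.Computes.seqTab (c := fun _ => 2 * N) (P := fun i t m => HoldsVec m t ((-X) i))
    (fun _ _ _ _ hm h => h.mono hm) fun i _ m hm _ => ?_).mono ?_ fun _ _ _ h => h
  · refine (Frag.Computes.seqTab (c := fun _ => 2) (P := fun j a m => Holds m a ((-X) i j))
      (fun _ _ _ _ hm h => h.mono hm) fun j _ m' hm' _ => Frag.Computes.expr_le
        (((Expr.Denotes.const 0).sub (.reg ((h i j).mono (hm.trans hm')))).congr (by simp))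
        le_rfl).mono ?_ fun _ _ _ h => h
    simp [mul_comm]
  · simp [pow_two]
    exact (by ring : N * (2 * N) = 2 * (N * N)).le

/-- The absolute value, as an expression. -/
def Expr.abs (e : Expr) : Expr := .un .sqrt (e * e)

theorem Expr.Denotes.abs {mem : List ℝ} {e : Expr} {v : ℝ} (h : e.Denotes mem v) :
    e.abs.Denotes mem |v| :=
  (Expr.Denotes.sqrt (h.mul h)).congr (Real.sqrt_mul_self_eq_abs v)

/-- The number of iterations, and registers for `α`, the modulus `k` and `K(k)`. -/
def params (a b c d e : ℕ) : Frag (ℕ × ℕ × ℕ × ℕ) := do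
  let g ← Frag.expr ((.reg c - .reg a : Expr).abs * (.reg d - .reg b : Expr).abs /
    ((.reg c - .reg b : Expr).abs * (.reg d - .reg a : Expr).abs))
  -- Only rational literals are available; `π` is obtained as `2 K(0)`.
  let π ← Frag.expr (.const 2 * .un .ellK (.const 0))
  let x ← Frag.expr (.un .log (.const 16 * .reg g) * .un .log (.const 4 / .reg e) /
    (.reg π * .reg π))
  let J ← Frag.ceil x
  let α ← Frag.expr (.const (-1) + .const 2 * .reg g +
    .const 2 * .un .sqrt (.reg g * .reg g - .reg g))
  let k ← Frag.expr (.un .sqrt (.const 1 - .const 1 / (.reg α * .reg α)))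
  let κ ← Frag.un .ellK k
  pure (J, α, k, κ)

theorem ellK_zero : ellK 0 = Real.pi / 2 := by
  simp [ellK, ellF]

theorem params_computes {mem : List ℝ} {a b c d e : ℕ} {va vb vc vd ve : ℝ}
    (ha : Holds mem a va) (hb : Holds mem b vb) (hc : Holds mem c vc) (hd : Holds mem d vd)
    (he : Holds mem e ve) :
    (params a b c d e).Computes mem (60 + adiCount va vb vc vd ve) fun t m =>
      t.1 = adiCount va vb vc vd ve ∧ Holds m t.2.1 (adiAlpha va vb vc vd) ∧
      Holds m t.2.2.1 (adiModulus va vb vc vd) ∧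
      Holds m t.2.2.2 (ellK (adiModulus va vb vc vd)) := by
  refine ((Frag.Computes.expr_le (c := 19) (v := adiGamma va vb vc vd)
    (.div (.mul (.abs (.sub (.reg hc) (.reg ha))) (.abs (.sub (.reg hd) (.reg hb))))
      (.mul (.abs (.sub (.reg hc) (.reg hb))) (.abs (.sub (.reg hd) (.reg ha)))))
      (Nat.le_of_ble_eq_true rfl)).bind fun g m₁ hm₁ hg =>
    (Frag.Computes.expr_le (c := 4) (v := Real.pi) (Expr.Denotes.congr
      (.mul (.const 2) (.un .ellK (.const 0)))
      (by simp only [UnOp.eval, Rat.cast_zero, ellK_zero]; push_cast; ring)) (Nat.le_of_ble_eq_true rfl)).bind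
    fun π m₂ hm₂ hπ => (Frag.Computes.expr_le (c := 9) (v := Real.log (16 * adiGamma va vb vc vd) *
        Real.log (4 / ve) / Real.pi ^ 2)
      (Expr.Denotes.congr (.div (.mul (.un .log (.mul (.const 16) (.reg (hg.mono hm₂))))
        (.un .log (.div (.const 4) (.reg (he.mono (hm₁.trans hm₂)))))) (.mul (.reg hπ) (.reg hπ)))
        (by simp only [UnOp.eval, pow_two]; push_cast; rfl)) (Nat.le_of_ble_eq_true rfl)).bind fun x m₃ hm₃ hx =>
    (Frag.Computes.ceil hx).bind fun J m₄ hm₄ hJ =>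
    (Frag.Computes.expr_le (c := 10) (v := adiAlpha va vb vc vd)
      (Expr.Denotes.congr (.add (.add (.const (-1)) (.mul (.const 2)
        (.reg (hg.mono (hm₂.trans (hm₃.trans hm₄)))))) (.mul (.const 2) (.sqrt (.sub (.mul
        (.reg (hg.mono (hm₂.trans (hm₃.trans hm₄)))) (.reg (hg.mono (hm₂.trans (hm₃.trans hm₄)))))
        (.reg (hg.mono (hm₂.trans (hm₃.trans hm₄))))))))
        (by rw [adiAlpha, pow_two]; push_cast; rfl)) (Nat.le_of_ble_eq_true rfl)).bind fun α m₅ hm₅ hα =>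
    (Frag.Computes.expr_le (c := 6) (v := adiModulus va vb vc vd)
      (Expr.Denotes.congr (.sqrt (.sub (.const 1) (.div (.const 1) (.mul (.reg hα) (.reg hα)))))
        (by rw [adiModulus, pow_two]; push_cast; rfl)) (Nat.le_of_ble_eq_true rfl)).bind fun k m₆ hm₆ hk =>
    (Frag.Computes.un .ellK hk).bind fun κ m₇ hm₇ hκ =>
    Frag.Computes.pure ⟨hJ, hα.mono (hm₆.trans hm₇), hk.mono hm₇, hκ⟩).mono ?_ fun _ _ _ h => h
  rw [adiCount]
  omega

/-- The Möbius transformation, as an expression. -/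
def mobiusExpr (a b c α z : Expr) : Expr :=
  (a * ((z - .const 1) * (α - .const 1) * (b - c)) + c * (.const 2 * (z + α) * (b - a))) /
    ((z - .const 1) * (α - .const 1) * (b - c) + .const 2 * (z + α) * (b - a))

theorem mobiusExpr_denotes {mem : List ℝ} {ea eb ec eα ez : Expr} {a b c d z : ℝ}
    (ha : ea.Denotes mem a) (hb : eb.Denotes mem b) (hc : ec.Denotes mem c)
    (hα : eα.Denotes mem (adiAlpha a b c d)) (hz : ez.Denotes mem z) :
    (mobiusExpr ea eb ec eα ez).Denotes mem (adiMobius a b c d z) := by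
  have hu := ((hz.sub (.const 1)).mul (hα.sub (.const 1))).mul (hb.sub hc)
  have hv := ((Expr.Denotes.const 2).mul (hz.add hα)).mul (hb.sub ha)
  refine (((ha.mul hu).add (hc.mul hv)).div (hu.add hv)).congr ?_
  rw [adiMobius]
  push_cast
  rfl

/-- The shifts with index `i`. -/
def shifts (a b c α k κ J i : ℕ) : Frag (ℕ × ℕ) := do
  -- `J` is a natural number known to the program after rounding, so the quotient is a legitimate
  -- rational literal.
  let x ← Frag.expr (.reg α *
    .bin .dn (.const ((2 * i + 1) / (2 * J)) * .reg κ) (.reg k))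
  let p ← Frag.expr (mobiusExpr (.reg a) (.reg b) (.reg c) (.reg α) (.const 0 - .reg x))
  let q ← Frag.expr (mobiusExpr (.reg a) (.reg b) (.reg c) (.reg α) (.reg x))
  pure (p, q)

theorem shifts_computes {mem : List ℝ} {a b c α k κ J i : ℕ} {va vb vc vd : ℝ}
    (ha : Holds mem a va) (hb : Holds mem b vb) (hc : Holds mem c vc)
    (hα : Holds mem α (adiAlpha va vb vc vd)) (hk : Holds mem k (adiModulus va vb vc vd))
    (hκ : Holds mem κ (ellK (adiModulus va vb vc vd))) :
    (shifts a b c α k κ J i).Computes mem 100 fun t m =>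
      Holds m t.1 (adiShiftP va vb vc vd J i) ∧ Holds m t.2 (adiShiftQ va vb vc vd J i) := by
  refine ((Frag.Computes.expr_le (c := 4)
    (v := adiAlpha va vb vc vd * adiDn va vb vc vd J i) (Expr.Denotes.congr (.mul (.reg hα)
      (.bin .dn (.mul (.const ((2 * i + 1) / (2 * J))) (.reg hκ)) (.reg hk)))
      (by simp only [BinOp.eval, adiDn]; push_cast; rfl)) le_rfl).bind fun x m₁ hm₁ hx =>
    (Frag.Computes.expr_le (c := 48) (v := adiShiftP va vb vc vd J i)
      (mobiusExpr_denotes (.reg (ha.mono hm₁)) (.reg (hb.mono hm₁)) (.reg (hc.mono hm₁))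
        (.reg (hα.mono hm₁)) (((Expr.Denotes.const 0).sub (.reg hx)).congr (by simp)))
      ?_).bind fun p m₂ hm₂ hp =>
    (Frag.Computes.expr_le (c := 48) (v := adiShiftQ va vb vc vd J i)
      (mobiusExpr_denotes (.reg (ha.mono (hm₁.trans hm₂))) (.reg (hb.mono (hm₁.trans hm₂)))
        (.reg (hc.mono (hm₁.trans hm₂))) (.reg (hα.mono (hm₁.trans hm₂))) (.reg (hx.mono hm₂)))
      ?_).bind fun q m₃ hm₃ hq => Frag.Computes.pure ⟨hp.mono hm₃, hq⟩).mono (by simp)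
      fun _ _ _ h => h
  all_goals exact Nat.le_of_ble_eq_true rfl

section Pre

variable {M N : ℕ} (Px : Pattern M) (Py : Pattern N)

/-- The precomputation for the matrices `A, B, C, D` and the tolerance in the given registers, with
relative accuracy `1 / s`. -/
def preFrag (s : ℕ) (tA : Fin M → Fin M → ℕ) (tB tC : Fin N → Fin N → ℕ)
    (tD : Fin M → Fin M → ℕ) (e : ℕ) : Frag (List ℕ) := do
  let (a, b) ← Px.enclose s tA tD
  let tB' ← negMat tB
  -- The enclosure is computed for the definite pencil `(-B, C)`; negation exchanges the two
  -- endpoints.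
  let (d', c') ← Py.enclose s tB' tC
  let c ← Frag.expr (.const 0 - .reg c')
  let d ← Frag.expr (.const 0 - .reg d')
  let (J, α, k, κ) ← params a b c d e
  let r : Fin J → (ℕ × ℕ) × (Fin M → Fin M → ℕ) × (Fin N → Fin N → ℕ) ←
    Frag.seqTab (Equiv.refl _) fun i _ => do
      let (p, q) ← shifts a b c α k κ J i
      let tL ← Px.buildMat fun i j => .reg (tA i j) - .reg q * .reg (tD i j)
      let L ← Px.chol tL
      let tR ← Py.buildMat fun i j => .reg p * .reg (tC i j) - .reg (tB i j)
      let R ← Py.chol tR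
      pure ((p, q), L, R)
  pure ([a, b, c, d] ++ List.ofFn (fun j => (r j).1.1) ++ List.ofFn (fun j => (r j).1.2) ++
    (List.ofFn fun j => addrList (r j).2.1).flatten ++
    (List.ofFn fun j => addrList (r j).2.2).flatten)

variable {Px Py} {A D : Matrix (Fin M) (Fin M) ℝ} {B C : Matrix (Fin N) (Fin N) ℝ}

theorem preFrag_computes (hM : 0 < M) (hN : 0 < N) (hA : Px.Conforms A) (hB : Py.Conforms (-B))
    (hC : Py.Conforms C) (hD : Px.Conforms D) (hAp : A.PosDef) (hBp : (-B).PosDef)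
    (hCp : C.PosDef) (hDp : D.PosDef) {s : ℕ} (hs : 0 < s) {δ : ℝ} (hsδ : 1 / (s : ℝ) ≤ δ)
    (hδ₁ : δ < 1) {ε : ℝ} {mem : List ℝ} {tA tD : Fin M → Fin M → ℕ}
    {tB tC : Fin N → Fin N → ℕ} {e : ℕ} (htA : HoldsMat mem tA A) (htB : HoldsMat mem tB B)
    (htC : HoldsMat mem tC C) (htD : HoldsMat mem tD D) (he : Holds mem e ε) :
    ∃ S : ADIData M N, S.IsPrecomputation δ ε A B C D ∧
      (preFrag Px Py s tA tB tC tD e).Computes mem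
        ((170 + 280 * s) * M ^ 2 + (172 + 280 * s) * N ^ 2 + 64 + S.J * (103 + 65 * (M + N)))
        fun l m => l.map (reg m) = S.toList := by
  have hpos : ∀ {K : ℕ} {P : Pattern K} {X : Matrix (Fin K) (Fin K) ℝ}, P.Conforms X →
      X.PosDef → IsRevCholesky X (Matrix.of (P.cholRec X)) := fun hX hXp =>
    hX.isRevCholesky_cholRec fun i => by
      obtain ⟨L, hL⟩ := exists_isRevCholesky hXp
      exact hX.chol_eq_cholRec hL i i ▸ hL.2.1 i
  -- The first runs are opened before `S` is chosen, since the endpoints and `J`, and with them the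
  -- cost bound, depend on the values they produce. The same runs are later fed to `bind` with a
  -- postcondition fixing result and memory.
  obtain ⟨⟨ra, rb⟩, m₁, hm₁, ⟨a, b, ha, hb, hab⟩, hk₁⟩ :=
    Pattern.enclose_computes hM hA hD hAp hDp hs hsδ htA htD
  obtain ⟨tB', m₂, hm₂, htB', hk₂⟩ := negMat_computes (htB.mono hm₁)
  obtain ⟨⟨rd, rc⟩, m₃, hm₃, ⟨d', c', hd', hc', hcd'⟩, hk₃⟩ :=
    Pattern.enclose_computes hN hB hC hBp hCp hs hsδ htB' (htC.mono (hm₁.trans hm₂))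
  have ha0 : 0 < a := hab.pos hAp hDp hδ₁
  have hd0 : -d' < 0 := neg_lt_zero.2 (hcd'.pos hBp hCp hδ₁)
  have hlt : -c' < -d' := neg_lt_neg hcd'.1
  set J := adiCount a b (-c') (-d') ε with hJ
  have hPL : ∀ j : Fin J, (A - adiShiftQ a b (-c') (-d') J j • D).PosDef := fun j => by
    rw [sub_eq_add_neg, ← neg_smul]
    exact hAp.add (hDp.smul (neg_pos.2 (adiShiftQ_neg ha0 hab.1 hlt hd0 J j)))
  have hPR : ∀ j : Fin J, (adiShiftP a b (-c') (-d') J j • C - B).PosDef := fun j => by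
    rw [sub_eq_add_neg]
    exact (hCp.smul (adiShiftP_pos ha0 hab.1 hlt hd0 J j)).add hBp
  have hCL : ∀ j : Fin J, Px.Conforms (A - adiShiftQ a b (-c') (-d') J j • D) := fun j =>
    hA.sub (hD.smul _)
  have hCR : ∀ j : Fin J, Py.Conforms (adiShiftP a b (-c') (-d') J j • C - B) := fun j => by
    rw [sub_eq_add_neg]
    exact (hC.smul _).add hB
  let S : ADIData M N :=
    { a := a, b := b, c := -c', d := -d', J := J
      p := fun j => adiShiftP a b (-c') (-d') J j
      q := fun j => adiShiftQ a b (-c') (-d') J j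
      L := fun j => Matrix.of (Px.cholRec (A - adiShiftQ a b (-c') (-d') J j • D))
      R := fun j => Matrix.of (Py.cholRec (adiShiftP a b (-c') (-d') J j • C - B)) }
  refine ⟨S, ⟨hab, ?_, hJ, fun _ => rfl, fun _ => rfl, fun j => hpos (hCL j) (hPL j),
    fun j => hpos (hCR j) (hPR j)⟩, ?_⟩
  · simpa using hcd'.neg
  refine Frag.Computes.mono (c₁ := (170 + 280 * s) * M ^ 2 + (2 * N ^ 2 +
    ((170 + 280 * s) * N ^ 2 + (2 + (2 + ((60 + J) + (J * (102 + 65 * (M + N))))))))) ?_ ?_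
    fun _ _ _ h => h
  · refine Frag.Computes.bind (P := fun t m => t = (ra, rb) ∧ m = m₁)
      ⟨(ra, rb), m₁, hm₁, ⟨rfl, rfl⟩, hk₁⟩ ?_
    rintro _ _ - ⟨rfl, rfl⟩
    refine Frag.Computes.bind (P := fun t m => t = tB' ∧ m = m₂)
      ⟨tB', m₂, hm₂, ⟨rfl, rfl⟩, hk₂⟩ ?_
    rintro _ _ - ⟨rfl, rfl⟩
    refine Frag.Computes.bind (P := fun t m => t = (rd, rc) ∧ m = m₃)
      ⟨(rd, rc), m₃, hm₃, ⟨rfl, rfl⟩, hk₃⟩ ?_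
    rintro _ _ - ⟨rfl, rfl⟩
    refine (Frag.Computes.expr_le (c := 2) (v := -c')
      (((Expr.Denotes.const 0).sub (.reg hc')).congr (by simp)) le_rfl).bind
      fun c m₄ hm₄ hc => (Frag.Computes.expr_le (c := 2) (v := -d')
      (((Expr.Denotes.const 0).sub (.reg (hd'.mono hm₄))).congr (by simp)) le_rfl).bind
      fun d m₅ hm₅ hd => ?_
    have h25 := hm₂.trans (hm₃.trans (hm₄.trans hm₅))
    have h15 := hm₁.trans h25
    refine (params_computes (ha.mono h25) (hb.mono h25) (hc.mono hm₅) hd (he.mono h15)).bind ?_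
    rintro ⟨J', α, k, κ⟩ m₆ hm₆ ⟨hJ', hα, hk, hκ⟩
    simp only at hJ' hα hk hκ
    rw [← hJ] at hJ'
    subst hJ'
    have h26 := h25.trans hm₆
    have h16 := h15.trans hm₆
    refine ((Frag.Computes.seqTab (c := fun _ => 102 + 65 * (M + N))
      (P := fun j r m => (Holds m r.1.1 (S.p j) ∧ Holds m r.1.2 (S.q j)) ∧
        HoldsMat m r.2.1 (S.L j) ∧ HoldsMat m r.2.2 (S.R j)) ?_ ?_).bind
      fun r m₇ hm₇ hr => Frag.Computes.pure ?_).mono ?_ fun _ _ _ h => h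
    · rintro j r m m' hm ⟨⟨h₁, h₂⟩, h₃, h₄⟩
      exact ⟨⟨h₁.mono hm, h₂.mono hm⟩, h₃.mono hm, h₄.mono hm⟩
    · intro j _ m hm _
      refine ((shifts_computes (J := J) (i := j) (ha.mono (h26.trans hm)) (hb.mono (h26.trans hm))
        (hc.mono (hm₅.trans (hm₆.trans hm))) (hα.mono hm) (hk.mono hm) (hκ.mono hm)).bind
        (c₂ := 2 + 65 * (M + N)) ?_).mono (by omega) fun _ _ _ h => h
      rintro ⟨p, q⟩ m₇ hm₇ ⟨hp, hq⟩
      have h17 := h16.trans (hm.trans hm₇)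
      refine ((Pattern.buildMat_computes (P := Px) (c := 2)
        (X := A - adiShiftQ a b (-c') (-d') J j • D)
        (fun i l _ => .sub (.reg ((htA i l).mono h17)) (.mul (.reg hq) (.reg ((htD i l).mono h17))))
        fun _ _ => le_rfl).bind fun tL m₈ hm₈ htL =>
        (Pattern.chol_computes htL).bind fun L m₉ hm₉ hL =>
        (Pattern.buildMat_computes (P := Py) (c := 2)
        (X := adiShiftP a b (-c') (-d') J j • C - B) (fun i l _ =>
          .sub (.mul (.reg (hp.mono (hm₈.trans hm₉)))
            (.reg ((htC i l).mono (h17.trans (hm₈.trans hm₉)))))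
            (.reg ((htB i l).mono (h17.trans (hm₈.trans hm₉)))))
        fun _ _ => le_rfl).bind fun tR m₁₀ hm₁₀ htR =>
        (Pattern.chol_computes htR).bind fun R m₁₁ hm₁₁ hR => Frag.Computes.pure
        ⟨⟨hp.mono (hm₈.trans (hm₉.trans (hm₁₀.trans hm₁₁))),
          hq.mono (hm₈.trans (hm₉.trans (hm₁₀.trans hm₁₁)))⟩,
          hL.mono (hm₁₀.trans hm₁₁), hR⟩).mono (by ring_nf; omega) fun _ _ _ h => h
    · have h27 := h26.trans hm₇
      rw [ADIData.toList]
      simp only [List.map_append]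
      congr 1
      · congr 1
        · congr 1
          · congr 1
            · simp only [List.map_cons, List.map_nil, (ha.mono h27).reg, (hb.mono h27).reg,
                (hc.mono (hm₅.trans (hm₆.trans hm₇))).reg, (hd.mono (hm₆.trans hm₇)).reg]
              rfl
            · exact HoldsVec.map_ofFn fun j => (hr j).1.1
          · exact HoldsVec.map_ofFn fun j => (hr j).1.2
        · exact map_flatten_ofFn fun j => (hr j).2.1.map_addrList
      · exact map_flatten_ofFn fun j => (hr j).2.2.map_addrList
    · simp [S]
  · change _ ≤ _ + J * (103 + 65 * (M + N))
    ring_nf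
    omega

end Pre

/-! ### The solve -/

theorem foldl_eq_of_rec {α : Type} {J : ℕ} (f : α → Fin J → α) (w : ℕ → α)
    (h : ∀ j : Fin J, w (j + 1) = f (w j) j) : Fin.foldl J f (w 0) = w J := by
  induction J with
  | zero => simp
  | succ J ih =>
    rw [Fin.foldl_succ_last, ih (fun a j => f a j.castSucc) fun j => by simpa using h j.castSucc]
    simpa using (h (Fin.last J)).symm

/-- The ADI iterates. -/
def adiIter {M N : ℕ} (A : Matrix (Fin M) (Fin M) ℝ) (B C : Matrix (Fin N) (Fin N) ℝ)
    (D : Matrix (Fin M) (Fin M) ℝ) (F : Matrix (Fin M) (Fin N) ℝ) (S : ADIData M N) :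
    ℕ → Matrix (Fin M) (Fin N) ℝ
  | 0 => 0
  | k + 1 => if h : k < S.J then
      adiStep A B C D F (S.p ⟨k, h⟩) (S.q ⟨k, h⟩) (adiIter A B C D F S k)
    else adiIter A B C D F S k

section Solve

variable {M N : ℕ} (Px : Pattern M) (Py : Pattern N)

/-- One ADI step. -/
def stepFrag (tA : Fin M → Fin M → ℕ) (tB tC : Fin N → Fin N → ℕ) (tD : Fin M → Fin M → ℕ)
    (tF : Fin M → Fin N → ℕ) (p q : ℕ) (L : Fin M → Fin M → ℕ) (R : Fin N → Fin N → ℕ)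
    (W : Fin M → Fin N → ℕ) : Frag (Fin M → Fin N → ℕ) := do
  let tX ← Px.buildMat fun i j => .reg (tA i j) - .reg p * .reg (tD i j)
  let Q ← Frag.seqTab (Equiv.refl _) fun c _ => Px.residual tX (fun r => tF r c) (fun r => W r c)
  let V ← Frag.seqTab (Equiv.refl _) fun r _ => Py.solveVec R fun c => Q c r
  let tY ← Py.buildMat fun i j => .reg q * .reg (tC i j) - .reg (tB i j)
  let G ← Frag.seqTab (Equiv.refl _) fun r _ => Py.residual tY (tF r) (V r)
  let W' ← Frag.seqTab (Equiv.refl _) fun c _ => Px.solveVec L fun r => G r c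
  pure fun r c => W' c r

/-- The solve with `J` iterations. -/
def solveFrag (J : ℕ) (tA : Fin M → Fin M → ℕ) (tB tC : Fin N → Fin N → ℕ)
    (tD : Fin M → Fin M → ℕ) (tF : Fin M → Fin N → ℕ) (tp tq : Fin J → ℕ)
    (tL : Fin J → Fin M → Fin M → ℕ) (tR : Fin J → Fin N → Fin N → ℕ) : Frag (List ℕ) := do
  let z ← Frag.const 0
  let K ← Py.chol tC
  let W ← Frag.loop (fun j W => stepFrag Px Py tA tB tC tD tF (tp j) (tq j) (tL j) (tR j) W)
    (fun _ _ => z) J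
  let U ← Frag.seqTab (Equiv.refl _) fun r _ => Py.solveVec K (W r)
  pure (addrList U)

variable {Px Py} {A D : Matrix (Fin M) (Fin M) ℝ} {B C : Matrix (Fin N) (Fin N) ℝ}
  {F : Matrix (Fin M) (Fin N) ℝ} {mem : List ℝ} {tA tD : Fin M → Fin M → ℕ}
  {tB tC : Fin N → Fin N → ℕ} {tF : Fin M → Fin N → ℕ}

/-- Matrices on the left act column by column, matrices on the right row by row. The two residuals
and two solves cost `22 M N` each; assembling the two sparse matrices takes the remaining `10 (M +
N)`. The second residual uses only the pattern of `t C - B`, not definiteness. -/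
theorem stepFrag_computes (hA : Px.Conforms A) (hB : Py.Conforms B)
    (hC : Py.Conforms C) (hD : Px.Conforms D) (htA : HoldsMat mem tA A) (htB : HoldsMat mem tB B)
    (htC : HoldsMat mem tC C) (htD : HoldsMat mem tD D) (htF : HoldsMat mem tF F)
    {p q : ℕ} {s t : ℝ} (hp : Holds mem p s) (hq : Holds mem q t)
    {tL : Fin M → Fin M → ℕ} {tR : Fin N → Fin N → ℕ} {L : Matrix (Fin M) (Fin M) ℝ}
    {R : Matrix (Fin N) (Fin N) ℝ} (htL : HoldsMat mem tL L) (htR : HoldsMat mem tR R)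
    (hL : IsRevCholesky (A - t • D) L) (hR : IsRevCholesky (s • C - B) R)
    {tW : Fin M → Fin N → ℕ} {W : Matrix (Fin M) (Fin N) ℝ} (htW : HoldsMat mem tW W) :
    (stepFrag Px Py tA tB tC tD tF p q tL tR tW).Computes mem
      (10 * (M + N) + 88 * (M * N)) fun t' m => HoldsMat m t' (adiStep A B C D F s t W) := by
  set Q : Matrix (Fin M) (Fin N) ℝ := F - (A - s • D) * W with hQ
  set V : Matrix (Fin M) (Fin N) ℝ := Q * (s • C - B)⁻¹ with hV
  set G : Matrix (Fin M) (Fin N) ℝ := F - V * (t • C - B) with hG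
  -- Replacing `B - s C` and `B - t C` by their negatives changes the sign twice.
  have hstep : adiStep A B C D F s t W = (A - t • D)⁻¹ * G := by
    have h₁ : (B - s • C)⁻¹ = -(s • C - B)⁻¹ := by
      rw [← neg_sub (s • C) B]
      refine Matrix.inv_eq_right_inv ?_
      rw [Matrix.neg_mul, Matrix.mul_neg, neg_neg]
      exact Matrix.mul_nonsing_inv _ ((Matrix.isUnit_iff_isUnit_det _).1 hR.posDef.isUnit)
    simp only [adiStep]
    rw [h₁, ← hQ, Matrix.mul_neg, ← hV, Matrix.neg_mul, hG, ← neg_sub (t • C) B, Matrix.mul_neg,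
      neg_neg]
  have hCR : Py.Conforms (s • C - B) := (hC.smul _).sub hB
  have hCR' : Py.Conforms (t • C - B) := (hC.smul _).sub hB
  -- Right multiplication by a symmetric matrix applies that matrix to every row.
  have hsymm : ∀ {S : Matrix (Fin N) (Fin N) ℝ} (Z : Matrix (Fin M) (Fin N) ℝ) (r : Fin M),
      S.IsSymm → S.mulVec (Z r) = (Z * S) r := fun {S} Z r hS => by
    rw [Matrix.mul_apply_eq_vecMul, ← Matrix.mulVec_transpose, hS.eq]
  rw [hstep]
  refine ((Pattern.buildMat_computes (P := Px) (c := 2) (X := A - s • D)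
    (fun i l _ => .sub (.reg (htA i l)) (.mul (.reg hp) (.reg (htD i l)))) fun _ _ => le_rfl).bind
    fun tX m₁ hm₁ htX => (Frag.Computes.seqTab (c := fun _ => 22 * M)
      (P := fun c x m => HoldsVec m x fun r => Q r c) (fun _ _ _ _ hm h => h.mono hm)
      fun c _ m hm _ => Pattern.residual_computes (v := fun r => F r c) (u := fun r => W r c)
        (hA.sub (hD.smul s)) (htX.mono hm) (fun r => (htF r c).mono (hm₁.trans hm))
        fun r => (htW r c).mono (hm₁.trans hm)).bind fun tQ m₂ hm₂ htQ =>
    (Frag.Computes.seqTab (c := fun _ => 22 * N) (P := fun r x m => HoldsVec m x (V r))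
      (fun _ _ _ _ hm h => h.mono hm) fun r _ m hm _ => ?_).bind fun tV m₃ hm₃ htV =>
    (Pattern.buildMat_computes (P := Py) (c := 2) (X := t • C - B)
      (fun i l _ => .sub (.mul (.reg (hq.mono (hm₁.trans (hm₂.trans hm₃))))
        (.reg ((htC i l).mono (hm₁.trans (hm₂.trans hm₃)))))
        (.reg ((htB i l).mono (hm₁.trans (hm₂.trans hm₃))))) fun _ _ => le_rfl).bind
    fun tY m₄ hm₄ htY => (Frag.Computes.seqTab (c := fun _ => 22 * N)
      (P := fun r x m => HoldsVec m x (G r)) (fun _ _ _ _ hm h => h.mono hm)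
      fun r _ m hm _ => ?_).bind fun tG m₅ hm₅ htG =>
    (Frag.Computes.seqTab (c := fun _ => 22 * M)
      (P := fun c x m => HoldsVec m x ((A - t • D)⁻¹.mulVec fun r => G r c))
      (fun _ _ _ _ hm h => h.mono hm)
      fun c _ m hm _ => Pattern.solveVec_computes (hA.sub (hD.smul t)) hL
        (htL.mono (hm₁.trans (hm₂.trans (hm₃.trans (hm₄.trans (hm₅.trans hm))))))
        fun r => (htG r c).mono hm).bind fun tW' m₆ hm₆ htW' =>
    Frag.Computes.pure fun r c => htW' c r).mono ?_ fun _ _ _ h => h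
  · rw [hV, ← hsymm Q r (by
      rw [Matrix.IsSymm, Matrix.transpose_nonsing_inv, hCR.1.eq])]
    exact Pattern.solveVec_computes hCR hR (htR.mono (hm₁.trans (hm₂.trans hm)))
      fun c => (htQ c r).mono hm
  · have : G r = F r - (t • C - B).mulVec (V r) := by
      rw [hsymm V r hCR'.1, hG]; rfl
    rw [this]
    exact Pattern.residual_computes hCR' (htY.mono hm)
      (fun c => (htF r c).mono (hm₁.trans (hm₂.trans (hm₃.trans (hm₄.trans hm)))))
      fun c => (htV r c).mono (hm₄.trans hm)
  · simp only [Finset.sum_const, Finset.card_univ, Fintype.card_fin, smul_eq_mul]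
    ring_nf
    omega

theorem solveFrag_computes (hA : Px.Conforms A) (hB : Py.Conforms B)
    (hC : Py.Conforms C) (hD : Px.Conforms D) (hCp : C.PosDef) {δ ε : ℝ} {S : ADIData M N}
    (hS : S.IsPrecomputation δ ε A B C D)
    (htA : HoldsMat mem tA A) (htB : HoldsMat mem tB B)
    (htC : HoldsMat mem tC C) (htD : HoldsMat mem tD D) (htF : HoldsMat mem tF F)
    {tp tq : Fin S.J → ℕ} {tL : Fin S.J → Fin M → Fin M → ℕ} {tR : Fin S.J → Fin N → Fin N → ℕ}
    (htp : HoldsVec mem tp S.p) (htq : HoldsVec mem tq S.q)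
    (htL : ∀ j, HoldsMat mem (tL j) (S.L j)) (htR : ∀ j, HoldsMat mem (tR j) (S.R j)) :
    (solveFrag Px Py S.J tA tB tC tD tF tp tq tL tR).Computes mem
      (S.J * (10 * (M + N) + 88 * (M * N)) + 55 * N + 22 * (M * N) + 2)
      fun l m => l.map (reg m) = matList (adiSolution A B C D F S) := by
  obtain ⟨LC, hLC⟩ := exists_isRevCholesky hCp
  have hLC' := hC.isRevCholesky_cholRec fun i => hC.chol_eq_cholRec hLC i i ▸ hLC.2.1 i
  have hfold : Fin.foldl S.J (fun W j => adiStep A B C D F (S.p j) (S.q j) W) 0 =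
      adiIter A B C D F S S.J :=
    foldl_eq_of_rec _ (adiIter A B C D F S) fun j => by simp [adiIter]
  rw [adiSolution, hfold]
  refine ((Frag.Computes.const 0).bind fun z m₁ hm₁ hz =>
    (Pattern.chol_computes (P := Py) (htC.mono hm₁).holdsPat).bind fun K m₂ hm₂ hK =>
    (Frag.Computes.loop (c := fun _ => 10 * (M + N) + 88 * (M * N))
      (fun k W m => HoldsMat m W (adiIter A B C D F S k))
      (fun i j => by simpa [adiIter] using hz.mono hm₂) fun j W m hm hW => ?_).bind
    fun W m₃ hm₃ hW => (Frag.Computes.seqTab (c := fun _ => 22 * N)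
      (P := fun r x m => HoldsVec m x (C⁻¹.mulVec (adiIter A B C D F S S.J r)))
      (fun _ _ _ _ hm h => h.mono hm) fun r _ m hm _ =>
      Pattern.solveVec_computes hC hLC' (hK.mono (hm₃.trans hm)) (fun c => (hW r c).mono hm)).bind
    fun U m₄ hm₄ hU => Frag.Computes.pure (HoldsMat.map_addrList fun r c => ?_)).mono ?_
    fun _ _ _ h => h
  · have hm' := hm₁.trans (hm₂.trans hm)
    have := stepFrag_computes hA hB hC hD (htA.mono hm') (htB.mono hm') (htC.mono hm')
      (htD.mono hm') (htF.mono hm') ((htp j).mono hm') ((htq j).mono hm') ((htL j).mono hm')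
      ((htR j).mono hm') (hS.chol_left j) (hS.chol_right j) hW
    simpa [adiIter] using this
  · have := hU r c
    have hCi : C⁻¹.transpose = C⁻¹ := by rw [Matrix.transpose_nonsing_inv, hC.1.eq]
    rwa [← hCi, Matrix.mulVec_transpose, ← Matrix.mul_apply_eq_vecMul] at this
  · simp only [Finset.sum_const, Finset.card_univ, Fintype.card_fin, smul_eq_mul]
    ring_nf
    omega

end Solve

/-! ### Integrals of polynomials -/

theorem intervalIntegrable_poly (q : ℝ[X]) (α β : ℝ) :
    IntervalIntegrable (fun t => q.eval t) MeasureTheory.volume α β :=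
  q.continuous.intervalIntegrable α β

/-- The integral of a polynomial from `α` to `β`. -/
def polyInt (α β : ℝ) : ℝ[X] →ₗ[ℝ] ℝ where
  toFun q := ∫ t in α..β, q.eval t
  map_add' q r := by
    simp only [eval_add]
    exact intervalIntegral.integral_add (intervalIntegrable_poly q α β)
      (intervalIntegrable_poly r α β)
  map_smul' c q := by
    simp only [eval_smul, smul_eq_mul, RingHom.id_apply]
    exact intervalIntegral.integral_const_mul c _

theorem polyInt_apply (α β : ℝ) (q : ℝ[X]) : polyInt α β q = ∫ t in α..β, q.eval t := rfl

theorem polyInt_derivative (α β : ℝ) (q : ℝ[X]) :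
    polyInt α β (derivative q) = q.eval β - q.eval α :=
  intervalIntegral.integral_eq_sub_of_hasDerivAt (fun t _ => q.hasDerivAt t)
    (intervalIntegrable_poly _ α β)

theorem polyInt_nonneg {α β : ℝ} (h : α ≤ β) {q : ℝ[X]}
    (hq : ∀ t ∈ Set.Icc α β, 0 ≤ q.eval t) : 0 ≤ polyInt α β q :=
  intervalIntegral.integral_nonneg h hq

theorem polyInt_sq_nonneg {α β : ℝ} (h : α ≤ β) (q : ℝ[X]) : 0 ≤ polyInt α β (q ^ 2) :=
  polyInt_nonneg h fun t _ => by rw [eval_pow]; positivity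

theorem eq_zero_of_polyInt_sq {α β : ℝ} (h : α < β) {q : ℝ[X]}
    (hq : polyInt α β (q ^ 2) = 0) : q = 0 := by
  have h₁ : ∀ t ∈ Set.Ioo α β, q.eval t = 0 := by
    by_contra! hc
    obtain ⟨t, ht, hne⟩ := hc
    have : 0 < polyInt α β (q ^ 2) := by
      refine intervalIntegral.integral_pos h (q ^ 2).continuous.continuousOn
        (fun s _ => by rw [eval_pow]; positivity) ⟨t, Set.Ioo_subset_Icc_self ht, ?_⟩
      rw [eval_pow]
      positivity
    linarith
  exact Polynomial.eq_zero_of_infinite_isRoot q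
    ((Set.Ioo_infinite h).mono fun t ht => h₁ t ht)

/-- Cauchy–Schwarz against the constant one, obtained by expanding `∫ (|q| - c)² ≥ 0` with `c` the
mean of `|q|`. -/
theorem sq_integral_abs_le {α β : ℝ} (h : α < β) (q : ℝ[X]) :
    (∫ t in α..β, |q.eval t|) ^ 2 ≤ (β - α) * polyInt α β (q ^ 2) := by
  set I := ∫ t in α..β, |q.eval t| with hI
  have hpos : 0 < β - α := sub_pos.2 h
  set c := I / (β - α) with hc
  have hcI : c * (β - α) = I := div_mul_cancel₀ _ hpos.ne'
  have hi₁ : IntervalIntegrable (fun t => |q.eval t|) MeasureTheory.volume α β :=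
    q.continuous.abs.intervalIntegrable α β
  have h₁ : 0 ≤ ∫ t in α..β, ((q ^ 2).eval t - 2 * c * |q.eval t| + c ^ 2) := by
    refine intervalIntegral.integral_nonneg h.le fun t _ => ?_
    rw [eval_pow, ← sq_abs (q.eval t)]
    nlinarith [sq_nonneg (|q.eval t| - c)]
  rw [intervalIntegral.integral_add ((intervalIntegrable_poly _ α β).sub (hi₁.const_mul _))
    intervalIntegrable_const,
    intervalIntegral.integral_sub (intervalIntegrable_poly _ α β) (hi₁.const_mul _),
    intervalIntegral.integral_const_mul, intervalIntegral.integral_const, ← hI, ← polyInt_apply,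
    smul_eq_mul] at h₁
  have h₂ : 0 ≤ (β - α) * (polyInt α β (q ^ 2) - 2 * c * I + (β - α) * c ^ 2) :=
    mul_nonneg hpos.le h₁
  have h₃ : (β - α) * (polyInt α β (q ^ 2) - 2 * c * I + (β - α) * c ^ 2) =
      (β - α) * polyInt α β (q ^ 2) - 2 * (c * (β - α)) * I + (c * (β - α)) ^ 2 := by ring
  rw [h₃, hcI] at h₂
  nlinarith

/-! ### Orthogonality of the integrated Legendre polynomials -/

/-- Integration by parts `k` times; all boundary terms vanish. -/
theorem polyInt_iterate_derivative_mul {α β : ℝ} {g : ℝ[X]} {k : ℕ}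
    (hα : ∀ i < k, (derivative^[i] g).eval α = 0) (hβ : ∀ i < k, (derivative^[i] g).eval β = 0)
    {q : ℝ[X]} (hq : derivative^[k] q = 0) : polyInt α β (derivative^[k] g * q) = 0 := by
  induction k generalizing q with
  | zero => simp only [Function.iterate_zero, id] at hq; simp [hq]
  | succ k ih =>
    have h₁ := ih (fun i hi => hα i (hi.trans k.lt_succ_self))
      (fun i hi => hβ i (hi.trans k.lt_succ_self)) (q := derivative q) (by
        rwa [Function.iterate_succ_apply] at hq)
    have h₂ := polyInt_derivative α β (derivative^[k] g * q)
    rw [derivative_mul, map_add, h₁, add_zero, eval_mul, eval_mul, hα k k.lt_succ_self,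
      hβ k k.lt_succ_self] at h₂
    rw [Function.iterate_succ_apply', h₂]
    ring

/-- `W_k` is a multiple of the `k`-th derivative of `(x² - 1)^(k+1)`, whose derivatives of lower
order vanish at `±1`. This orthogonality is the source of all the sparsity. -/
theorem polyInt_bubbleW_mul {k : ℕ} {q : ℝ[X]} (hq : q.natDegree < k) :
    polyInt (-1) 1 (bubbleW k * q) = 0 := by
  have h : ∀ t : ℝ, t ^ 2 = 1 → ∀ i < k,
      (derivative^[i] ((X ^ 2 - 1 : ℝ[X]) ^ (k + 1))).eval t = 0 := by
    intro t ht i hi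
    obtain ⟨r, hr⟩ := pow_sub_dvd_iterate_derivative_pow (X ^ 2 - 1 : ℝ[X]) (k + 1) i
    rw [hr, eval_mul, eval_pow]
    have : k + 1 - i ≠ 0 := by omega
    simp [ht, zero_pow this]
  have := polyInt_iterate_derivative_mul (h (-1) (by norm_num)) (h 1 (by norm_num))
    (iterate_derivative_eq_zero hq)
  rw [bubbleW, neg_mul, mul_assoc, map_neg, ← smul_eq_C_mul, map_smul, this, smul_zero, neg_zero]

theorem natDegree_bubbleW (k : ℕ) : (bubbleW k).natDegree = k + 2 := by
  have hm : ((X ^ 2 - 1 : ℝ[X]) ^ (k + 1)).Monic :=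
    ((monic_X_pow_sub_C (1 : ℝ) (by norm_num : 2 ≠ 0)).pow (k + 1))
  have hd : ((X ^ 2 - 1 : ℝ[X]) ^ (k + 1)).natDegree = 2 * k + 2 := by
    have : (X ^ 2 - 1 : ℝ[X]).natDegree = 2 := natDegree_X_pow_sub_C (r := (1 : ℝ))
    rw [natDegree_pow, this]; ring
  have hc : (1 / (2 ^ (k + 1) * ((k + 1).factorial : ℝ))) ≠ 0 := by positivity
  rw [bubbleW, natDegree_neg, natDegree_C_mul hc]
  refine le_antisymm ?_ ?_
  · refine (natDegree_iterate_derivative _ _).trans ?_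
    omega
  · refine le_natDegree_of_ne_zero ?_
    rw [coeff_iterate_derivative, show k + 2 + k = 2 * k + 2 by ring, ← hd, hm.coeff_natDegree,
      nsmul_eq_mul, mul_one, hd]
    have : (2 * k + 2).descFactorial k ≠ 0 := by
      rw [Ne, Nat.descFactorial_eq_zero_iff_lt]; omega
    exact_mod_cast this

/-- The affine map from `[α, β]` to `[-1, 1]`. -/
def toRef (α β : ℝ) : ℝ[X] := C (2 / (β - α)) * X - C ((α + β) / (β - α))

theorem natDegree_toRef {α β : ℝ} (h : α < β) : (toRef α β).natDegree = 1 := by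
  have : 2 / (β - α) ≠ 0 := (div_pos two_pos (sub_pos.2 h)).ne'
  rw [toRef, sub_eq_add_neg, ← C_neg]
  exact natDegree_linear this

theorem polyInt_comp_toRef {α β : ℝ} (h : α < β) (p q : ℝ[X]) :
    polyInt α β (p.comp (toRef α β) * q) =
      (β - α) / 2 * polyInt (-1) 1 (p * q.comp (C ((β - α) / 2) * X + C ((α + β) / 2))) := by
  have hpos : 0 < β - α := sub_pos.2 h
  have h₁ := intervalIntegral.integral_comp_mul_sub
    (fun s => (p * q.comp (C ((β - α) / 2) * X + C ((α + β) / 2))).eval s)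
    (div_pos two_pos hpos).ne' ((α + β) / (β - α)) (a := α) (b := β)
  rw [show 2 / (β - α) * α - (α + β) / (β - α) = -1 by field_simp; ring,
    show 2 / (β - α) * β - (α + β) / (β - α) = 1 by field_simp; ring, inv_div, smul_eq_mul] at h₁
  rw [polyInt_apply, polyInt_apply, ← h₁]
  congr 1
  ext t
  simp only [eval_mul, eval_comp, toRef, eval_sub, eval_add, eval_C, eval_X]
  congr 2
  field_simp
  ring

theorem polyInt_bubble_mul {α β : ℝ} (h : α < β) {k : ℕ} {q : ℝ[X]} (hq : q.natDegree < k) :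
    polyInt α β ((bubbleW k).comp (toRef α β) * q) = 0 := by
  rw [polyInt_comp_toRef h, polyInt_bubbleW_mul, mul_zero]
  refine (natDegree_comp_le.trans ?_).trans_lt hq
  exact (Nat.mul_le_mul_left _ natDegree_linear_le).trans (mul_one _).le

theorem eval_bubble_of_mem {α β : ℝ} (h : α < β) (k : ℕ) {t : ℝ} (ht : t = α ∨ t = β) :
    ((bubbleW k).comp (toRef α β)).eval t = 0 := by
  have hpos : 0 < β - α := sub_pos.2 h
  rw [eval_comp]
  refine bubbleW_eval_of_sq_eq_one k ?_
  simp only [toRef, eval_sub, eval_mul, eval_C, eval_X]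
  rcases ht with rfl | rfl
  · rw [show 2 / (β - t) * t - (t + β) / (β - t) = -1 by field_simp; ring]; norm_num
  · rw [show 2 / (t - α) * t - (α + t) / (t - α) = 1 by field_simp; ring]; norm_num

/-! ### Inverse inequalities -/

/-- Among polynomials bounded by one on `[-1, 1]`, the Chebyshev polynomial has the largest
derivative at `1`, namely `n²`. -/
theorem abs_derivative_eval_one_le {n : ℕ} {P : ℝ[X]} (hd : P.natDegree ≤ n)
    (hP : ∀ x ∈ Set.Icc (-1 : ℝ) 1, |P.eval x| ≤ 1) : |(derivative P).eval 1| ≤ (n : ℝ) ^ 2 := by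
  have key : ∀ Q : ℝ[X], Q.natDegree ≤ n → (∀ x ∈ Set.Icc (-1 : ℝ) 1, |Q.eval x| ≤ 1) →
      (derivative Q).eval 1 ≤ (n : ℝ) ^ 2 := fun Q hQd hQ => by
    have := Polynomial.Chebyshev.eval_iterate_derivative_le_of_forall_abs_le_one
      (k := 1) le_rfl (natDegree_le_iff_degree_le.1 hQd) hQ
    have h1 := Polynomial.Chebyshev.derivative_T_eval_one (R := ℝ) n
    simp only [Function.iterate_one] at this
    rw [h1] at this
    exact_mod_cast this
  refine abs_le.2 ⟨?_, key P hd hP⟩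
  have := key (-P) (by rwa [natDegree_neg]) fun x hx => by rw [eval_neg, abs_neg]; exact hP x hx
  rw [derivative_neg, eval_neg] at this
  linarith

theorem abs_derivative_eval_right_le {n : ℕ} {v : ℝ[X]} (hd : v.natDegree ≤ n) {α β M : ℝ}
    (h : α < β) (hM : ∀ x ∈ Set.Icc α β, |v.eval x| ≤ M) :
    |(derivative v).eval β| ≤ 2 * (n : ℝ) ^ 2 / (β - α) * M := by
  have hpos : 0 < β - α := sub_pos.2 h
  have key : ∀ M', 0 < M' → (∀ x ∈ Set.Icc α β, |v.eval x| ≤ M') →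
      |(derivative v).eval β| ≤ 2 * (n : ℝ) ^ 2 / (β - α) * M' := by
    intro M' hM' hb
    set L : ℝ[X] := C ((β - α) / 2) * X + C ((α + β) / 2) with hL
    have h₁ := abs_derivative_eval_one_le (n := n) (P := C (1 / M') * v.comp L) ?_ ?_
    · rw [derivative_C_mul, derivative_comp, eval_mul, eval_C, eval_mul, eval_comp] at h₁
      have e₁ : (derivative L).eval 1 = (β - α) / 2 := by
        rw [hL]
        simp only [derivative_add, derivative_mul, derivative_C, derivative_X, eval_add, eval_mul,
          eval_C, eval_X, eval_zero, eval_one]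
        ring
      have e₂ : L.eval 1 = β := by
        rw [hL]; simp only [eval_add, eval_mul, eval_C, eval_X]; ring
      rw [e₁, e₂, abs_mul, abs_mul, abs_of_pos (one_div_pos.2 hM'), abs_of_pos (half_pos hpos),
        one_div_mul_eq_div, div_le_iff₀ hM'] at h₁
      rw [div_mul_eq_mul_div, le_div_iff₀ hpos]
      linarith
    · refine (natDegree_C_mul_le _ _).trans (natDegree_comp_le.trans ?_)
      calc v.natDegree * L.natDegree ≤ v.natDegree * 1 :=
            Nat.mul_le_mul_left _ natDegree_linear_le
        _ ≤ n := by simpa using hd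
    · intro x hx
      rw [eval_mul, eval_C, eval_comp, abs_mul, abs_of_pos (one_div_pos.2 hM'),
        one_div_mul_eq_div, div_le_one hM']
      refine hb _ ?_
      rw [hL]
      simp only [eval_add, eval_mul, eval_C, eval_X]
      constructor <;> nlinarith [hx.1, hx.2]
  have hM0 : 0 ≤ M := (abs_nonneg _).trans (hM β (Set.right_mem_Icc.2 h.le))
  -- The scaling argument divides by the bound, and `M` may be zero; so `M` is enlarged slightly.
  refine le_of_forall_pos_le_add fun ε hε => ?_
  set c := 2 * (n : ℝ) ^ 2 / (β - α) with hc
  have hc0 : 0 ≤ c := by positivity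
  have hη : 0 < ε / (c + 1) := by positivity
  refine (key (M + ε / (c + 1)) (by linarith) fun x hx => (hM x hx).trans (by linarith)).trans ?_
  rw [mul_add]
  have : c * (ε / (c + 1)) ≤ ε := by
    rw [mul_div_assoc', div_le_iff₀ (by linarith)]
    nlinarith
  linarith

/-- A Markov inequality. -/
theorem abs_derivative_eval_le {n : ℕ} {v : ℝ[X]} (hd : v.natDegree ≤ n) {α β M : ℝ}
    (h : α < β) (hM : ∀ x ∈ Set.Icc α β, |v.eval x| ≤ M) {x : ℝ} (hx : x ∈ Set.Icc α β) :
    |(derivative v).eval x| ≤ 4 * (n : ℝ) ^ 2 / (β - α) * M := by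
  have hpos : 0 < β - α := sub_pos.2 h
  have hM0 : 0 ≤ M := (abs_nonneg _).trans (hM x hx)
  have hc : ∀ l : ℝ, (β - α) / 2 ≤ l →
      2 * (n : ℝ) ^ 2 / l * M ≤ 4 * (n : ℝ) ^ 2 / (β - α) * M := fun l hl => by
    refine mul_le_mul_of_nonneg_right ?_ hM0
    rw [div_le_div_iff₀ (by linarith) hpos]
    nlinarith [sq_nonneg (n : ℝ)]
  -- The endpoint bound is applied on the longer of `[α, x]` and `[x, β]`, after a reflection in the
  -- second case. Its length is at least half of `β - α`, whence the factor `4`.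
  rcases le_total ((α + β) / 2) x with hx' | hx'
  · exact (abs_derivative_eval_right_le hd (by linarith : α < x) fun y hy =>
      hM y ⟨hy.1, hy.2.trans hx.2⟩).trans (hc _ (by linarith))
  · have := abs_derivative_eval_right_le (v := v.comp (-X)) (n := n) ?_
      (by linarith : -β < -x) (M := M) fun y hy => ?_
    · rw [derivative_comp, eval_mul, eval_comp] at this
      simp only [derivative_neg, derivative_X, eval_neg, eval_one, eval_X, neg_neg, neg_mul,
        one_mul, abs_neg] at this
      exact this.trans (hc _ (by linarith))
    · refine natDegree_comp_le.trans ?_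
      rw [natDegree_neg, natDegree_X, mul_one]
      exact hd
    · rw [eval_comp, eval_neg, eval_X]
      exact hM _ ⟨by linarith [hy.2, hx.1], by linarith [hy.1]⟩

theorem exists_antiderivative {n : ℕ} {v : ℝ[X]} (hd : v.natDegree ≤ n) :
    ∃ V : ℝ[X], derivative V = v ∧ V.natDegree ≤ n + 1 := by
  refine ⟨∑ i ∈ Finset.range (n + 1), C (v.coeff i / (i + 1)) * X ^ (i + 1), ?_, ?_⟩
  · rw [derivative_sum]
    conv_rhs => rw [v.as_sum_range_C_mul_X_pow' (Nat.lt_succ_of_le hd)]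
    refine Finset.sum_congr rfl fun i _ => ?_
    rw [derivative_C_mul_X_pow]
    have : ((i : ℝ) + 1) ≠ 0 := by positivity
    push_cast
    rw [div_mul_cancel₀ _ this]
  · refine natDegree_sum_le_of_forall_le _ _ fun i hi => ?_
    refine (natDegree_C_mul_X_pow_le _ _).trans ?_
    have := Finset.mem_range.1 hi
    omega

/-- Markov's inequality for the antiderivative vanishing at `α`, which has degree at most `n + 1`
and is bounded by `∫ |v|`. -/
theorem abs_eval_le_integral {n : ℕ} {v : ℝ[X]} (hd : v.natDegree ≤ n) {α β : ℝ} (h : α < β)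
    {x : ℝ} (hx : x ∈ Set.Icc α β) :
    |v.eval x| ≤ 4 * ((n : ℝ) + 1) ^ 2 / (β - α) * ∫ t in α..β, |v.eval t| := by
  obtain ⟨V, hV, hVd⟩ := exists_antiderivative hd
  have h₁ := abs_derivative_eval_le (v := V - C (V.eval α)) (n := n + 1)
    (by rwa [natDegree_sub_C]) h (M := ∫ t in α..β, |v.eval t|) (fun y hy => ?_) hx
  · rw [derivative_sub, derivative_C, sub_zero, hV] at h₁
    exact_mod_cast h₁
  · rw [eval_sub, eval_C, ← polyInt_derivative, hV, polyInt_apply]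
    refine (intervalIntegral.abs_integral_le_integral_abs hy.1).trans ?_
    refine intervalIntegral.integral_mono_interval le_rfl hy.1 hy.2
      (Filter.Eventually.of_forall fun t => abs_nonneg _) ?_
    exact v.continuous.abs.intervalIntegrable α β

theorem polyInt_le_of_le {α β M : ℝ} (h : α ≤ β) {q : ℝ[X]}
    (hq : ∀ t ∈ Set.Icc α β, q.eval t ≤ M) : polyInt α β q ≤ (β - α) * M := by
  have := intervalIntegral.integral_mono_on h (intervalIntegrable_poly q α β)
    (intervalIntegrable_const (c := M)) hq
  rwa [intervalIntegral.integral_const, smul_eq_mul] at this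

/-- An inverse inequality. -/
theorem polyInt_derivative_sq_le {n : ℕ} {v : ℝ[X]} (hd : v.natDegree ≤ n) {α β : ℝ}
    (h : α < β) : polyInt α β (derivative v ^ 2) ≤
      256 * ((n : ℝ) + 1) ^ 8 / (β - α) ^ 2 * polyInt α β (v ^ 2) := by
  have hpos : 0 < β - α := sub_pos.2 h
  set I := ∫ t in α..β, |v.eval t| with hI
  have hI0 : 0 ≤ I := intervalIntegral.integral_nonneg h.le fun t _ => abs_nonneg _
  set c := 4 * ((n : ℝ) + 1) ^ 2 / (β - α) with hc
  have hc0 : 0 ≤ c := by positivity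
  -- One factor `c` bounds `v` by its integral, the other bounds the derivative by `v`. The
  -- resulting eighth power of `n + 1` is not sharp, but only its logarithm will matter.
  have h₁ : ∀ t ∈ Set.Icc α β, ((derivative v) ^ 2).eval t ≤ (c * (c * I)) ^ 2 := by
    intro t ht
    rw [eval_pow, ← sq_abs]
    refine pow_le_pow_left₀ (abs_nonneg _) ?_ 2
    refine (abs_derivative_eval_le hd h (fun x hx => abs_eval_le_integral hd h hx) ht).trans ?_
    refine mul_le_mul_of_nonneg_right ?_ (mul_nonneg hc0 hI0)
    rw [hc]
    gcongr
    linarith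
  refine (polyInt_le_of_le h.le h₁).trans ?_
  have h₂ := sq_integral_abs_le h v
  rw [← hI] at h₂
  calc (β - α) * (c * (c * I)) ^ 2 = (β - α) * c ^ 4 * I ^ 2 := by ring
    _ ≤ (β - α) * c ^ 4 * ((β - α) * polyInt α β (v ^ 2)) :=
      mul_le_mul_of_nonneg_left h₂ (by positivity)
    _ = _ := by rw [hc]; field_simp; ring

/-! ### The finite element matrices -/

namespace Mesh

variable {a b : ℝ} {n : ℕ} (x : Mesh a b n) (bc : BC)

theorem node_lt_node {i j : ℕ} (hij : i < j) (hj : j ≤ n) : x.node i < x.node j := by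
  induction j with
  | zero => omega
  | succ j ih =>
    have h := x.node_lt j hj
    rcases (Nat.lt_succ_iff.1 hij).lt_or_eq with h' | rfl
    · exact (ih h' (by omega)).trans h
    · exact h

theorem node_le_node {i j : ℕ} (hij : i ≤ j) (hj : j ≤ n) : x.node i ≤ x.node j := by
  rcases hij.lt_or_eq with h | rfl
  · exact (x.node_lt_node h hj).le
  · rfl

/-- The polynomial with which the hat function `j` coincides on element `e`. -/
def hatPoly (j e : ℕ) : ℝ[X] :=
  if e + 1 = j then C (1 / (x.node (e + 1) - x.node e)) * (X - C (x.node e))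
  else if e = j then C (1 / (x.node (e + 1) - x.node e)) * (C (x.node (e + 1)) - X)
  else 0

/-- The polynomial with which the basis function `i` coincides on element `e`. -/
def basisPoly (i e : ℕ) : ℝ[X] :=
  if i < bc.numHats n then x.hatPoly (bc.firstHat + i) e
  else if e = (i - bc.numHats n) % n then
    (bubbleW ((i - bc.numHats n) / n)).comp (toRef (x.node e) (x.node (e + 1)))
  else 0

theorem hat_eq_hatPoly {j e : ℕ} (hj : j ≤ n) (he : e < n) {t : ℝ} (h₁ : x.node e ≤ t)
    (h₂ : t ≤ x.node (e + 1)) : x.hat j t = (x.hatPoly j e).eval t := by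
  have hlt := x.node_lt e he
  have hpos : 0 < x.node (e + 1) - x.node e := sub_pos.2 hlt
  unfold hat hatPoly
  by_cases c₁ : e + 1 = j
  · subst c₁
    rw [if_pos ⟨by omega, by simpa using h₁, h₂⟩, if_pos rfl]
    simp only [Nat.add_sub_cancel, eval_mul, eval_C, eval_sub, eval_X]
    ring
  · rw [if_neg c₁]
    by_cases c₂ : e = j
    · subst c₂
      rw [if_pos rfl]
      simp only [eval_mul, eval_C, eval_sub, eval_X]
      by_cases c₃ : 1 ≤ e ∧ x.node (e - 1) ≤ t ∧ t ≤ x.node e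
      · rw [if_pos c₃]
        have ht : t = x.node e := le_antisymm c₃.2.2 h₁
        have h₃ := x.node_lt (e - 1) (by omega)
        rw [Nat.sub_add_cancel c₃.1] at h₃
        rw [ht, div_self (sub_pos.2 h₃).ne', one_div_mul_cancel hpos.ne']
      · rw [if_neg c₃, if_pos ⟨he, h₁, h₂⟩]
        ring
    · rw [if_neg c₂, eval_zero]
      rcases lt_or_gt_of_ne c₁ with c | c
      · have h₃ := x.node_le_node (show e + 1 ≤ j - 1 by omega) (by omega)
        have h₄ := x.node_lt_node (show j - 1 < j by omega) hj
        by_cases c₃ : 1 ≤ j ∧ x.node (j - 1) ≤ t ∧ t ≤ x.node j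
        · rw [if_pos c₃, le_antisymm (h₂.trans h₃) c₃.2.1]
          simp
        · rw [if_neg c₃, if_neg]
          rintro ⟨-, h₅, -⟩
          linarith
      · have hje : j + 1 ≤ e := by omega
        have h₃ := x.node_le_node hje he.le
        have h₄ := x.node_lt_node (show j < j + 1 by omega) (by omega)
        rw [if_neg (by rintro ⟨-, -, h₅⟩; linarith)]
        by_cases c₃ : j + 1 ≤ n ∧ x.node j ≤ t ∧ t ≤ x.node (j + 1)
        · rw [if_pos c₃, le_antisymm c₃.2.2 (h₃.trans h₁)]
          simp
        · rw [if_neg c₃]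

theorem bubble_eq {k e e' : ℕ} (he : e < n) (he' : e' < n) {t : ℝ} (h₁ : x.node e ≤ t)
    (h₂ : t ≤ x.node (e + 1)) : x.bubble k e' t = if e = e' then
      ((bubbleW k).comp (toRef (x.node e) (x.node (e + 1)))).eval t else 0 := by
  have key : ((bubbleW k).comp (toRef (x.node e') (x.node (e' + 1)))).eval t =
      (bubbleW k).eval ((2 * t - x.node e' - x.node (e' + 1)) /
        (x.node (e' + 1) - x.node e')) := by
    rw [eval_comp]
    congr 1
    simp only [toRef, eval_sub, eval_mul, eval_C, eval_X]
    ring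
  unfold bubble
  by_cases c : e = e'
  · subst c
    rw [if_pos ⟨h₁, h₂⟩, if_pos rfl, key]
  · rw [if_neg c]
    by_cases c₁ : x.node e' ≤ t ∧ t ≤ x.node (e' + 1)
    · rw [if_pos c₁, ← key]
      -- A point in two different elements is an endpoint of both, and bubbles vanish there.
      refine eval_bubble_of_mem (x.node_lt e' he') k ?_
      rcases lt_or_gt_of_ne c with h | h
      · left
        exact le_antisymm (h₂.trans (x.node_le_node h he'.le)) c₁.1
      · right
        exact le_antisymm c₁.2 ((x.node_le_node h he.le).trans h₁)
    · rw [if_neg c₁]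

theorem _root_.GenADI.BC.firstHat_add_le {bc : BC} {n i : ℕ} (h : i < bc.numHats n) :
    bc.firstHat + i ≤ n := by
  cases bc <;> simp only [BC.numHats, BC.firstHat] at * <;> omega

theorem basis_eq {i e : ℕ} (he : e < n) {t : ℝ} (h₁ : x.node e ≤ t)
    (h₂ : t ≤ x.node (e + 1)) : x.basis bc i t = (x.basisPoly bc i e).eval t := by
  unfold basis basisPoly
  split_ifs with c₁ c₂
  · exact x.hat_eq_hatPoly (BC.firstHat_add_le c₁) he h₁ h₂
  · rw [x.bubble_eq he (Nat.mod_lt _ (by omega)) h₁ h₂, if_pos c₂]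
  · rw [x.bubble_eq he (Nat.mod_lt _ (by omega)) h₁ h₂, if_neg c₂, eval_zero]

/-- Agreement is required only inside the elements, since derivatives of basis functions may jump at
the nodes. -/
theorem integral_eq_sum {g : ℝ → ℝ} {q : ℕ → ℝ[X]}
    (h : ∀ e < n, ∀ t ∈ Set.Ioo (x.node e) (x.node (e + 1)), g t = (q e).eval t) :
    ∫ t in a..b, g t = ∑ e ∈ Finset.range n, polyInt (x.node e) (x.node (e + 1)) (q e) := by
  have h' : ∀ e < n, Set.EqOn (fun t => (q e).eval t) g
      (Set.uIoo (x.node e) (x.node (e + 1))) := fun e he t ht => by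
    rw [Set.uIoo_of_lt (x.node_lt e he)] at ht
    exact (h e he t ht).symm
  have := intervalIntegral.sum_integral_adjacent_intervals (f := g) (a := x.node) (n := n)
    (μ := MeasureTheory.volume)
    fun e he => (intervalIntegrable_poly (q e) _ _).congr_uIoo (h' e he)
  rw [x.node_zero, x.node_last] at this
  rw [← this]
  refine Finset.sum_congr rfl fun e he => ?_
  exact (intervalIntegral.integral_congr_uIoo (h' e (Finset.mem_range.1 he))).symm

theorem mass_apply (p : ℕ) (i j : Fin (bc.dof n p)) : x.mass bc p i j =
    ∑ e ∈ Finset.range n, polyInt (x.node e) (x.node (e + 1))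
      (x.basisPoly bc i e * x.basisPoly bc j e) := by
  refine x.integral_eq_sum fun e he t ht => ?_
  rw [eval_mul, x.basis_eq bc he ht.1.le ht.2.le, x.basis_eq bc he ht.1.le ht.2.le]

theorem deriv_basis_eq {i e : ℕ} (he : e < n) {t : ℝ}
    (ht : t ∈ Set.Ioo (x.node e) (x.node (e + 1))) :
    deriv (x.basis bc i) t = (derivative (x.basisPoly bc i e)).eval t := by
  rw [← Polynomial.deriv]
  refine Filter.EventuallyEq.deriv_eq ?_
  filter_upwards [Ioo_mem_nhds ht.1 ht.2] with s hs
  exact x.basis_eq bc he hs.1.le hs.2.le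

theorem stiffness_apply (p : ℕ) (i j : Fin (bc.dof n p)) : x.stiffness bc p i j =
    ∑ e ∈ Finset.range n, polyInt (x.node e) (x.node (e + 1))
      (derivative (x.basisPoly bc i e) * derivative (x.basisPoly bc j e)) := by
  refine x.integral_eq_sum fun e he t ht => ?_
  rw [eval_mul, x.deriv_basis_eq bc he ht, x.deriv_basis_eq bc he ht]

theorem natDegree_hatPoly_le (j e : ℕ) : (x.hatPoly j e).natDegree ≤ 1 := by
  unfold hatPoly
  split_ifs
  · exact (natDegree_C_mul_le _ _).trans (natDegree_X_sub_C_le _)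
  · refine (natDegree_C_mul_le _ _).trans ?_
    rw [← natDegree_neg, neg_sub]
    exact natDegree_X_sub_C_le _
  · simp

theorem natDegree_basisPoly_le {i e : ℕ} (he : e < n) (hi : bc.numHats n ≤ i) :
    (x.basisPoly bc i e).natDegree ≤ (i - bc.numHats n) / n + 2 := by
  unfold basisPoly
  rw [if_neg (not_lt.2 hi)]
  split_ifs
  · rw [natDegree_comp, natDegree_toRef (x.node_lt e he), natDegree_bubbleW, mul_one]
  · simp

theorem hatPoly_node {j e : ℕ} (he : e < n) :
    (x.hatPoly j e).eval (x.node e) = if e = j then 1 else 0 := by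
  have hpos : 0 < x.node (e + 1) - x.node e := sub_pos.2 (x.node_lt e he)
  unfold hatPoly
  by_cases c₁ : e + 1 = j
  · rw [if_pos c₁, if_neg (by omega)]; simp
  · rw [if_neg c₁]
    by_cases c₂ : e = j
    · rw [if_pos c₂, if_pos c₂]
      simp [hpos.ne']
    · rw [if_neg c₂, if_neg c₂]; simp

theorem hatPoly_node_succ {j e : ℕ} (he : e < n) :
    (x.hatPoly j e).eval (x.node (e + 1)) = if e + 1 = j then 1 else 0 := by
  have hpos : 0 < x.node (e + 1) - x.node e := sub_pos.2 (x.node_lt e he)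
  unfold hatPoly
  by_cases c₁ : e + 1 = j
  · rw [if_pos c₁, if_pos c₁]
    simp [hpos.ne']
  · rw [if_neg c₁, if_neg c₁]
    split_ifs <;> simp

theorem bubblePoly_node {i e : ℕ} (he : e < n) (hi : bc.numHats n ≤ i) {t : ℝ}
    (ht : t = x.node e ∨ t = x.node (e + 1)) : (x.basisPoly bc i e).eval t = 0 := by
  unfold basisPoly
  rw [if_neg (not_lt.2 hi)]
  split_ifs
  · exact eval_bubble_of_mem (x.node_lt e he) _ ht
  · exact eval_zero

/-- On each element, a finite element function is the polynomial `x.elemPoly bc v e`. -/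
def elemPoly {p : ℕ} (v : Fin (bc.dof n p) → ℝ) (e : ℕ) : ℝ[X] :=
  ∑ i, v i • x.basisPoly bc i e

theorem gram_quadratic {N : ℕ} {q : Fin N → ℕ → ℝ[X]} {G : Matrix (Fin N) (Fin N) ℝ}
    (hG : ∀ i j, G i j = ∑ e ∈ Finset.range n, polyInt (x.node e) (x.node (e + 1))
      (q i e * q j e)) (v : Fin N → ℝ) :
    v ⬝ᵥ G.mulVec v = ∑ e ∈ Finset.range n, polyInt (x.node e) (x.node (e + 1))
      ((∑ i, v i • q i e) ^ 2) := by
  simp only [dotProduct, Matrix.mulVec, hG, pow_two, map_sum, smul_mul_smul_comm,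
    map_smul, smul_eq_mul, Finset.mul_sum, Finset.sum_mul]
  rw [Finset.sum_comm' (t' := Finset.univ) (s' := fun _ => Finset.range n) (by simp)]
  rw [Finset.sum_comm]
  refine Finset.sum_congr rfl fun i _ => ?_
  rw [Finset.sum_comm]
  refine Finset.sum_congr rfl fun e _ => Finset.sum_congr rfl fun j _ => ?_
  ring

theorem mass_quadratic {p : ℕ} (v : Fin (bc.dof n p) → ℝ) : v ⬝ᵥ (x.mass bc p).mulVec v =
    ∑ e ∈ Finset.range n, polyInt (x.node e) (x.node (e + 1)) (x.elemPoly bc v e ^ 2) :=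
  x.gram_quadratic (x.mass_apply bc p) v

theorem stiffness_quadratic {p : ℕ} (v : Fin (bc.dof n p) → ℝ) :
    v ⬝ᵥ (x.stiffness bc p).mulVec v = ∑ e ∈ Finset.range n,
      polyInt (x.node e) (x.node (e + 1)) (derivative (x.elemPoly bc v e) ^ 2) := by
  rw [x.gram_quadratic (q := fun i e => derivative (x.basisPoly bc i e)) (x.stiffness_apply bc p) v]
  simp only [elemPoly, derivative_sum, derivative_smul]

theorem mass_isSymm (p : ℕ) : (x.mass bc p).IsSymm := by
  ext i j
  simp only [Matrix.transpose_apply, mass, Matrix.of_apply, mul_comm]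

theorem stiffness_isSymm (p : ℕ) : (x.stiffness bc p).IsSymm := by
  ext i j
  simp only [Matrix.transpose_apply, stiffness, Matrix.of_apply, mul_comm]

end Mesh

/-! ### The sparsity pattern -/

/-- Unknown `j < i` is coupled with unknown `i`, where `f` is the index of the first hat function,
`H` the number of hat functions, and `n` the number of elements. -/
def Coupled (f H n i j : ℕ) : Prop :=
  j < i ∧ ((i < H ∧ j + 1 = i) ∨
    (H ≤ i ∧ j < H ∧ (i - H) / n ≤ 1 ∧ (f + j = (i - H) % n ∨ f + j = (i - H) % n + 1)) ∨
    (H ≤ j ∧ (j - H) % n = (i - H) % n ∧ (i - H) / n ≤ (j - H) / n + 2))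

theorem div_lt_div_of_mod_eq {n r s : ℕ} (h : r < s) (hm : r % n = s % n) : r / n < s / n := by
  have h₁ := Nat.div_add_mod r n
  have h₂ := Nat.div_add_mod s n
  exact Nat.lt_of_mul_lt_mul_left (a := n) (by omega)

/-- The at most four candidates for a bubble: two hats of its element and the two preceding bubbles
on it. -/
theorem Coupled.mem_bound {f H n i j : ℕ} (h : Coupled f H n i j) :
    (i < H → j = i - 1) ∧ (H ≤ i → j ∈ ({(i - H) % n - f, (i - H) % n + 1 - f,
      H + (n * ((i - H) / n - 1) + (i - H) % n), H + (n * ((i - H) / n - 2) + (i - H) % n)} :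
        Finset ℕ)) := by
  obtain ⟨hlt, h⟩ := h
  constructor
  · intro hi
    omega
  · intro hi
    simp only [Finset.mem_insert, Finset.mem_singleton]
    rcases h with h | h | ⟨h₁, h₂, h₃⟩
    · omega
    · omega
    · have h₄ := div_lt_div_of_mod_eq (by omega : j - H < i - H) h₂
      have h₅ := Nat.div_add_mod (j - H) n
      have h₆ : ∀ r s : ℕ, r < s → s ≤ r + 2 → r = s - 1 ∨ r = s - 2 := by omega
      rcases h₆ _ _ h₄ h₃ with h | h
      · right; right; left; rw [← h, ← h₂, h₅]; omega
      · right; right; right; rw [← h, ← h₂, h₅]; omega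

/-- A hat has only one earlier neighbour. The two hats coupled with a bubble are adjacent. An
earlier bubble on the same element has smaller index, so it still couples with those hats, and index
differences from bubbles below it only shrink. -/
theorem Coupled.clique {f H n i j k : ℕ} (hi : Coupled f H n k i) (hj : Coupled f H n k j)
    (hji : j < i) : Coupled f H n i j := by
  obtain ⟨hik, hi⟩ := hi
  obtain ⟨hjk, hj⟩ := hj
  refine ⟨hji, ?_⟩
  rcases hi with hi | hi | ⟨hi₁, hi₂, hi₃⟩
  · rcases hj with hj | hj | hj <;> omega
  · rcases hj with hj | hj | hj <;> omega
  · have h₁ := div_lt_div_of_mod_eq (by omega : i - H < k - H) hi₂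
    rcases hj with hj | ⟨hj₁, hj₂, hj₃, hj₄⟩ | ⟨hj₁, hj₂, hj₃⟩
    · omega
    · right; left
      refine ⟨hi₁, hj₂, by omega, by rwa [hi₂]⟩
    · right; right
      exact ⟨hj₁, hj₂.trans hi₂.symm, by omega⟩

open Classical in
/-- The sparsity pattern of the finite element matrices. -/
def femPattern (bc : BC) (n p : ℕ) : Pattern (bc.dof n p) where
  lo i := Finset.univ.filter fun j => Coupled bc.firstHat (bc.numHats n) n i j
  lt_of_mem h := (Finset.mem_filter.1 h).2.1
  card_le i := by
    rcases lt_or_ge (i : ℕ) (bc.numHats n) with hi | hi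
    · refine (Finset.card_le_card_of_injOn (t := ({(i : ℕ) - 1} : Finset ℕ)) Fin.val
        (fun j hj => ?_) Fin.val_injective.injOn).trans (by simp)
      have := (Finset.mem_filter.1 hj).2.mem_bound.1 hi
      simp [this]
    · refine (Finset.card_le_card_of_injOn Fin.val
        (fun j hj => (Finset.mem_filter.1 hj).2.mem_bound.2 hi)
        Fin.val_injective.injOn).trans Finset.card_le_four
  clique hi hj hji := by
    refine Finset.mem_filter.2 ⟨Finset.mem_univ _, ?_⟩
    exact (Finset.mem_filter.1 hi).2.clique (Finset.mem_filter.1 hj).2 hji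

theorem mem_femPattern {bc : BC} {n p : ℕ} {i j : Fin (bc.dof n p)} :
    j ∈ (femPattern bc n p).lo i ↔ Coupled bc.firstHat (bc.numHats n) n i j := by
  simp [femPattern]

/-! ### Sparsity of the finite element matrices and linear independence of the basis -/

namespace Mesh

variable {a b : ℝ} {n : ℕ} (x : Mesh a b n) (bc : BC)

theorem hatPoly_eq_zero {j e : ℕ} (h₁ : e + 1 ≠ j) (h₂ : e ≠ j) : x.hatPoly j e = 0 := by
  rw [hatPoly, if_neg h₁, if_neg h₂]

/-- Uncoupled basis functions are orthogonal, together with their derivatives, on every element. -/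
theorem polyInt_eq_zero_of_not_coupled {e i j : ℕ} (he : e < n) (hji : j < i)
    (h : ¬ Coupled bc.firstHat (bc.numHats n) n i j) :
    polyInt (x.node e) (x.node (e + 1)) (x.basisPoly bc i e * x.basisPoly bc j e) = 0 ∧
    polyInt (x.node e) (x.node (e + 1))
      (derivative (x.basisPoly bc i e) * derivative (x.basisPoly bc j e)) = 0 := by
  set H := bc.numHats n with hH
  rcases lt_or_ge i H with hi | hi
  · have hne : j + 1 ≠ i := fun h' => h ⟨hji, .inl ⟨hi, h'⟩⟩
    have : x.basisPoly bc i e = 0 ∨ x.basisPoly bc j e = 0 := by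
      unfold basisPoly
      rw [← hH, if_pos hi, if_pos (hji.trans hi)]
      by_contra! hc
      have h₁ : e + 1 = bc.firstHat + i ∨ e = bc.firstHat + i := by
        by_contra! h'; exact hc.1 (x.hatPoly_eq_zero h'.1 h'.2)
      have h₂ : e + 1 = bc.firstHat + j ∨ e = bc.firstHat + j := by
        by_contra! h'; exact hc.2 (x.hatPoly_eq_zero h'.1 h'.2)
      omega
    rcases this with h' | h' <;> simp [h']
  · by_cases hei : e = (i - H) % n
    swap
    · have : x.basisPoly bc i e = 0 := by
        unfold basisPoly
        rw [← hH, if_neg (not_lt.2 hi), if_neg hei]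
      simp [this]
    set κ := (i - H) / n with hκ
    have hlt := x.node_lt e he
    have hbi : x.basisPoly bc i e = (bubbleW κ).comp (toRef (x.node e) (x.node (e + 1))) := by
      unfold basisPoly
      rw [← hH, if_neg (not_lt.2 hi), if_pos hei]
    have h0 : ∀ t, t = x.node e ∨ t = x.node (e + 1) → (x.basisPoly bc i e).eval t = 0 :=
      fun t ht => x.bubblePoly_node bc he hi ht
    -- Since the bubble vanishes at both ends, integration by parts moves the derivative to the
    -- other factor, and the stiffness entry is also an integral against the bubble itself.
    have hparts : ∀ q : ℝ[X], polyInt (x.node e) (x.node (e + 1))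
        (derivative (x.basisPoly bc i e) * q) = -polyInt (x.node e) (x.node (e + 1))
        (x.basisPoly bc i e * derivative q) := fun q => by
      have := polyInt_derivative (x.node e) (x.node (e + 1)) (x.basisPoly bc i e * q)
      rw [derivative_mul, map_add, eval_mul, eval_mul, h0 _ (.inl rfl), h0 _ (.inr rfl), zero_mul,
        zero_mul, sub_zero] at this
      linarith
    rw [hparts]
    have hfin : (x.basisPoly bc j e = 0) ∨ ((x.basisPoly bc j e).natDegree < κ) ∨
        (derivative (derivative (x.basisPoly bc j e)) = 0 ∧
          (x.basisPoly bc j e).natDegree < κ) := by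
      rcases lt_or_ge j H with hj | hj
      · have hb : x.basisPoly bc j e = x.hatPoly (bc.firstHat + j) e := by
          unfold basisPoly
          rw [← hH, if_pos hj]
        by_cases hκ1 : κ ≤ 1
        · left
          rw [hb]
          refine x.hatPoly_eq_zero (fun h' => h ⟨hji, .inr (.inl ⟨hi, hj, hκ1, ?_⟩)⟩)
            (fun h' => h ⟨hji, .inr (.inl ⟨hi, hj, hκ1, ?_⟩)⟩) <;> omega
        · right; left
          rw [hb]
          exact (x.natDegree_hatPoly_le _ _).trans_lt (by omega)
      · by_cases hej : e = (j - H) % n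
        · right; left
          refine (x.natDegree_basisPoly_le bc he hj).trans_lt ?_
          by_contra hc
          exact h ⟨hji, .inr (.inr ⟨hj, hej.symm.trans hei, not_lt.1 hc⟩)⟩
        · left
          unfold basisPoly
          rw [← hH, if_neg (not_lt.2 hj), if_neg hej]
    -- Either `j` is absent from this element, or its degree is below the index of the bubble and
    -- orthogonality applies, also to its second derivative.
    have hdeg : x.basisPoly bc j e = 0 ∨ (x.basisPoly bc j e).natDegree < κ := by tauto
    rcases hdeg with hz | hdeg
    · simp [hz]
    · rw [hbi, polyInt_bubble_mul hlt hdeg, polyInt_bubble_mul hlt, neg_zero]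
      · exact ⟨rfl, rfl⟩
      · exact (natDegree_derivative_le _).trans_lt
          ((Nat.sub_le _ _).trans_lt ((natDegree_derivative_le _).trans_lt
            ((Nat.sub_le _ _).trans_lt hdeg)))

theorem mass_conforms (p : ℕ) : (femPattern bc n p).Conforms (x.mass bc p) := by
  refine ⟨x.mass_isSymm bc p, fun i j hji hj => ?_⟩
  rw [mass_apply]
  refine Finset.sum_eq_zero fun e he => ?_
  exact (x.polyInt_eq_zero_of_not_coupled bc (Finset.mem_range.1 he) hji
    fun h => hj (mem_femPattern.2 h)).1

theorem stiffness_conforms (p : ℕ) : (femPattern bc n p).Conforms (x.stiffness bc p) := by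
  refine ⟨x.stiffness_isSymm bc p, fun i j hji hj => ?_⟩
  rw [stiffness_apply]
  refine Finset.sum_eq_zero fun e he => ?_
  exact (x.polyInt_eq_zero_of_not_coupled bc (Finset.mem_range.1 he) hji
    fun h => hj (mem_femPattern.2 h)).2

theorem screened_conforms (ω : ℝ) (p : ℕ) :
    (femPattern bc n p).Conforms (x.screened bc ω p) :=
  (x.stiffness_conforms bc p).add ((x.mass_conforms bc p).smul _)

/-! ### Definiteness -/

variable {p : ℕ}

theorem eval_elemPoly (v : Fin (bc.dof n p) → ℝ) (e : ℕ) (t : ℝ) :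
    (x.elemPoly bc v e).eval t = ∑ i, v i * (x.basisPoly bc i e).eval t := by
  simp [elemPoly, eval_finsetSum]

/-- The basis functions are linearly independent. -/
theorem eq_zero_of_elemPoly_eq_zero (hn : 0 < n) {v : Fin (bc.dof n p) → ℝ}
    (h : ∀ e < n, x.elemPoly bc v e = 0) : v = 0 := by
  by_contra hv
  have hs : (Finset.univ.filter fun i => v i ≠ 0).Nonempty := by
    by_contra hc
    rw [Finset.not_nonempty_iff_eq_empty, Finset.filter_eq_empty_iff] at hc
    exact hv (funext fun i => by simpa using hc (Finset.mem_univ i))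
  -- The largest index with a nonzero coefficient: all later basis functions drop out, and the
  -- earlier ones are separated by a nodal value or by degree.
  obtain ⟨i, hi, hmax⟩ := Finset.exists_max_image _ (fun i => i) hs
  have hvi : v i ≠ 0 := (Finset.mem_filter.1 hi).2
  have hgt : ∀ j, i < j → v j = 0 := fun j hj => by
    by_contra hne
    exact absurd (hmax j (Finset.mem_filter.2 ⟨Finset.mem_univ _, hne⟩)) (not_le.2 hj)
  set H := bc.numHats n with hH
  rcases lt_or_ge (i : ℕ) H with hiH | hiH
  · have key : ∀ e < n, ∀ t, (x.basisPoly bc i e).eval t = 1 →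
        (∀ j : Fin (bc.dof n p), j < i → (x.basisPoly bc j e).eval t = 0) → False := by
      intro e he t h₁ h₂
      have h₃ := x.eval_elemPoly bc v e t
      rw [h e he, eval_zero, Finset.sum_eq_single i, h₁, mul_one] at h₃
      · exact hvi h₃.symm
      · intro j _ hj
        rcases lt_or_gt_of_ne hj with hj | hj
        · rw [h₂ j hj, mul_zero]
        · rw [hgt j hj, zero_mul]
      · simp
    have hle := BC.firstHat_add_le hiH
    have hhat : ∀ j : ℕ, j < H → ∀ e, x.basisPoly bc j e = x.hatPoly (bc.firstHat + j) e :=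
      fun j hj e => by unfold basisPoly; rw [← hH, if_pos hj]
    -- A hat is tested at its own node, seen from the element on its left; node `0` has none, and
    -- there no earlier hat exists.
    rcases Nat.eq_zero_or_pos (bc.firstHat + i) with h0 | h0
    · refine key 0 hn (x.node 0) ?_ fun j hj => by
        have : (j : ℕ) < i := hj
        omega
      rw [hhat i hiH, x.hatPoly_node hn, if_pos h0.symm]
    · have he : bc.firstHat + (i : ℕ) - 1 < n := by omega
      refine key _ he (x.node (bc.firstHat + i - 1 + 1)) ?_ fun j hj => ?_
      · rw [hhat i hiH, x.hatPoly_node_succ he, if_pos (by omega)]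
      · have hji : (j : ℕ) < i := hj
        rw [hhat j (hji.trans hiH), x.hatPoly_node_succ he, if_neg (by omega)]
  · set κ := ((i : ℕ) - H) / n with hκ
    set e := ((i : ℕ) - H) % n with he
    have hen : e < n := Nat.mod_lt _ hn
    have hlt := x.node_lt e hen
    -- A bubble is detected by the coefficient of its exact degree `κ + 2`: earlier basis functions
    -- have smaller degree on this element.
    have h₃ := congrArg (fun q => q.coeff (κ + 2)) (h e hen)
    simp only [elemPoly, finsetSum_coeff, coeff_smul, smul_eq_mul, coeff_zero] at h₃
    rw [Finset.sum_eq_single i] at h₃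
    · refine (mul_ne_zero hvi ?_) h₃
      have hb : x.basisPoly bc i e = (bubbleW κ).comp (toRef (x.node e) (x.node (e + 1))) := by
        unfold basisPoly
        rw [← hH, if_neg (not_lt.2 hiH), if_pos rfl]
      have hd : (x.basisPoly bc i e).natDegree = κ + 2 := by
        rw [hb, natDegree_comp, natDegree_toRef hlt, natDegree_bubbleW, mul_one]
      rw [← hd, coeff_natDegree, Ne, leadingCoeff_eq_zero]
      intro h'
      rw [h', natDegree_zero] at hd
      exact Nat.succ_ne_zero _ hd.symm
    · intro j _ hj
      rcases lt_or_gt_of_ne hj with hj | hj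
      · have hji : (j : ℕ) < i := hj
        rcases lt_or_ge (j : ℕ) H with hjH | hjH
        · rw [coeff_eq_zero_of_natDegree_lt, mul_zero]
          unfold basisPoly
          rw [← hH, if_pos hjH]
          exact (x.natDegree_hatPoly_le _ _).trans_lt (Nat.lt_add_left κ one_lt_two)
        · by_cases hej : e = ((j : ℕ) - H) % n
          · rw [coeff_eq_zero_of_natDegree_lt, mul_zero]
            refine (x.natDegree_basisPoly_le bc hen hjH).trans_lt ?_
            have := div_lt_div_of_mod_eq (n := n) (by omega : (j : ℕ) - H < i - H)
              (hej.symm.trans he)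
            rw [← hH]
            exact Nat.add_lt_add_right this 2
          · unfold basisPoly
            rw [← hH, if_neg (not_lt.2 hjH), if_neg hej, coeff_zero, mul_zero]
      · rw [hgt j hj, zero_mul]
    · simp

end Mesh

theorem abs_eval_sub_le {α β t : ℝ} (V : ℝ[X]) (h₁ : α ≤ t) (h₂ : t ≤ β) :
    |V.eval t - V.eval α| ≤ ∫ s in α..β, |(derivative V).eval s| := by
  rw [← polyInt_derivative, polyInt_apply]
  refine (intervalIntegral.abs_integral_le_integral_abs h₁).trans ?_
  exact intervalIntegral.integral_mono_interval le_rfl h₁ h₂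
    (Filter.Eventually.of_forall fun t => abs_nonneg _)
    ((derivative V).continuous.abs.intervalIntegrable α β)

/-! ### Definiteness and polynomial bounds of the generalised eigenvalues -/

namespace Mesh

variable {a b : ℝ} {n : ℕ} (x : Mesh a b n) (bc : BC) {p : ℕ}

theorem lt (x : Mesh a b n) (hn : 0 < n) : a < b := by
  have := x.node_lt_node hn le_rfl
  rwa [x.node_zero, x.node_last] at this

theorem sum_length : ∑ e ∈ Finset.range n, (x.node (e + 1) - x.node e) = b - a := by
  rw [Finset.sum_range_sub, x.node_zero, x.node_last]

theorem length_le {e : ℕ} (he : e < n) : x.node (e + 1) - x.node e ≤ b - a := by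
  have h₁ := x.node_le_node (Nat.zero_le e) he.le
  have h₂ := x.node_le_node (Nat.succ_le_of_lt he) le_rfl
  rw [x.node_zero] at h₁
  rw [x.node_last] at h₂
  linarith

theorem mass_posDef (hn : 0 < n) : (x.mass bc p).PosDef := by
  refine Matrix.PosDef.of_dotProduct_mulVec_pos ?_ fun v hv => ?_
  · rw [Matrix.IsHermitian, Matrix.conjTranspose_eq_transpose_of_trivial, x.mass_isSymm]
  · rw [star_trivial, x.mass_quadratic]
    have hnn : ∀ e ∈ Finset.range n, 0 ≤ polyInt (x.node e) (x.node (e + 1))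
        (x.elemPoly bc v e ^ 2) := fun e he =>
      polyInt_sq_nonneg (x.node_lt e (Finset.mem_range.1 he)).le _
    refine lt_of_le_of_ne (Finset.sum_nonneg hnn) fun h => hv ?_
    refine x.eq_zero_of_elemPoly_eq_zero bc hn fun e he => ?_
    exact eq_zero_of_polyInt_sq (x.node_lt e he)
      ((Finset.sum_eq_zero_iff_of_nonneg hnn).1 h.symm e (Finset.mem_range.2 he))

theorem stiffness_nonneg (v : Fin (bc.dof n p) → ℝ) : 0 ≤ v ⬝ᵥ (x.stiffness bc p).mulVec v := by
  rw [x.stiffness_quadratic]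
  exact Finset.sum_nonneg fun e he =>
    polyInt_sq_nonneg (x.node_lt e (Finset.mem_range.1 he)).le _

theorem elemPoly_continuous (v : Fin (bc.dof n p) → ℝ) {e : ℕ} (he : e + 1 < n) :
    (x.elemPoly bc v e).eval (x.node (e + 1)) =
      (x.elemPoly bc v (e + 1)).eval (x.node (e + 1)) := by
  rw [eval_elemPoly, eval_elemPoly]
  refine Finset.sum_congr rfl fun i _ => ?_
  rw [← x.basis_eq bc (by omega : e < n) (x.node_lt e (by omega)).le le_rfl,
    ← x.basis_eq bc he le_rfl (x.node_lt (e + 1) he).le]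

theorem elemPoly_left (hn : 0 < n) (v : Fin (BC.dirichlet.dof n p) → ℝ) :
    (x.elemPoly .dirichlet v 0).eval (x.node 0) = 0 := by
  rw [eval_elemPoly]
  refine Finset.sum_eq_zero fun i _ => ?_
  rcases lt_or_ge (i : ℕ) (BC.dirichlet.numHats n) with hi | hi
  · have : x.basisPoly .dirichlet i 0 = x.hatPoly (1 + i) 0 := by
      unfold basisPoly; rw [if_pos hi]; rfl
    rw [this, x.hatPoly_node hn, if_neg (by omega), mul_zero]
  · rw [x.bubblePoly_node _ hn hi (.inl rfl), mul_zero]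

/-- A Poincaré inequality. -/
theorem mass_le_stiffness (hn : 0 < n) (v : Fin (BC.dirichlet.dof n p) → ℝ) :
    v ⬝ᵥ (x.mass .dirichlet p).mulVec v ≤
      n * (b - a) ^ 2 * (v ⬝ᵥ (x.stiffness .dirichlet p).mulVec v) := by
  have hab := x.lt hn
  rw [x.mass_quadratic, x.stiffness_quadratic]
  set u := x.elemPoly .dirichlet v with hu
  set E := fun e => polyInt (x.node e) (x.node (e + 1)) (derivative (u e) ^ 2) with hE
  set g := fun e => ∫ s in x.node e..x.node (e + 1), |(derivative (u e)).eval s| with hg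
  have hlt : ∀ e ∈ Finset.range n, x.node e < x.node (e + 1) := fun e he =>
    x.node_lt e (Finset.mem_range.1 he)
  have hg0 : ∀ e ∈ Finset.range n, 0 ≤ g e := fun e he =>
    intervalIntegral.integral_nonneg (hlt e he).le fun t _ => abs_nonneg _
  have hE0 : ∀ e ∈ Finset.range n, 0 ≤ E e := fun e he => polyInt_sq_nonneg (hlt e he).le _
  -- The variation of `u` is accumulated from the left end, where `u` vanishes, using continuity at
  -- the nodes.
  have h₁ : ∀ e < n, ∀ t, x.node e ≤ t → t ≤ x.node (e + 1) →
      |(u e).eval t| ≤ ∑ e' ∈ Finset.range (e + 1), g e' := by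
    intro e
    induction e with
    | zero =>
      intro he t ht₁ ht₂
      have := abs_eval_sub_le (u 0) ht₁ ht₂
      rw [hu, x.elemPoly_left hn, sub_zero] at this
      simpa using this
    | succ e ih =>
      intro he t ht₁ ht₂
      have h₂ := abs_eval_sub_le (u (e + 1)) ht₁ ht₂
      have h₃ := ih (by omega) (x.node (e + 1)) (x.node_lt e (by omega)).le le_rfl
      rw [hu, x.elemPoly_continuous _ v he, ← hu] at h₃
      rw [Finset.sum_range_succ]
      have h₄ := abs_sub_abs_le_abs_sub ((u (e + 1)).eval t) ((u (e + 1)).eval (x.node (e + 1)))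
      simp only [hg] at h₃ ⊢
      linarith
  set G := ∑ e ∈ Finset.range n, g e with hG
  have h₂ : ∀ e ∈ Finset.range n, polyInt (x.node e) (x.node (e + 1)) (u e ^ 2) ≤
      (x.node (e + 1) - x.node e) * G ^ 2 := by
    intro e he
    refine polyInt_le_of_le (hlt e he).le fun t ht => ?_
    rw [eval_pow, ← sq_abs]
    refine pow_le_pow_left₀ (abs_nonneg _) ((h₁ e (Finset.mem_range.1 he) t ht.1 ht.2).trans ?_) 2
    refine Finset.sum_le_sum_of_subset_of_nonneg ?_ fun i hi _ => hg0 i hi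
    have := Finset.mem_range.1 he
    intro i hi
    rw [Finset.mem_range] at *
    omega
  -- Cauchy–Schwarz on each element and then over the elements; the latter produces the factor `n`,
  -- harmless inside a logarithm.
  have h₃ : G ^ 2 ≤ n * ((b - a) * ∑ e ∈ Finset.range n, E e) := by
    have h₄ := sq_sum_le_card_mul_sum_sq (s := Finset.range n) (f := g)
    rw [Finset.card_range] at h₄
    refine h₄.trans (mul_le_mul_of_nonneg_left ?_ (Nat.cast_nonneg n))
    rw [Finset.mul_sum]
    refine Finset.sum_le_sum fun e he => ?_
    refine (sq_integral_abs_le (hlt e he) (derivative (u e))).trans ?_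
    exact mul_le_mul_of_nonneg_right (x.length_le (Finset.mem_range.1 he)) (hE0 e he)
  calc ∑ e ∈ Finset.range n, polyInt (x.node e) (x.node (e + 1)) (u e ^ 2)
      ≤ ∑ e ∈ Finset.range n, (x.node (e + 1) - x.node e) * G ^ 2 := Finset.sum_le_sum h₂
    _ = (b - a) * G ^ 2 := by rw [← Finset.sum_mul, x.sum_length]
    _ ≤ (b - a) * (n * ((b - a) * ∑ e ∈ Finset.range n, E e)) :=
      mul_le_mul_of_nonneg_left h₃ (by linarith)
    _ = _ := by ring

theorem screened_quadratic (ω : ℝ) (v : Fin (bc.dof n p) → ℝ) :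
    v ⬝ᵥ (x.screened bc ω p).mulVec v = v ⬝ᵥ (x.stiffness bc p).mulVec v +
      ω ^ 2 / 2 * (v ⬝ᵥ (x.mass bc p).mulVec v) := by
  rw [screened, Matrix.add_mulVec, dotProduct_add, Matrix.smul_mulVec, dotProduct_smul,
    smul_eq_mul]

/-- A lower bound of the generalised eigenvalues, up to the number of elements. -/
def _root_.GenADI.BC.eigLower (bc : BC) (a b ω : ℝ) : ℝ :=
  match bc with
  | .dirichlet => 1 / (b - a) ^ 2
  | .neumann => ω ^ 2 / 2

theorem _root_.GenADI.BC.eigLower_pos {bc : BC} {a b ω : ℝ} (hab : a < b)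
    (hω : bc = BC.neumann → ω ≠ 0) : 0 < bc.eigLower a b ω := by
  cases bc with
  | dirichlet => exact one_div_pos.2 (pow_pos (sub_pos.2 hab) 2)
  | neumann =>
    have : 0 < ω ^ 2 := by have := hω rfl; positivity
    exact half_pos this

/-- For Dirichlet conditions the Poincaré inequality bounds the stiffness part from below; for
Neumann conditions the term with `ω²` alone suffices. -/
theorem eigLower_mul_le (hn : 0 < n) (ω : ℝ) (v : Fin (bc.dof n p) → ℝ) :
    bc.eigLower a b ω / n * (v ⬝ᵥ (x.mass bc p).mulVec v) ≤
      v ⬝ᵥ (x.screened bc ω p).mulVec v := by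
  have hM : 0 ≤ v ⬝ᵥ (x.mass bc p).mulVec v := by
    simpa using (x.mass_posDef bc hn).posSemidef.dotProduct_mulVec_nonneg v
  have hn' : (1 : ℝ) ≤ n := by exact_mod_cast hn
  rw [x.screened_quadratic]
  cases bc with
  | dirichlet =>
    have h₁ := x.mass_le_stiffness hn v
    have hab : 0 < b - a := sub_pos.2 (x.lt hn)
    have h₂ : 0 ≤ ω ^ 2 / 2 * (v ⬝ᵥ (x.mass .dirichlet p).mulVec v) :=
      mul_nonneg (by positivity) hM
    refine le_trans ?_ (le_add_of_nonneg_right h₂)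
    rw [BC.eigLower, div_div, one_div_mul_eq_div, div_le_iff₀ (by positivity)]
    linarith
  | neumann =>
    have h₁ := x.stiffness_nonneg .neumann v
    refine le_trans ?_ (le_add_of_nonneg_left h₁)
    refine mul_le_mul_of_nonneg_right ?_ hM
    exact div_le_self (by change 0 ≤ ω ^ 2 / 2; positivity) hn'

theorem screened_posDef (hn : 0 < n) {ω : ℝ} (hω : bc = BC.neumann → ω ≠ 0) :
    (x.screened bc ω p).PosDef := by
  refine Matrix.PosDef.of_dotProduct_mulVec_pos ?_ fun v hv => ?_
  · rw [Matrix.IsHermitian, Matrix.conjTranspose_eq_transpose_of_trivial,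
      (x.screened_conforms bc ω p).1]
  · have h₁ := (x.mass_posDef bc hn (p := p)).dotProduct_mulVec_pos hv
    rw [star_trivial] at *
    refine lt_of_lt_of_le (mul_pos (div_pos (BC.eigLower_pos (x.lt hn) hω) ?_) h₁)
      (x.eigLower_mul_le bc hn ω v)
    exact_mod_cast hn

theorem natDegree_elemPoly_le (hp : 1 ≤ p) (v : Fin (bc.dof n p) → ℝ) {e : ℕ} (he : e < n) :
    (x.elemPoly bc v e).natDegree ≤ p := by
  refine natDegree_sum_le_of_forall_le _ _ fun i _ => (natDegree_smul_le _ _).trans ?_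
  rcases lt_or_ge (i : ℕ) (bc.numHats n) with hi | hi
  · unfold basisPoly
    rw [if_pos hi]
    exact (x.natDegree_hatPoly_le _ _).trans hp
  · refine (x.natDegree_basisPoly_le bc he hi).trans ?_
    have h₁ : (i : ℕ) < bc.numHats n + n * (p - 1) := i.2
    have h₂ : ((i : ℕ) - bc.numHats n) / n < p - 1 :=
      Nat.div_lt_of_lt_mul (by omega)
    revert h₂
    generalize ((i : ℕ) - bc.numHats n) / n = k
    omega

theorem QuasiUniform.le_length {x : Mesh a b n} {ρ : ℝ} (h : x.QuasiUniform ρ) {e : ℕ}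
    (he : e < n) : ρ * (b - a) ≤ n * (x.node (e + 1) - x.node e) := by
  have := Finset.sum_le_sum fun j hj => h e he j (Finset.mem_range.1 hj)
  rw [← Finset.mul_sum, x.sum_length, Finset.sum_const, Finset.card_range, nsmul_eq_mul] at this
  exact this

/-- The inverse inequality element by element, with every length at least `ρ (b - a)/n` by
quasi-uniformity. -/
theorem stiffness_le_mass (hn : 0 < n) (hp : 1 ≤ p) {ρ : ℝ} (hρ : 0 < ρ) (h : x.QuasiUniform ρ)
    (v : Fin (bc.dof n p) → ℝ) : v ⬝ᵥ (x.stiffness bc p).mulVec v ≤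
      256 * ((p : ℝ) + 1) ^ 8 * (n : ℝ) ^ 2 / (ρ * (b - a)) ^ 2 *
        (v ⬝ᵥ (x.mass bc p).mulVec v) := by
  rw [x.mass_quadratic, x.stiffness_quadratic, Finset.mul_sum]
  refine Finset.sum_le_sum fun e he => ?_
  have he' := Finset.mem_range.1 he
  have hlt := x.node_lt e he'
  have hpos : 0 < x.node (e + 1) - x.node e := sub_pos.2 hlt
  have hab : 0 < b - a := sub_pos.2 (x.lt hn)
  refine (polyInt_derivative_sq_le (x.natDegree_elemPoly_le bc hp v he') hlt).trans
    (mul_le_mul_of_nonneg_right ?_ (polyInt_sq_nonneg hlt.le _))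
  rw [div_le_div_iff₀ (by positivity) (by positivity), mul_assoc _ ((n : ℝ) ^ 2), ← mul_pow]
  exact mul_le_mul_of_nonneg_left (pow_le_pow_left₀ (by positivity) (h.le_length he') 2)
    (by positivity)

theorem genSpectrum_bounds (hn : 0 < n) (hp : 1 ≤ p) {ρ ω : ℝ} (hρ : 0 < ρ)
    (h : x.QuasiUniform ρ) {μ : ℝ} (hμ : μ ∈ genSpectrum (x.screened bc ω p) (x.mass bc p)) :
    bc.eigLower a b ω / n ≤ μ ∧
      μ ≤ 256 * ((p : ℝ) + 1) ^ 8 * (n : ℝ) ^ 2 / (ρ * (b - a)) ^ 2 + ω ^ 2 / 2 := by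
  obtain ⟨v, hv, he⟩ := mem_genSpectrum_iff.1 hμ
  have hM := (x.mass_posDef bc hn (p := p)).dotProduct_mulVec_pos hv
  rw [star_trivial] at hM
  have hq : v ⬝ᵥ (x.screened bc ω p).mulVec v = μ * (v ⬝ᵥ (x.mass bc p).mulVec v) := by
    rw [he, dotProduct_smul, smul_eq_mul]
  have h₁ := x.eigLower_mul_le bc hn ω v
  have h₂ := x.stiffness_le_mass bc hn hp hρ h v
  rw [hq] at h₁
  rw [x.screened_quadratic] at hq
  refine ⟨le_of_mul_le_mul_right h₁ hM, le_of_mul_le_mul_right ?_ hM⟩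
  rw [← hq, add_mul]
  linarith

end Mesh

/-! ### The programs -/

/-- The addresses of the entries of block `j` of a list of `M × N` blocks, starting at `o`. -/
def blockAddr {J M N : ℕ} (o : ℕ) (j : Fin J) : Fin M → Fin N → ℕ :=
  matAddr (o + j * (M * N))

theorem holdsMat_flatten {J M N o : ℕ} (l : List ℝ) (X : Fin J → Matrix (Fin M) (Fin N) ℝ)
    (ho : o = l.length) (j : Fin J) :
    HoldsMat (l ++ (List.ofFn fun j => matList (X j)).flatten) (blockAddr o j) (X j) := by
  intro i k
  have hlt : (i : ℕ) * N + k < M * N := by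
    calc (i : ℕ) * N + k < i * N + N := Nat.add_lt_add_left k.2 _
      _ = (i + 1) * N := by ring
      _ ≤ M * N := Nat.mul_le_mul_right _ i.2
  refine Holds.append_right (i := j * (M * N) + (i * N + k)) ?_ ?_
  · unfold Holds
    rw [getElem?_flatten_ofFn _ (fun j => length_matList (X j)) j hlt, getElem?_matList]
  · rw [ho, blockAddr, matAddr, add_assoc]

theorem holdsVec_ofFn {J o : ℕ} (l : List ℝ) (v : Fin J → ℝ) (ho : o = l.length) :
    HoldsVec (l ++ List.ofFn v) (fun j : Fin J => o + j) v := by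
  intro j
  refine Holds.append_right (i := j) ?_ (by rw [ho])
  simp [Holds]

theorem HoldsVec.append {J : ℕ} {mem l : List ℝ} {t : Fin J → ℕ} {v : Fin J → ℝ}
    (h : HoldsVec mem t v) : HoldsVec (mem ++ l) t v := h.mono (List.prefix_append _ _)

/-- The precomputation program; extreme eigenvalues are computed to relative accuracy `1 / s`. -/
def preProg (s : ℕ) (bc : BC) (m n p : ℕ) : Prog :=
  let M := bc.dof m p
  let N := bc.dof n p
  (preFrag (femPattern bc m p) (femPattern bc n p) s (matAddr 0) (matAddr (M * M))
    (matAddr (M * M + N * N)) (matAddr (M * M + N * N + N * N))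
    (M * M + N * N + N * N + M * M)).toProg (M * M + N * N + N * N + M * M + 1)

/-- The solve program. -/
def solveProg (bc : BC) (m n p J : ℕ) : Prog :=
  let M := bc.dof m p
  let N := bc.dof n p
  let o := M * M + N * N + N * N + M * M + 4
  (solveFrag (femPattern bc m p) (femPattern bc n p) J (matAddr 0) (matAddr (M * M))
    (matAddr (M * M + N * N)) (matAddr (M * M + N * N + N * N))
    (matAddr (o + J + J + J * (M * M) + J * (N * N)))
    (fun j => o + j) (fun j => o + J + j) (blockAddr (o + J + J))
    (blockAddr (o + J + J + J * (M * M)))).toProg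
    (o + J + J + J * (M * M) + J * (N * N) + M * N)

/-! ### Correctness and cost of the programs for a discretisation -/

namespace Discretisation

variable {bc : BC} {a b c d ω : ℝ} {m n p : ℕ} (P : Discretisation bc a b c d ω m n p)

theorem length_matrices : P.matrices.length = bc.dof m p * bc.dof m p + bc.dof n p * bc.dof n p +
    bc.dof n p * bc.dof n p + bc.dof m p * bc.dof m p := by
  simp only [matrices, List.length_append, length_matList]

theorem holdsMat_matA : HoldsMat P.matrices (matAddr 0) P.matA :=
  ((holdsMat_matList [] P.matA rfl).append.append.append :)

theorem holdsMat_matB :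
    HoldsMat P.matrices (matAddr (bc.dof m p * bc.dof m p)) P.matB :=
  (holdsMat_matList _ P.matB (length_matList _).symm).append.append

theorem holdsMat_matC :
    HoldsMat P.matrices (matAddr (bc.dof m p * bc.dof m p + bc.dof n p * bc.dof n p)) P.matC :=
  (holdsMat_matList _ P.matC (by simp only [List.length_append, length_matList])).append

theorem holdsMat_matD :
    HoldsMat P.matrices (matAddr (bc.dof m p * bc.dof m p + bc.dof n p * bc.dof n p +
      bc.dof n p * bc.dof n p)) P.matD :=
  holdsMat_matList _ P.matD (by simp only [List.length_append, length_matList])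

theorem conforms_matA : (femPattern bc m p).Conforms P.matA := P.x.screened_conforms bc ω p

theorem conforms_neg_matB : (femPattern bc n p).Conforms (-P.matB) := by
  rw [matB, neg_neg]
  exact P.y.screened_conforms bc ω p

theorem conforms_matB : (femPattern bc n p).Conforms P.matB := by
  rw [matB, ← neg_one_smul ℝ]
  exact (P.y.screened_conforms bc ω p).smul _

theorem posDef_matA : P.matA.PosDef := P.x.screened_posDef bc P.one_le_m P.omega_ne_zero

theorem posDef_neg_matB : (-P.matB).PosDef := by
  rw [matB, neg_neg]
  exact P.y.screened_posDef bc P.one_le_n P.omega_ne_zero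

theorem posDef_matC : P.matC.PosDef := P.y.mass_posDef bc P.one_le_n

theorem posDef_matD : P.matD.PosDef := P.x.mass_posDef bc P.one_le_m

theorem dof_x_le_maxDof : bc.dof m p ≤ P.maxDof := le_max_left _ _

theorem dof_y_le_maxDof : bc.dof n p ≤ P.maxDof := le_max_right _ _

theorem one_le_maxDof : 1 ≤ P.maxDof := le_trans P.dof_x_pos P.dof_x_le_maxDof

theorem one_le_numElem : 1 ≤ P.numElem := P.one_le_m.trans (le_max_left _ _)

theorem one_le_J {P : Discretisation bc a b c d ω m n p} {δ ε : ℝ} (hδ : δ < 1) (hε₀ : 0 < ε)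
    (hε₁ : ε < 1) {S : ADIData (bc.dof m p) (bc.dof n p)} (hS : P.IsPre δ ε S) : 1 ≤ S.J := by
  have h := hS.encl_right
  rw [← neg_neg P.matB] at h
  have := h.of_neg.pos P.posDef_neg_matB P.posDef_matC hδ
  rw [hS.count]
  exact one_le_adiCount (hS.encl_left.pos P.posDef_matA P.posDef_matD hδ) hS.encl_left.1
    hS.encl_right.1 (by linarith) hε₀ hε₁

theorem preProg_correct {δ : ℝ} (hδ₁ : δ < 1) {s : ℕ} (hs : 0 < s) (hsδ : 1 / (s : ℝ) ≤ δ)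
    (ε : ℝ) : ∃ S : ADIData (bc.dof m p) (bc.dof n p), P.IsPre δ ε S ∧
      (preProg s bc m n p).output (P.preInput ε) = S.toList ∧
      ((preProg s bc m n p).cost (P.preInput ε) : ℝ) ≤
        (600 + 560 * s) * ((P.numElem : ℝ) * (P.maxDof : ℝ) ^ 2 + (S.J : ℝ) * (P.maxDof : ℝ)) := by
  obtain ⟨S, hS, hk⟩ := preFrag_computes P.dof_x_pos P.dof_y_pos P.conforms_matA
    P.conforms_neg_matB (P.y.mass_conforms bc p) (P.x.mass_conforms bc p) P.posDef_matA
    P.posDef_neg_matB P.posDef_matC P.posDef_matD hs hsδ hδ₁ (ε := ε) (mem := P.preInput ε)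
    P.holdsMat_matA.append P.holdsMat_matB.append P.holdsMat_matC.append P.holdsMat_matD.append
    (Holds.append_right (i := 0) rfl P.length_matrices.symm)
  obtain ⟨h₁, h₂⟩ := Frag.Computes.toProg (Q := (· = S.toList)) hk
    (s := bc.dof m p * bc.dof m p + bc.dof n p * bc.dof n p +
      bc.dof n p * bc.dof n p + bc.dof m p * bc.dof m p + 1)
    (by rw [preInput, List.length_append, P.length_matrices]; rfl)
  refine ⟨S, hS, h₁, (Nat.cast_le.2 h₂).trans ?_⟩
  have hM : (bc.dof m p : ℝ) ≤ P.maxDof := Nat.cast_le.2 P.dof_x_le_maxDof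
  have hN : (bc.dof n p : ℝ) ≤ P.maxDof := Nat.cast_le.2 P.dof_y_le_maxDof
  have hM2 := pow_le_pow_left₀ (Nat.cast_nonneg _) hM 2
  have hN2 := pow_le_pow_left₀ (Nat.cast_nonneg _) hN 2
  have h1 : (1 : ℝ) ≤ P.maxDof := Nat.one_le_cast.2 P.one_le_maxDof
  have he : (1 : ℝ) ≤ P.numElem := Nat.one_le_cast.2 P.one_le_numElem
  push_cast
  calc (170 + 280 * (s : ℝ)) * (bc.dof m p : ℝ) ^ 2 + (172 + 280 * s) * (bc.dof n p : ℝ) ^ 2 + 64 +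
        S.J * (103 + 65 * (bc.dof m p + bc.dof n p))
      ≤ (170 + 280 * (s : ℝ)) * (P.maxDof : ℝ) ^ 2 + (172 + 280 * s) * (P.maxDof : ℝ) ^ 2 +
        64 * (P.maxDof : ℝ) ^ 2 +
        S.J * (103 * P.maxDof + 65 * (P.maxDof + P.maxDof)) := by
        have : (64 : ℝ) ≤ 64 * (P.maxDof : ℝ) ^ 2 :=
          le_mul_of_one_le_right (by norm_num) (one_le_pow₀ h1)
        have : (103 : ℝ) ≤ 103 * P.maxDof := le_mul_of_one_le_right (by norm_num) h1
        gcongr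
    _ = (406 + 560 * s) * (1 * (P.maxDof : ℝ) ^ 2) + 233 * (S.J * P.maxDof) := by ring
    -- The eigenvalue search is already quadratic in `N`; the factor `numElem ≥ 1` only weakens the
    -- bound.
    _ ≤ (600 + 560 * s) * ((P.numElem : ℝ) * (P.maxDof : ℝ) ^ 2) +
        (600 + 560 * s) * (S.J * P.maxDof) := by
        have : (0 : ℝ) ≤ s := Nat.cast_nonneg s
        gcongr <;> linarith
    _ = _ := by ring

theorem solve_cost_le {J M N K : ℝ} (hJ : 1 ≤ J) (hN₀ : 0 ≤ N) (hM : M ≤ K)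
    (hN : N ≤ K) (hK : 1 ≤ K) :
    J * (10 * (M + N) + 88 * (M * N)) + 55 * N + 22 * (M * N) + 2 ≤ 200 * (J * K ^ 2) := by
  have h₁ : M * N ≤ K ^ 2 := by
    rw [sq]
    exact mul_le_mul hM hN hN₀ (by linarith)
  have h₂ : K ≤ K ^ 2 := le_self_pow₀ hK two_ne_zero
  have h₃ : J * (10 * (M + N) + 88 * (M * N)) ≤ J * (108 * K ^ 2) :=
    mul_le_mul_of_nonneg_left (by linarith) (by linarith)
  have h₄ : 1 * K ^ 2 ≤ J * K ^ 2 := mul_le_mul_of_nonneg_right hJ (by linarith)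
  linarith

theorem solveProg_correct {δ ε : ℝ} (hδ : δ < 1) (hε₀ : 0 < ε) (hε₁ : ε < 1)
    {S : ADIData (bc.dof m p) (bc.dof n p)} (hS : P.IsPre δ ε S)
    (F : Matrix (Fin (bc.dof m p)) (Fin (bc.dof n p)) ℝ) :
    (solveProg bc m n p S.J).output (P.solveInput S F) = matList (P.solution S F) ∧
      ((solveProg bc m n p S.J).cost (P.solveInput S F) : ℝ) ≤
        200 * ((S.J : ℝ) * (P.maxDof : ℝ) ^ 2) := by
  have hin : P.solveInput S F = P.matrices ++ [S.a, S.b, S.c, S.d] ++ List.ofFn S.p ++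
      List.ofFn S.q ++ (List.ofFn fun j => matList (S.L j)).flatten ++
      (List.ofFn fun j => matList (S.R j)).flatten ++ matList F := by
    simp only [solveInput, ADIData.toList, List.append_assoc]
  have h₀ : (P.matrices ++ [S.a, S.b, S.c, S.d]).length = bc.dof m p * bc.dof m p +
      bc.dof n p * bc.dof n p + bc.dof n p * bc.dof n p + bc.dof m p * bc.dof m p + 4 := by
    rw [List.length_append, P.length_matrices]
    rfl
  set l₀ := P.matrices ++ [S.a, S.b, S.c, S.d] with hl₀
  have h₁ : (l₀ ++ List.ofFn S.p).length = l₀.length + S.J := by simp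
  have h₂ : (l₀ ++ List.ofFn S.p ++ List.ofFn S.q).length = l₀.length + S.J + S.J := by
    simp [add_assoc]
  have h₃ : (l₀ ++ List.ofFn S.p ++ List.ofFn S.q ++
      (List.ofFn fun j => matList (S.L j)).flatten).length =
      l₀.length + S.J + S.J + S.J * (bc.dof m p * bc.dof m p) := by
    rw [List.length_append, h₂, length_flatten_ofFn _ fun j => length_matList (S.L j)]
  have h₄ : (l₀ ++ List.ofFn S.p ++ List.ofFn S.q ++
      (List.ofFn fun j => matList (S.L j)).flatten ++
      (List.ofFn fun j => matList (S.R j)).flatten).length =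
      l₀.length + S.J + S.J + S.J * (bc.dof m p * bc.dof m p) +
        S.J * (bc.dof n p * bc.dof n p) := by
    rw [List.length_append, h₃, length_flatten_ofFn _ fun j => length_matList (S.R j)]
  have hpre : P.matrices <+: P.solveInput S F := by
    rw [solveInput, List.append_assoc]
    exact List.prefix_append _ _
  have hk := solveFrag_computes P.conforms_matA P.conforms_matB (P.y.mass_conforms bc p)
    (P.x.mass_conforms bc p) P.posDef_matC hS (F := F) (mem := P.solveInput S F)
    (P.holdsMat_matA.mono hpre) (P.holdsMat_matB.mono hpre) (P.holdsMat_matC.mono hpre)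
    (P.holdsMat_matD.mono hpre) (hin ▸ holdsMat_matList _ F h₄.symm)
    (hin ▸ (holdsVec_ofFn l₀ S.p rfl).append.append.append.append)
    (hin ▸ (holdsVec_ofFn _ S.q h₁.symm).append.append.append)
    (fun j => hin ▸ (holdsMat_flatten _ S.L h₂.symm j).append.append)
    (fun j => hin ▸ (holdsMat_flatten _ S.R h₃.symm j).append)
  rw [h₀] at hk
  obtain ⟨h₅, h₆⟩ := Frag.Computes.toProg (Q := (· = matList (P.solution S F))) hk
    (s := bc.dof m p * bc.dof m p + bc.dof n p * bc.dof n p +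
    bc.dof n p * bc.dof n p + bc.dof m p * bc.dof m p + 4 + S.J + S.J +
    S.J * (bc.dof m p * bc.dof m p) + S.J * (bc.dof n p * bc.dof n p) + bc.dof m p * bc.dof n p)
    (by rw [hin, List.length_append, h₄, h₀, length_matList])
  refine ⟨h₅, (Nat.cast_le.2 h₆).trans ?_⟩
  push_cast
  exact solve_cost_le (Nat.one_le_cast.2 (one_le_J hδ hε₀ hε₁ hS)) (Nat.cast_nonneg _)
    (Nat.cast_le.2 P.dof_x_le_maxDof) (Nat.cast_le.2 P.dof_y_le_maxDof) (Nat.one_le_cast.2 P.one_le_maxDof)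

end Discretisation

/-! ### The number of iterations on quasi-uniform meshes -/

theorem half_le_log {x : ℝ} (hx : 2 ≤ x) : 1 / 2 ≤ Real.log x := by
  have h₁ := Real.log_two_gt_d9
  have h₂ := Real.log_le_log two_pos hx
  linarith

theorem half_le_log_inv {ε : ℝ} (hε₀ : 0 < ε) (hε₁ : ε ≤ 1 / 2) : 1 / 2 ≤ Real.log ε⁻¹ := by
  refine half_le_log ?_
  rw [le_inv_comm₀ two_pos hε₀]
  linarith

/-- The logarithm of a polynomial bound on `γ` is `O(log N)`. Both `log N` and `log ε⁻¹` are at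
least `1/2`, which absorbs constants: the two factors give `3 (2 |log 16C| + 11)`, and rounding up
adds `1 ≤ 4 log N log ε⁻¹`. -/
theorem adiCount_le {a b c d ε C N : ℝ} (hγ : 1 < adiGamma a b c d)
    (hC : adiGamma a b c d ≤ C * N ^ 11) (hN : 2 ≤ N) (hε₀ : 0 < ε) (hε₁ : ε ≤ 1 / 2) :
    (adiCount a b c d ε : ℝ) ≤
      (6 * |Real.log (16 * C)| + 37) * (Real.log N * Real.log ε⁻¹) := by
  have h₁ := half_le_log hN
  have h₂ := half_le_log_inv hε₀ hε₁
  have hC₀ : 0 < C := pos_of_mul_pos_left (by linarith) (by positivity : 0 ≤ N ^ 11)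
  have h₃ : Real.log (16 * adiGamma a b c d) ≤
      (2 * |Real.log (16 * C)| + 11) * Real.log N := by
    have h₄ : Real.log (16 * adiGamma a b c d) ≤ Real.log (16 * C * N ^ 11) :=
      Real.log_le_log (by linarith) (by linarith)
    rw [Real.log_mul (x := 16 * C) (by positivity) (by positivity), Real.log_pow] at h₄
    have h₅ := le_abs_self (Real.log (16 * C))
    have h₆ := mul_le_mul_of_nonneg_left h₁ (abs_nonneg (Real.log (16 * C)))
    push_cast at h₄
    linarith
  have h₄ : Real.log (4 / ε) ≤ 3 * Real.log ε⁻¹ := by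
    have h₅ : Real.log 2 ≤ Real.log ε⁻¹ := Real.log_le_log two_pos (by
      rw [le_inv_comm₀ two_pos hε₀]
      linarith)
    rw [div_eq_mul_inv, Real.log_mul (by norm_num) (by positivity),
      show (4 : ℝ) = 2 ^ 2 by norm_num, Real.log_pow]
    push_cast
    linarith
  have h₅ : 0 ≤ Real.log (4 / ε) := Real.log_nonneg (by
    rw [le_div_iff₀ hε₀]
    linarith)
  have h₆ : 0 ≤ Real.log (16 * adiGamma a b c d) := Real.log_nonneg (by linarith)
  have h₇ : 1 ≤ Real.pi ^ 2 := one_le_pow₀ (by linarith [Real.pi_gt_three])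
  have h₈ : 1 ≤ 4 * (Real.log N * Real.log ε⁻¹) := by nlinarith
  have h₉ := mul_le_mul h₃ h₄ h₅ (h₆.trans h₃)
  have h₁₀ := div_le_self (mul_nonneg h₆ h₅) h₇
  refine (Nat.ceil_lt_add_one (div_nonneg (mul_nonneg h₆ h₅) (by positivity))).le.trans ?_
  linarith

theorem BC.elements_le_dof (bc : BC) {n p : ℕ} (hn : 1 ≤ n) (hp : 1 ≤ p) :
    n ≤ bc.dof n p + 1 ∧ p ≤ bc.dof n p + 1 := by
  obtain ⟨k, rfl⟩ := Nat.exists_eq_add_of_le' hp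
  obtain ⟨l, rfl⟩ := Nat.exists_eq_add_of_le' hn
  have : k ≤ (l + 1) * k := Nat.le_mul_of_pos_left k l.succ_pos
  cases bc <;> simp only [dof, numHats, Nat.add_sub_cancel] <;> omega

theorem IsEnclosure.div_le {S : Set ℝ} {δ a b lo hi : ℝ} (hδ₀ : 0 ≤ δ) (hδ₁ : δ < 1)
    (h : IsEnclosure δ S a b) (hlo : 0 < lo) (hS : ∀ s ∈ S, lo ≤ s ∧ s ≤ hi) :
    b / a ≤ (1 + δ) * hi / ((1 - δ) * lo) := by
  obtain ⟨hab, -, ⟨s, hs, h₁⟩, ⟨t, ht, h₂⟩⟩ := h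
  have hs₀ := hlo.trans_le (hS s hs).1
  have ht₀ := hlo.trans_le (hS t ht).1
  rw [abs_of_pos hs₀] at h₁
  rw [abs_of_pos ht₀] at h₂
  have h₃ := (neg_abs_le (a - s)).trans' (neg_le_neg h₁)
  have h₄ := (le_abs_self (b - t)).trans h₂
  have h₅ : (1 - δ) * lo ≤ a := by
    have := mul_le_mul_of_nonneg_left (hS s hs).1 (sub_pos.2 hδ₁).le
    linarith
  have h₆ : b ≤ (1 + δ) * hi := by
    have := mul_le_mul_of_nonneg_left (hS t ht).2 (by linarith : 0 ≤ 1 + δ)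
    linarith
  have h₇ : 0 < (1 - δ) * lo := mul_pos (sub_pos.2 hδ₁) hlo
  exact div_le_div₀ (by linarith) h₆ h₇ h₅

namespace Discretisation

variable {bc : BC} {a b c d ω : ℝ} {m n p : ℕ} {P : Discretisation bc a b c d ω m n p}

/-- Of the eleven powers of `N`, eight come from `(p + 1)^8` and two from `m²` in the upper
eigenvalue bound, one from the division by `m` in the lower bound. As `p + 1` and `m` are at most `2
N`, the constants are `256 * 2^8 * 2^2 = 262144` and a further `2`. -/
theorem adiGamma_le_pow {δ ε ρ : ℝ} (hδ₀ : 0 ≤ δ) (hδ₁ : δ < 1) (hρ : 0 < ρ)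
    (hx : P.x.QuasiUniform ρ) (hN : 2 ≤ P.maxDof) {S : ADIData (bc.dof m p) (bc.dof n p)}
    (hS : P.IsPre δ ε S) : 1 < adiGamma S.a S.b S.c S.d ∧ adiGamma S.a S.b S.c S.d ≤
      (1 + δ) * (262144 / (ρ * (b - a)) ^ 2 + ω ^ 2 / 2) * 2 /
        ((1 - δ) * bc.eigLower a b ω) * (P.maxDof : ℝ) ^ 11 := by
  have ha := hS.encl_left.pos P.posDef_matA P.posDef_matD hδ₁
  have hd : S.d < 0 := by
    have h := hS.encl_right
    rw [← neg_neg P.matB] at h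
    linarith [h.of_neg.pos P.posDef_neg_matB P.posDef_matC hδ₁]
  have hlow := BC.eigLower_pos (P.x.lt P.one_le_m) P.omega_ne_zero
  have hm : (0 : ℝ) < m := Nat.cast_pos.2 P.one_le_m
  have hN' : (1 : ℝ) ≤ P.maxDof := Nat.one_le_cast.2 P.one_le_maxDof
  obtain ⟨h₁, h₂⟩ := bc.elements_le_dof P.one_le_m P.one_le_p
  have h₃ := P.dof_x_le_maxDof
  have hm' : (m : ℝ) ≤ 2 * P.maxDof := by
    have : m ≤ 2 * P.maxDof := by omega
    exact_mod_cast this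
  have hp' : (p : ℝ) + 1 ≤ 2 * P.maxDof := by
    have : p + 1 ≤ 2 * P.maxDof := by omega
    exact_mod_cast this
  refine ⟨one_lt_adiGamma ha hS.encl_left.1 hS.encl_right.1 hd,
    (adiGamma_le ha hS.encl_left.1 hS.encl_right.1 hd).trans ?_⟩
  refine (hS.encl_left.div_le hδ₀ hδ₁ (div_pos hlow hm) fun s hs =>
    P.x.genSpectrum_bounds bc P.one_le_m P.one_le_p hρ hx hs).trans ?_
  have h₄ : 256 * ((p : ℝ) + 1) ^ 8 * (m : ℝ) ^ 2 / (ρ * (b - a)) ^ 2 + ω ^ 2 / 2 ≤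
      (262144 / (ρ * (b - a)) ^ 2 + ω ^ 2 / 2) * (P.maxDof : ℝ) ^ 10 := by
    have h₅ : 256 * ((p : ℝ) + 1) ^ 8 * (m : ℝ) ^ 2 / (ρ * (b - a)) ^ 2 ≤
        256 * (2 * (P.maxDof : ℝ)) ^ 8 * (2 * P.maxDof) ^ 2 / (ρ * (b - a)) ^ 2 := by gcongr
    have h₆ : ω ^ 2 / 2 ≤ ω ^ 2 / 2 * (P.maxDof : ℝ) ^ 10 :=
      le_mul_of_one_le_right (by positivity) (one_le_pow₀ hN')
    calc _ ≤ _ := add_le_add h₅ h₆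
      _ = _ := by ring
  have h₇ : 0 < 1 - δ := sub_pos.2 hδ₁
  calc _ ≤ (1 + δ) * ((262144 / (ρ * (b - a)) ^ 2 + ω ^ 2 / 2) * (P.maxDof : ℝ) ^ 10) /
        ((1 - δ) * (bc.eigLower a b ω / m)) := by gcongr
    _ = (1 + δ) * ((262144 / (ρ * (b - a)) ^ 2 + ω ^ 2 / 2) * (P.maxDof : ℝ) ^ 10) * m /
        ((1 - δ) * bc.eigLower a b ω) := by field_simp
    _ ≤ (1 + δ) * ((262144 / (ρ * (b - a)) ^ 2 + ω ^ 2 / 2) * (P.maxDof : ℝ) ^ 10) *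
        (2 * P.maxDof) / ((1 - δ) * bc.eigLower a b ω) := by gcongr
    _ = _ := by ring

theorem exists_J_le (bc : BC) (a b c d ω : ℝ) {δ ρ : ℝ} (hδ₀ : 0 ≤ δ) (hδ₁ : δ < 1)
    (hρ : 0 < ρ) : ∃ K : ℝ, 0 ≤ K ∧ ∀ (m n p : ℕ) (P : Discretisation bc a b c d ω m n p),
      P.x.QuasiUniform ρ → 2 ≤ P.maxDof → ∀ ε : ℝ, 0 < ε → ε ≤ 1 / 2 →
      ∀ S : ADIData (bc.dof m p) (bc.dof n p), P.IsPre δ ε S →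
        (S.J : ℝ) ≤ K * (Real.log (P.maxDof : ℝ) * Real.log ε⁻¹) := by
  refine ⟨6 * |Real.log (16 * ((1 + δ) * (262144 / (ρ * (b - a)) ^ 2 + ω ^ 2 / 2) * 2 /
    ((1 - δ) * bc.eigLower a b ω)))| + 37, by positivity, fun m n p P hx hN ε hε₀ hε₁ S hS => ?_⟩
  obtain ⟨h₁, h₂⟩ := adiGamma_le_pow hδ₀ hδ₁ hρ hx hN hS
  rw [hS.count]
  exact adiCount_le h₁ h₂ (by exact_mod_cast hN) hε₀ hε₁

theorem exists_cost_le (bc : BC) (a b c d ω : ℝ) {δ ρ : ℝ} (hδ₀ : 0 ≤ δ) (hδ₁ : δ < 1)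
    (hρ : 0 < ρ) {s : ℕ} (hs : 0 < s) (hsδ : 1 / (s : ℝ) ≤ δ) :
    ∃ K : ℝ, 0 ≤ K ∧ ∀ (m n p : ℕ) (P : Discretisation bc a b c d ω m n p),
      P.x.QuasiUniform ρ → 2 ≤ P.maxDof → ∀ ε : ℝ, 0 < ε → ε ≤ 1 / 2 →
        ((preProg s bc m n p).cost (P.preInput ε) : ℝ) ≤
          K * ((P.numElem : ℝ) * (P.maxDof : ℝ) ^ 2 +
            (P.maxDof : ℝ) * Real.log (P.maxDof : ℝ) * Real.log ε⁻¹) ∧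
        ∀ S : ADIData (bc.dof m p) (bc.dof n p), P.IsPre δ ε S →
          (S.J : ℝ) ≤ K * (Real.log (P.maxDof : ℝ) * Real.log ε⁻¹) ∧
          ∀ F : Matrix (Fin (bc.dof m p)) (Fin (bc.dof n p)) ℝ,
            ((solveProg bc m n p S.J).cost (P.solveInput S F) : ℝ) ≤
              K * ((P.maxDof : ℝ) ^ 2 * Real.log (P.maxDof : ℝ) * Real.log ε⁻¹) := by
  obtain ⟨K, hK, hJ⟩ := exists_J_le bc a b c d ω hδ₀ hδ₁ hρ
  have hκ : (600 : ℝ) ≤ 600 + 560 * s := le_add_of_nonneg_right (by positivity)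
  generalize hκ' : (600 : ℝ) + 560 * s = κ at hκ
  have hκK : 0 ≤ κ * K := mul_nonneg (by linarith) hK
  refine ⟨κ * (1 + K), by linarith, fun m n p P hx hN ε hε₀ hε₁ => ?_⟩
  specialize hJ m n p P hx hN ε hε₀ hε₁
  have hl : 0 ≤ Real.log P.maxDof := by
    linarith [half_le_log (x := P.maxDof) (by exact_mod_cast hN)]
  have he : 0 ≤ Real.log ε⁻¹ := by linarith [half_le_log_inv hε₀ hε₁]
  obtain ⟨S, hS, -, h₁⟩ := P.preProg_correct hδ₁ hs hsδ ε
  have h₂ : ∀ S : ADIData (bc.dof m p) (bc.dof n p), P.IsPre δ ε S →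
      ∀ F : Matrix (Fin (bc.dof m p)) (Fin (bc.dof n p)) ℝ,
        ((solveProg bc m n p S.J).cost (P.solveInput S F) : ℝ) ≤
          200 * ((S.J : ℝ) * (P.maxDof : ℝ) ^ 2) := fun S hS F =>
    (P.solveProg_correct hδ₁ hε₀ (by linarith) hS F).2
  rw [hκ'] at h₁
  have hN₀ : (0 : ℝ) ≤ P.maxDof := Nat.cast_nonneg _
  have hν : (0 : ℝ) ≤ P.numElem := Nat.cast_nonneg _
  generalize (P.maxDof : ℝ) = N at *
  generalize Real.log N = l at *
  generalize Real.log ε⁻¹ = e at *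
  generalize (P.numElem : ℝ) = ν at *
  have hle : 0 ≤ l * e := mul_nonneg hl he
  refine ⟨h₁.trans ?_, fun S hS => ⟨(hJ S hS).trans ?_, fun F => (h₂ S hS F).trans ?_⟩⟩
  · have h₃ := mul_le_mul_of_nonneg_left
      (mul_le_mul_of_nonneg_right (hJ S hS) hN₀) (by linarith : 0 ≤ κ)
    have h₄ : 0 ≤ κ * K * (ν * N ^ 2) := by positivity
    have h₅ : 0 ≤ κ * (N * (l * e)) := mul_nonneg (by linarith) (mul_nonneg hN₀ hle)
    linarith
  · refine mul_le_mul_of_nonneg_right ?_ hle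
    have := mul_le_mul_of_nonneg_right (by linarith : 1 ≤ κ) hK
    linarith
  · have h₃ := mul_le_mul_of_nonneg_right (hJ S hS) (sq_nonneg N)
    have h₄ : 0 ≤ l * e * N ^ 2 := mul_nonneg hle (sq_nonneg N)
    have h₅ : 200 * K * (l * e * N ^ 2) ≤ κ * (1 + K) * (l * e * N ^ 2) := by
      refine mul_le_mul_of_nonneg_right ?_ h₄
      have := mul_le_mul_of_nonneg_right (by linarith : 200 ≤ κ) hK
      linarith
    linarith

/-- For a bounded number of elements, a solve dominates the precomputation up to logarithms. -/
theorem total_cost_le {N l e ν ν₀ K : ℝ} (hK : 0 ≤ K) (hN : 1 ≤ N) (hl : 1 / 2 ≤ l)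
    (he : 1 / 2 ≤ e) (hν₀ : 0 ≤ ν₀) (hν : ν ≤ ν₀) :
    K * (ν * N ^ 2 + N * l * e) ≤ K * (4 * ν₀ + 2) * (N ^ 2 + N * l * e) ∧
      K * (ν * N ^ 2 + N * l * e) + K * (N ^ 2 * l * e) ≤
        K * (4 * ν₀ + 2) * (N ^ 2 * l * e) := by
  -- Both logarithms are at least `1/2`, so `ν₀ N²` is at most `4 ν₀` times the cost bound of a
  -- solve.
  have h₁ : 1 ≤ 4 * (l * e) := by nlinarith
  have h₂ : N ≤ N ^ 2 := le_self_pow₀ hN two_ne_zero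
  have h₃ : N * (l * e) ≤ N ^ 2 * (l * e) := mul_le_mul_of_nonneg_right h₂ (by linarith)
  have h₄ : ν * N ^ 2 ≤ ν₀ * N ^ 2 := mul_le_mul_of_nonneg_right hν (sq_nonneg N)
  have h₅ : 0 ≤ ν₀ * N ^ 2 := mul_nonneg hν₀ (sq_nonneg N)
  have h₆ : ν₀ * N ^ 2 * 1 ≤ ν₀ * N ^ 2 * (4 * (l * e)) := mul_le_mul_of_nonneg_left h₁ h₅
  have h₇ : 0 ≤ N * (l * e) := mul_nonneg (by linarith) (by linarith)
  have h₈ : 0 ≤ ν₀ * (N * (l * e)) := mul_nonneg hν₀ h₇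
  constructor
  · rw [mul_assoc K]
    refine mul_le_mul_of_nonneg_left ?_ hK
    linarith [sq_nonneg N]
  · rw [← mul_add, mul_assoc K]
    refine mul_le_mul_of_nonneg_left ?_ hK
    linarith

end Discretisation

theorem exists_pos_one_div_le {δ : ℝ} (hδ : 0 < δ) : ∃ s : ℕ, 0 < s ∧ 1 / (s : ℝ) ≤ δ := by
  obtain ⟨n, hn⟩ := exists_nat_one_div_lt hδ
  exact ⟨n + 1, n.succ_pos, by exact_mod_cast hn.le⟩

end GenADI

end

/-! ### The complexity theorem -/

theorem mainTheorem6 (δ : ℝ) (hδ₀ : 0 < δ) (hδ₁ : δ < 1) :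
    ∃ (pre : GenADI.BC → ℕ → ℕ → ℕ → GenADI.Prog)
      (solve : GenADI.BC → ℕ → ℕ → ℕ → ℕ → GenADI.Prog),
      -- the precomputation costs `O(n N² + J N)`
      (∃ K : ℝ, ∀ (bc : GenADI.BC) (a b c d ω : ℝ) (m n p : ℕ)
        (P : GenADI.Discretisation bc a b c d ω m n p) (ε : ℝ), 0 < ε → ε < 1 →
        ∃ S : GenADI.ADIData (bc.dof m p) (bc.dof n p), P.IsPre δ ε S ∧
          (pre bc m n p).output (P.preInput ε) = S.toList ∧
          ((pre bc m n p).cost (P.preInput ε) : ℝ) ≤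
            K * ((P.numElem : ℝ) * (P.maxDof : ℝ) ^ 2 + (S.J : ℝ) * (P.maxDof : ℝ))) ∧
      -- each solve costs `O(J N²)`
      (∃ K : ℝ, ∀ (bc : GenADI.BC) (a b c d ω : ℝ) (m n p : ℕ)
        (P : GenADI.Discretisation bc a b c d ω m n p) (ε : ℝ), 0 < ε → ε < 1 →
        ∀ S : GenADI.ADIData (bc.dof m p) (bc.dof n p), P.IsPre δ ε S →
        ∀ F : Matrix (Fin (bc.dof m p)) (Fin (bc.dof n p)) ℝ,
          (solve bc m n p S.J).output (P.solveInput S F) = GenADI.matList (P.solution S F) ∧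
          ((solve bc m n p S.J).cost (P.solveInput S F) : ℝ) ≤
            K * ((S.J : ℝ) * (P.maxDof : ℝ) ^ 2)) ∧
      -- on quasi-uniform families `J = O(log N log ε⁻¹)`, and the costs are bounded accordingly
      (∀ (bc : GenADI.BC) (a b c d ω ρ : ℝ), 0 < ρ →
        ∃ K : ℝ, ∀ (m n p : ℕ) (P : GenADI.Discretisation bc a b c d ω m n p),
        P.x.QuasiUniform ρ → P.y.QuasiUniform ρ → 2 ≤ P.maxDof →
        ∀ ε : ℝ, 0 < ε → ε ≤ 1 / 2 →
          ((pre bc m n p).cost (P.preInput ε) : ℝ) ≤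
            K * ((P.numElem : ℝ) * (P.maxDof : ℝ) ^ 2 +
              (P.maxDof : ℝ) * Real.log (P.maxDof : ℝ) * Real.log ε⁻¹) ∧
          ∀ S : GenADI.ADIData (bc.dof m p) (bc.dof n p), P.IsPre δ ε S →
            (S.J : ℝ) ≤ K * (Real.log (P.maxDof : ℝ) * Real.log ε⁻¹) ∧
            ∀ F : Matrix (Fin (bc.dof m p)) (Fin (bc.dof n p)) ℝ,
              ((solve bc m n p S.J).cost (P.solveInput S F) : ℝ) ≤
                K * ((P.maxDof : ℝ) ^ 2 * Real.log (P.maxDof : ℝ) * Real.log ε⁻¹)) ∧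
      -- quasi-optimal complexity as `p → ∞` with a bounded number of elements
      (∀ (bc : GenADI.BC) (a b c d ω ρ : ℝ) (n₀ : ℕ), 0 < ρ →
        ∃ K : ℝ, ∀ (m n p : ℕ) (P : GenADI.Discretisation bc a b c d ω m n p),
        P.x.QuasiUniform ρ → P.y.QuasiUniform ρ → P.numElem ≤ n₀ → 2 ≤ P.maxDof →
        ∀ ε : ℝ, 0 < ε → ε ≤ 1 / 2 →
          ((pre bc m n p).cost (P.preInput ε) : ℝ) ≤
            K * ((P.maxDof : ℝ) ^ 2 +
              (P.maxDof : ℝ) * Real.log (P.maxDof : ℝ) * Real.log ε⁻¹) ∧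
          ∀ S : GenADI.ADIData (bc.dof m p) (bc.dof n p), P.IsPre δ ε S →
            ∀ F : Matrix (Fin (bc.dof m p)) (Fin (bc.dof n p)) ℝ,
              ((pre bc m n p).cost (P.preInput ε) : ℝ) +
                ((solve bc m n p S.J).cost (P.solveInput S F) : ℝ) ≤
                K * ((P.maxDof : ℝ) ^ 2 * Real.log (P.maxDof : ℝ) * Real.log ε⁻¹)) := by
  -- The search runs with relative accuracy `1/s ≤ δ`; this is the only way in which `δ` enters the
  -- programs.
  obtain ⟨s, hs, hsδ⟩ := GenADI.exists_pos_one_div_le hδ₀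
  refine ⟨GenADI.preProg s, GenADI.solveProg,
    ⟨600 + 560 * s, fun bc a b c d ω m n p P ε _ _ => P.preProg_correct hδ₁ hs hsδ ε⟩,
    ⟨200, fun bc a b c d ω m n p P ε hε₀ hε₁ S hS F =>
      P.solveProg_correct hδ₁ hε₀ hε₁ hS F⟩, ?_, ?_⟩
  · intro bc a b c d ω ρ hρ
    obtain ⟨K, -, h⟩ :=
      GenADI.Discretisation.exists_cost_le bc a b c d ω hδ₀.le hδ₁ hρ hs hsδ
    exact ⟨K, fun m n p P hx _ => h m n p P hx⟩
  · intro bc a b c d ω ρ n₀ hρ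
    obtain ⟨K, hK, h⟩ :=
      GenADI.Discretisation.exists_cost_le bc a b c d ω hδ₀.le hδ₁ hρ hs hsδ
    refine ⟨K * (4 * n₀ + 2), fun m n p P hx _ hn hN ε hε₀ hε₁ => ?_⟩
    obtain ⟨h₁, h₂⟩ := h m n p P hx hN ε hε₀ hε₁
    obtain ⟨h₃, h₄⟩ := GenADI.Discretisation.total_cost_le (N := P.maxDof)
      (ν := P.numElem) hK (by exact_mod_cast P.one_le_maxDof)
      (GenADI.half_le_log (x := P.maxDof) (by exact_mod_cast hN)) (GenADI.half_le_log_inv hε₀ hε₁)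
      (Nat.cast_nonneg n₀) (Nat.cast_le.2 hn)
    exact ⟨h₁.trans h₃, fun S hS F => (add_le_add h₁ ((h₂ S hS).2 F)).trans h₄⟩
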